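/- Let \(n\ge 2\) and \(m=n-1\). Let \(V=\{x\in\mathbb R^{n}:\sum_i x_i=0\}\) with its standard scalar product, let \(\Phi=\{e_i-e_j: i\ne j\}\subset V\) be the root system of type \(A_{n-1}\), with simple roots \(\alpha_i=e_i-e_{i+1}\) (\(1\le i\le m\)), Weyl group \(W\cong S_n\) generated by the reflections in the roots, and let \(\delta\) be half the sum of the positive roots. Let \(\mathcal C\) be the set of all subspaces of \(V\) spanned by a nonempty set of roots, let \(\mathcal F\subset\mathcal C\) be the minimal building set, i.e. the set of the subspaces spanned by irreducible root subsystems of \(\Phi\), and let \(\mathcal F_{fund}\), \(\mathcal C_{fund}\) be the sets of those members of \(\mathcal F\), \(\mathcal C\) that are spanned by some of the simple roots. For a subspace \(A\) let \(\pi_A\) be the orthogonal projection of \(\delta\) to \(A\). For \(B\subsetneq A\) in \(\mathcal F_{fund}\) let \(R^A_B\) be the maximum coefficient of \(\pi_A\) divided by the minimum coefficient of \(\pi_B\), where \(\pi_A\) (resp. \(\pi_B\)) is written as a combination of the simple roots lying in \(A\) (resp. in \(B\)), and let \(R^i_j\) be the maximum of \(R^A_B\) over all such pairs with \(\dim A=i\),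 \(\dim B=j\). A list of positive real numbers \(\epsilon_1<\epsilon_2<\dots<\epsilon_{m}=a\) is called suitable if \(\epsilon_i>2R^i_{i-1}\epsilon_{i-1}\) for \(2\le i\le m\). Given a suitable list, put \[HS_V=\{x:(x,\delta)\le a\},\qquad HS_A=\{x:(x,\delta-\pi_A)\le a-\epsilon_{\dim A}\}\quad (A\in\mathcal F_{fund},\ A\neq V),\] and, for \(B\in\mathcal C_{fund}\setminus\mathcal F_{fund}\), with \(A_1,\dots,A_s\) the maximal elements of \(\mathcal F_{fund}\) contained in \(B\) (so that \(B=A_1\oplus\dots\oplus A_s\)), \[\overline{HS}_B=\Big\{x:\Big(x,\delta-\sum_{i}\pi_{A_i}\Big)\le a-\sum_i\epsilon_{\dim A_i}\Big\}.\] The minimal permutonestohedron \(P_{\mathcal F}(A_{n-1})\) (Kapranov's permutoassociahedron) defined by this list is the intersection of all the half-spaces \(\sigma HS_A\) and \(\sigma\overline{HS}_B\) with \(\sigma\in W\), \(A\in\mathcal F_{fund}\), \(B\in\mathcal C_{fund}\setminus\mathcal F_{fund}\). For a partition \(\lambda=(\lambda_1,\dots,\lambda_{l(\lambda)})\) of \(n\)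 with \(l(\lambda)\) parts, of which \(m_i\) are equal to \(i\), put \(w(\lambda)=\dfrac{l(\lambda)!}{\prod_{1\le i\le n}m_i!}\). **Theorem.** For every suitable list and every \(0\le k\le n-2\), the number of (nonempty) faces of codimension \(k+1\) of the minimal permutonestohedron \(P_{\mathcal F}(A_{n-1})\) is finite and equal to \[\sum_{\lambda\vdash n,\ l(\lambda)\ge k+2} w(\lambda)\,\frac{n!}{\lambda_1!\,\lambda_2!\cdots\lambda_{l(\lambda)}!}\left[\frac1{k+1}\binom{l(\lambda)-2}{k}\binom{l(\lambda)+k}{k}\right].\] -/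

import Mathlib

open scoped RealInnerProductSpace

noncomputable section

namespace Permutonest

/-! ### Root arrangements and building sets

`V` is a Euclidean space, `Φ` a finite root system spanning `V`, and `Δ` a basis of simple
roots, indexed by `Fin r` where `r = dim V`. -/

section General

variable {V : Type*} [NormedAddCommGroup V] [InnerProductSpace ℝ V] [FiniteDimensional ℝ V]
variable {r : ℕ}

/-- The orthogonal reflection `s_α` in the hyperplane orthogonal to `α`. -/
def rootReflection (α : V) : V ≃ₗᵢ[ℝ] V := ((ℝ ∙ α)ᗮ).reflection

/-- The group `W` generated by the reflections in the roots. -/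
def weylGroup (Φ : Set V) : Subgroup (V ≃ₗᵢ[ℝ] V) :=
  Subgroup.closure (rootReflection '' Φ)

/-- The positive roots: those whose coordinates in the basis of simple roots are nonnegative. -/
def positiveRoots (Φ : Set V) (Δ : Module.Basis (Fin r) ℝ V) : Set V :=
  {α | α ∈ Φ ∧ ∀ i, 0 ≤ Δ.repr α i}

/-- `δ`, the half sum of the positive roots. -/
def delta (Φ : Set V) (Δ : Module.Basis (Fin r) ℝ V) : V :=
  (1 / 2 : ℝ) • ∑ᶠ α ∈ positiveRoots Φ Δ, α

/-- The maximal building set: all the subspaces spanned by some (at least one) of the roots. -/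
def spannedSubspaces (Φ : Set V) : Set (Submodule ℝ V) :=
  {A | ∃ Ψ ⊆ Φ, Ψ.Nonempty ∧ A = Submodule.span ℝ Ψ}

/-- `Ψ` is a root subsystem of `Φ`: a subset stable under its own reflections. -/
def IsSubsystem (Φ Ψ : Set V) : Prop :=
  Ψ ⊆ Φ ∧ ∀ α ∈ Ψ, ∀ β ∈ Ψ, rootReflection α β ∈ Ψ

/-- `Ψ` is irreducible: it is nonempty and is not the union of two nonempty sets of roots
that are orthogonal to each other. -/
def IsIrreducibleSystem (Ψ : Set V) : Prop :=
  Ψ.Nonempty ∧ ∀ Ψ₁ Ψ₂ : Set V, Ψ₁ ∪ Ψ₂ = Ψ → (∀ α ∈ Ψ₁, ∀ β ∈ Ψ₂, ⟪α, β⟫ = 0) →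
    Ψ₁ = ∅ ∨ Ψ₂ = ∅

/-- The minimal building set: the subspaces spanned by the irreducible root subsystems. -/
def irreducibleSubspaces (Φ : Set V) : Set (Submodule ℝ V) :=
  {A | ∃ Ψ, IsSubsystem Φ Ψ ∧ IsIrreducibleSystem Ψ ∧ A = Submodule.span ℝ Ψ}

/-- The members of a collection of subspaces that are spanned by some of the simple roots. -/
def fund (Δ : Module.Basis (Fin r) ℝ V) (G : Set (Submodule ℝ V)) : Set (Submodule ℝ V) :=
  {A | A ∈ G ∧ ∃ I : Set (Fin r), A = Submodule.span ℝ (Δ '' I)}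

/-- The components of `B` in its decomposition with respect to `G`: the maximal elements of `G`
contained in `B`. -/
def components (G : Set (Submodule ℝ V)) (B : Submodule ℝ V) : Set (Submodule ℝ V) :=
  {A | Maximal (fun C => C ∈ G ∧ C ≤ B) A}

/-- `π_A`: the component of `δ` in `A`, so that `δ - π_A` is the orthogonal projection of `δ`
to the orthogonal complement of `A`. -/
def piVec (Φ : Set V) (Δ : Module.Basis (Fin r) ℝ V) (A : Submodule ℝ V) : V :=
  A.starProjection (delta Φ Δ)

/-! ### Suitable lists -/

/-- `R^A_B`: the maximum coefficient of `π_A` divided by the minimum coefficient of `π_B`, where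
`π_A` and `π_B` are written as combinations of the simple roots that lie in `A`, respectively
in `B`. -/
def ratio (Φ : Set V) (Δ : Module.Basis (Fin r) ℝ V) (A B : Submodule ℝ V) : ℝ :=
  (⨆ i : {i : Fin r // Δ i ∈ A}, Δ.repr (piVec Φ Δ A) i) /
    (⨅ j : {j : Fin r // Δ j ∈ B}, Δ.repr (piVec Φ Δ B) j)

/-- `R^i_j`: the maximum of the (finitely many) numbers `R^A_B`, where `B ⊂ A` are members of
`G_fund` of dimension `j` and `i` respectively. -/
def maxRatio (Φ : Set V) (Δ : Module.Basis (Fin r) ℝ V) (G : Set (Submodule ℝ V))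
    (i j : ℕ) : ℝ :=
  sSup {c | ∃ A ∈ fund Δ G, ∃ B ∈ fund Δ G, B < A ∧ Module.finrank ℝ A = i ∧
    Module.finrank ℝ B = j ∧ c = ratio Φ Δ A B}

/-- `ε 1 < ε 2 < ⋯ < ε r` is a suitable list of positive numbers (the other values of `ε` are
never used). -/
structure IsSuitable (Φ : Set V) (Δ : Module.Basis (Fin r) ℝ V) (G : Set (Submodule ℝ V))
    (ε : ℕ → ℝ) : Prop where
  pos : ∀ i, 1 ≤ i → i ≤ r → 0 < ε i
  lt : ∀ i, 2 ≤ i → i ≤ r → ε (i - 1) < ε i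
  two_mul_lt : ∀ i, 2 ≤ i → i ≤ r → 2 * maxRatio Φ Δ G i (i - 1) * ε (i - 1) < ε i

/-! ### The permutonestohedron

For a suitable list all the right-hand sides below are positive, so that each of the following
half-spaces is the one that contains the origin. -/

/-- The half-space `HS_A` for `A ∈ G_fund`; here `δ_A = δ - π_A` if `A ≠ V`, and `δ_V = δ`. -/
def halfSpace (Φ : Set V) (Δ : Module.Basis (Fin r) ℝ V) (ε : ℕ → ℝ) (A : Submodule ℝ V) :
    Set V :=
  {x | (A = ⊤ → ⟪x, delta Φ Δ⟫ ≤ ε r) ∧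
    (A ≠ ⊤ → ⟪x, delta Φ Δ - piVec Φ Δ A⟫ ≤ ε r - ε (Module.finrank ℝ A))}

/-- The half-space attached to a subspace `B` that is spanned by simple roots but is not in
`G_fund`; the sums run over the components of `B` with respect to `G_fund`. -/
def halfSpaceBar (Φ : Set V) (Δ : Module.Basis (Fin r) ℝ V) (G : Set (Submodule ℝ V))
    (ε : ℕ → ℝ) (B : Submodule ℝ V) : Set V :=
  {x | ⟪x, delta Φ Δ - ∑ᶠ A ∈ components (fund Δ G) B, piVec Φ Δ A⟫ ≤
    ε r - ∑ᶠ A ∈ components (fund Δ G) B, ε (Module.finrank ℝ A)}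

/-- The permutonestohedron `P_G(Φ)` defined by the list `ε 1 < ⋯ < ε r`: the intersection of all
the images under `W` of the half-spaces above. -/
def permutonestohedron (Φ : Set V) (Δ : Module.Basis (Fin r) ℝ V) (G : Set (Submodule ℝ V))
    (ε : ℕ → ℝ) : Set V :=
  ⋂ σ ∈ weylGroup Φ,
    (⋂ A ∈ fund Δ G, σ '' halfSpace Φ Δ ε A) ∩
    (⋂ B ∈ fund Δ (spannedSubspaces Φ) \ fund Δ G, σ '' halfSpaceBar Φ Δ G ε B)

/-- The nonempty faces `F` of a polytope `P` that have codimension `c` in `P`: the nonempty sets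
of points of `P` at which some linear functional attains its maximum over `P`, with
`dim F + c = dim P`. -/
def facesOfCodim (P : Set V) (c : ℕ) : Set (Set V) :=
  {F | F.Nonempty ∧ IsExposed ℝ P F ∧
    Module.finrank ℝ (vectorSpan ℝ F) + c = Module.finrank ℝ (vectorSpan ℝ P)}

end General

/-! ### The root system `A_m` -/

/-- The hyperplane `x_0 + ⋯ + x_m = 0` of `ℝ^(m+1)`. -/
def hyperplaneA (m : ℕ) : Submodule ℝ (EuclideanSpace ℝ (Fin (m + 1))) where
  carrier := {x | ∑ i, x i = 0}
  add_mem' := by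
    intro x y hx hy
    simp only [Set.mem_ofPred_eq, PiLp.add_apply, Finset.sum_add_distrib] at *
    rw [hx, hy, add_zero]
  zero_mem' := by simp
  smul_mem' := by
    intro c x hx
    simp only [Set.mem_ofPred_eq, PiLp.smul_apply, smul_eq_mul, ← Finset.mul_sum] at *
    rw [hx, mul_zero]

/-- The vector `e_i - e_j`. -/
def rootA (m : ℕ) (i j : Fin (m + 1)) : hyperplaneA m :=
  ⟨EuclideanSpace.single i (1 : ℝ) - EuclideanSpace.single j (1 : ℝ), by
    change ∑ l, _ = (0 : ℝ)
    simp [Finset.sum_sub_distrib]⟩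

/-- The root system `A_m`. -/
def rootsA (m : ℕ) : Set (hyperplaneA m) :=
  {α | ∃ i j : Fin (m + 1), i ≠ j ∧ α = rootA m i j}

theorem partialSum_rootA (m : ℕ) (i j : Fin m) :
    ∑ l ∈ Finset.Iic i.castSucc,
      (rootA m j.castSucc j.succ : EuclideanSpace ℝ (Fin (m + 1))) l = if j = i then 1 else 0 := by
  simp only [rootA, PiLp.sub_apply, PiLp.single_apply, Finset.sum_sub_distrib,
    Finset.sum_ite_eq', Finset.mem_Iic, Fin.castSucc_le_castSucc_iff, Fin.succ_le_castSucc_iff]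
  rcases lt_trichotomy j i with h | h | h
  · simp [h, h.le, h.ne]
  · simp [h]
  · simp [h.not_ge, h.not_gt, h.ne']

theorem linearIndependent_simpleA (m : ℕ) :
    LinearIndependent ℝ (fun i : Fin m => rootA m i.castSucc i.succ) := by
  rw [Fintype.linearIndependent_iff]
  intro g hg i
  have h := congrArg (fun x : hyperplaneA m =>
    ∑ l ∈ Finset.Iic i.castSucc, (x : EuclideanSpace ℝ (Fin (m + 1))) l) hg
  simp only [Submodule.coe_sum, Submodule.coe_smul, WithLp.ofLp_sum, Finset.sum_apply,
    PiLp.smul_apply, smul_eq_mul, ZeroMemClass.coe_zero, PiLp.zero_apply,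
    Finset.sum_const_zero] at h
  rw [Finset.sum_comm] at h
  simp only [← Finset.mul_sum, partialSum_rootA] at h
  simpa using h

theorem span_simpleA (m : ℕ) :
    ⊤ ≤ Submodule.span ℝ (Set.range fun i : Fin m => rootA m i.castSucc i.succ) := by
  have h1 : m ≤ Module.finrank ℝ (hyperplaneA m) := by
    simpa using (linearIndependent_simpleA m).fintype_card_le_finrank
  have h2 : hyperplaneA m < ⊤ := by
    rw [lt_top_iff_ne_top]
    intro h
    have h0 : EuclideanSpace.single (0 : Fin (m + 1)) (1 : ℝ) ∈ hyperplaneA m := by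
      rw [h]; trivial
    change ∑ l, _ = (0 : ℝ) at h0
    simp at h0
  have h3 := Submodule.finrank_lt_finrank_of_lt h2
  rw [finrank_top, finrank_euclideanSpace_fin] at h3
  exact ((linearIndependent_simpleA m).span_eq_top_of_card_eq_finrank'
    (by rw [Fintype.card_fin]; omega)).ge

/-- The simple roots `e_i - e_(i+1)` of `A_m`. -/
def simpleA (m : ℕ) : Module.Basis (Fin m) ℝ (hyperplaneA m) :=
  Module.Basis.mk (linearIndependent_simpleA m) (span_simpleA m)

/-- The minimal permutonestohedron of type `A_m` defined by the list `ε 1 < ⋯ < ε m`. -/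
def minimalPermutonestohedronA (m : ℕ) (ε : ℕ → ℝ) : Set (hyperplaneA m) :=
  permutonestohedron (rootsA m) (simpleA m) (irreducibleSubspaces (rootsA m)) ε

/-- `w(λ) = l(λ)! / ∏ m_i!`, where `m_i` is the number of parts of `λ` equal to `i`. -/
def partitionWeight {n : ℕ} (p : n.Partition) : ℚ :=
  (p.parts.card.factorial : ℚ) / ∏ i ∈ Finset.Icc 1 n, ((p.parts.count i).factorial : ℚ)

/-- `n! / (λ_1! ⋯ λ_l!)`. -/
def partitionMultinomial {n : ℕ} (p : n.Partition) : ℚ :=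
  (n.factorial : ℚ) / ((p.parts.map Nat.factorial).prod : ℚ)

end Permutonest

end

/-! Put `e s = ε (s - 1)` for block sizes `s ≥ 2`, and `e 0 = e 1 = 0`. In coordinates the
half-spaces are indexed by the ordered partitions `q` of the n coordinates into at least two blocks:
simple roots cut the coordinates into consecutive blocks, and the Weyl group permutes the
coordinates. The inequality of `q` says that half the sum of x_s - x_t, over the pairs with s in an
earlier block than t, is at most e n minus the sum of e #B over the blocks B
(`minimalPermutonestohedronA_eq`).

Measure a set B by its gap, i.e. half the sum of the distances |x_s - x_t| over its pairs, minus e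
#B. The slack of `q` is then the sum of the gaps of its blocks, minus the gap of the whole set, plus
a nonnegative defect that vanishes exactly when x is weakly decreasing along `q` (`slack_eq`).
Comparing a tight `q` with its refinements and coarsenings gives inequalities between gaps. A
suitable list grows so fast that crossing blocks violate them: gap(B ∪ C) + gap(B ∩ C) < gap B + gap
C (`gap_union_lt`). Hence classes of partitions that are tight at one point are nested
(`Active.cls_nested`). It follows that there is a finest tight partition `f`, and that the other
tight partitions arise by collapsing disjoint brackets of a noncrossing family `T` of intervals of
blocks of `f` (`exists_label`).

Conversely, every pair (`f`, `T`) with the full bracket in `T` occurs. Gluing blocks along a binary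
tree of cuts that respects `T` gives a vertex (`Good.union`, `exists_good_layers`). This vertex has
additional tight intervals, but the mirror-image construction has different ones, and the midpoint
of the two vertices has exactly the wanted active set (`exists_point_of_label`).

So boundary active sets, hence proper nonempty faces, correspond to labels (`f`, `T`). The
codimension of a face is the rank of its active forms. These span the same space as the forms of the
brackets in `T`, which are linearly independent by a triangular argument, so the codimension is #`T`
(`finrank_span_compatible`).

It remains to count. Ordered partitions into l blocks, sorted by block sizes, give w(λ) times the
multinomial coefficient. Bracketings of a word of length l with k + 1 brackets, the full one
included, are the dissections of an (l + 1)-gon by k diagonals. The Kirkman–Cayley formula for them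
is proved by a recursion that removes the longest bracket ending at the last letter
(`numFamilies_eq`, `card_bracketings`). -/

namespace Permutoassoc

open Finset

/-! ### Growth of the offsets -/

/-- The growth condition that a suitable list imposes on the offsets `e s = ε (s - 1)`, indexed by
the sizes of the blocks. -/
structure Growth (n : ℕ) (e : ℕ → ℝ) : Prop where
  zero : e 0 = 0
  one : e 1 = 0
  two_pos : 2 ≤ n → 0 < e 2
  step : ∀ s a b : ℕ, 2 ≤ s → s + 1 ≤ n → a + b = s + 1 → 1 ≤ a → 1 ≤ b →
    2 * ((a : ℝ) * b) * e s < ((s : ℝ) - 1) * e (s + 1)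

namespace Growth

/-- The growth condition with `a = 2` and `b = s - 1`, where the factor `s - 1` cancels. -/
theorem four_mul_lt {n : ℕ} {e : ℕ → ℝ} (h : Growth n e) {s : ℕ} (hs : 2 ≤ s)
    (hn : s + 1 ≤ n) : 4 * e s < e (s + 1) := by
  obtain ⟨r, rfl⟩ : ∃ r, s = r + 1 := ⟨s - 1, by omega⟩
  have h1 := h.step (r + 1) 2 r hs hn (by omega) (by omega) (by omega)
  have hr : (0 : ℝ) < r := by exact_mod_cast (by omega : 0 < r)
  push_cast at h1
  have : (r : ℝ) * (4 * e (r + 1)) < r * e (r + 1 + 1) := by linarith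
  exact lt_of_mul_lt_mul_left this hr.le

theorem pos {n : ℕ} {e : ℕ → ℝ} (h : Growth n e) {s : ℕ} (hs : 2 ≤ s) (hn : s ≤ n) :
    0 < e s := by
  induction s, hs using Nat.le_induction with
  | base => exact h.two_pos hn
  | succ s hs ih =>
    have := h.four_mul_lt hs hn
    have := ih (by omega)
    linarith

theorem nonneg {n : ℕ} {e : ℕ → ℝ} (h : Growth n e) {s : ℕ} (hn : s ≤ n) : 0 ≤ e s := by
  rcases s with _ | _ | s
  · exact h.zero.ge
  · exact h.one.ge
  · exact (h.pos (by omega) hn).le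

/-- Every step multiplies the offset by more than 4, and 4^c ≥ 2(1 + c); for `s = 1` the left side
is zero. The linear factor in `c` is what beats the distances between the elements of a block and
`c` new elements. -/
theorem two_mul_lt {n : ℕ} {e : ℕ → ℝ} (h : Growth n e) {s c : ℕ} (hs : 1 ≤ s) (hc : 1 ≤ c)
    (hn : s + c ≤ n) : 2 * (1 + (c : ℝ)) * e s < e (s + c) := by
  rcases hs.eq_or_lt with rfl | hs
  · rw [h.one, mul_zero]
    exact h.pos (by omega) hn
  · induction c, hc using Nat.le_induction with
    | base =>
      have := h.four_mul_lt hs hn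
      push_cast
      linarith
    | succ c hc ih =>
      have h1 := h.four_mul_lt (s := s + c) (by omega) hn
      have h2 := ih (by omega)
      have h3 : 0 ≤ (c : ℝ) * e s := mul_nonneg (Nat.cast_nonneg c) (h.nonneg (by omega))
      have h4 := h.nonneg (s := s) (by omega)
      rw [← add_assoc]
      push_cast
      nlinarith

theorem four_mul_le {n : ℕ} {e : ℕ → ℝ} (h : Growth n e) {s c : ℕ} (hs : 2 ≤ s) (hc : 2 ≤ c)
    (hn : s + c ≤ n) : 4 * (1 + (c : ℝ)) * e s ≤ e (s + c) := by
  obtain ⟨d, rfl⟩ : ∃ d, c = d + 1 := ⟨c - 1, by omega⟩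
  have h1 := h.four_mul_lt (s := s + d) (by omega) (by omega)
  have h2 := h.two_mul_lt (s := s) (c := d) (by omega) (by omega) (by omega)
  have h4 := h.nonneg (s := s) (by omega)
  have h3 : 1 * e s ≤ (d : ℝ) * e s :=
    mul_le_mul_of_nonneg_right (by exact_mod_cast (by omega : 1 ≤ d)) h4
  rw [← add_assoc]
  push_cast
  nlinarith

/-- When both sizes are at least 2, each of the two terms takes at most half of the right side; a
size equal to 1 contributes no offset. This is what makes room for a large distance when two blocks
are glued in `Good.union`. -/
theorem two_mul_add_le {n : ℕ} {e : ℕ → ℝ} (h : Growth n e) {a b : ℕ} (ha : 1 ≤ a) (hb : 1 ≤ b)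
    (hn : a + b ≤ n) : 2 * ((1 + (b : ℝ)) * e a + (1 + (a : ℝ)) * e b) ≤ e (a + b) := by
  rcases ha.eq_or_lt with rfl | ha
  · have := h.two_mul_lt (s := b) (c := 1) hb le_rfl (by omega)
    rw [h.one, add_comm 1 b]
    push_cast at *
    linarith
  rcases hb.eq_or_lt with rfl | hb
  · have := h.two_mul_lt (s := a) (c := 1) (by omega) le_rfl (by omega)
    rw [h.one]
    push_cast at *
    linarith
  have h1 := h.four_mul_le ha hb hn
  have h2 := h.four_mul_le hb ha (by omega)
  rw [add_comm b a] at h2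
  linarith

/-- The quotient e s / (s - 1) is nondecreasing. It reduces the estimate for a straddling set of any
size to the largest possible size in `Good.union`. -/
theorem slope_le {n : ℕ} {e : ℕ → ℝ} (h : Growth n e) {b s : ℕ} (hb : 2 ≤ b) (hbs : b ≤ s)
    (hn : s ≤ n) : ((s : ℝ) - 1) * e b ≤ ((b : ℝ) - 1) * e s := by
  obtain ⟨c, rfl⟩ : ∃ c, s = b + c := ⟨s - b, by omega⟩
  rcases Nat.eq_zero_or_pos c with rfl | hc
  · simp
  have h1 := h.two_mul_lt (s := b) (c := c) (by omega) hc hn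
  have h2 := h.nonneg (s := b) (by omega)
  have hb' : (1 : ℝ) ≤ (b : ℝ) - 1 := by
    have : (2 : ℝ) ≤ b := by exact_mod_cast hb
    linarith
  have hc' : (0 : ℝ) ≤ c := Nat.cast_nonneg c
  have h3 : ((b + c : ℕ) - 1 : ℝ) * e b ≤ ((b : ℝ) - 1) * ((1 + c) * e b) := by
    rw [← mul_assoc]
    apply mul_le_mul_of_nonneg_right _ h2
    push_cast
    nlinarith
  have h4 : ((b : ℝ) - 1) * ((1 + c) * e b) ≤ ((b : ℝ) - 1) * e (b + c) := by
    apply mul_le_mul_of_nonneg_left _ (by linarith)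
    nlinarith [mul_nonneg hc' h2]
  linarith

/-- A proper block takes at most half of its proportional share of `e n`; summed over the blocks
this makes every right-hand side positive. -/
theorem proportion_le {n : ℕ} {e : ℕ → ℝ} (h : Growth n e) {s : ℕ} (hs : 1 ≤ s) (hn : s < n) :
    2 * (n : ℝ) * e s ≤ s * e n := by
  obtain ⟨c, rfl⟩ : ∃ c, n = s + c := ⟨n - s, by omega⟩
  have h1 := h.two_mul_lt (s := s) (c := c) hs (by omega) le_rfl
  have h2 := h.nonneg (s := s) (by omega)
  have hs' : (1 : ℝ) ≤ s := by exact_mod_cast hs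
  have hc' : (0 : ℝ) ≤ c := Nat.cast_nonneg c
  have h3 : ((s + c : ℕ) : ℝ) * e s ≤ (s * (1 + c)) * e s := by
    apply mul_le_mul_of_nonneg_right _ h2
    push_cast
    nlinarith
  nlinarith

end Growth

/-! ### Spread of a point over a block -/

section Spread

variable {n : ℕ}

/-- The sum of all the distances between the coordinates in `A` and those in `B`. -/
def cross (x : Fin n → ℝ) (A B : Finset (Fin n)) : ℝ := ∑ s ∈ A, ∑ t ∈ B, |x s - x t|

/-- Half the sum of the distances over the unordered pairs of elements of `B`. -/
noncomputable def spread (x : Fin n → ℝ) (B : Finset (Fin n)) : ℝ := 1 / 4 * cross x B B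

/-- The gap of the block `B`: it vanishes on the facets attached to `B`. -/
noncomputable def gap (e : ℕ → ℝ) (x : Fin n → ℝ) (B : Finset (Fin n)) : ℝ := spread x B - e #B

theorem cross_comm (x : Fin n → ℝ) (A B : Finset (Fin n)) : cross x A B = cross x B A := by
  unfold cross
  rw [sum_comm]
  simp_rw [abs_sub_comm]

theorem cross_union_left (x : Fin n → ℝ) {A A' : Finset (Fin n)} (B : Finset (Fin n))
    (h : Disjoint A A') : cross x (A ∪ A') B = cross x A B + cross x A' B := by
  unfold cross
  rw [sum_union h]

theorem cross_union_right (x : Fin n → ℝ) (A : Finset (Fin n)) {B B' : Finset (Fin n)}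
    (h : Disjoint B B') : cross x A (B ∪ B') = cross x A B + cross x A B' := by
  rw [cross_comm, cross_union_left x A h, cross_comm x B, cross_comm x B']

theorem cross_nonneg (x : Fin n → ℝ) (A B : Finset (Fin n)) : 0 ≤ cross x A B :=
  sum_nonneg fun _ _ => sum_nonneg fun _ _ => abs_nonneg _

theorem spread_nonneg (x : Fin n → ℝ) (B : Finset (Fin n)) : 0 ≤ spread x B :=
  mul_nonneg (by norm_num) (cross_nonneg x B B)

theorem spread_union (x : Fin n → ℝ) {A B : Finset (Fin n)} (h : Disjoint A B) :
    spread x (A ∪ B) = spread x A + spread x B + 1 / 2 * cross x A B := by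
  unfold spread
  rw [cross_union_left x _ h, cross_union_right x _ h, cross_union_right x _ h, cross_comm x B A]
  ring

theorem spread_singleton (x : Fin n → ℝ) (a : Fin n) : spread x {a} = 0 := by
  simp [spread, cross]

theorem spread_empty (x : Fin n → ℝ) : spread x ∅ = 0 := by
  simp [spread, cross]

theorem gap_empty {e : ℕ → ℝ} (h : Growth n e) (x : Fin n → ℝ) : gap e x ∅ = 0 := by
  simp [gap, spread_empty, h.zero]

theorem gap_singleton {e : ℕ → ℝ} (h : Growth n e) (x : Fin n → ℝ) (a : Fin n) :
    gap e x {a} = 0 := by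
  simp [gap, spread_singleton, h.one]

/-- Twice the spread is the sum of the distances over all unordered pairs, of which only the pairs
through `v` are kept. -/
theorem sum_dist_le_two_spread (x : Fin n → ℝ) {B : Finset (Fin n)} {v : Fin n} (hv : v ∈ B) :
    ∑ s ∈ B, |x s - x v| ≤ 2 * spread x B := by
  have h1 : cross x B B = cross x {v} {v} + 2 * cross x {v} (B.erase v)
      + cross x (B.erase v) (B.erase v) := by
    have hd : Disjoint {v} (B.erase v) := by simp
    have hB : B = {v} ∪ B.erase v := by
      rw [← insert_eq, insert_erase hv]
    conv_lhs => rw [hB]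
    rw [cross_union_left x _ hd, cross_union_right x _ hd, cross_union_right x _ hd,
      cross_comm x (B.erase v) {v}]
    ring
  have h2 : ∑ s ∈ B, |x s - x v| = cross x {v} (B.erase v) := by
    rw [← add_sum_erase _ _ hv]
    simp [cross, abs_sub_comm]
  have h3 := cross_nonneg x {v} {v}
  have h4 := cross_nonneg x (B.erase v) (B.erase v)
  rw [h2, spread]
  linarith

/-- Go from `s` to `t` through `v` and `w`; the two detours are controlled by the spreads of the
ambient blocks. -/
theorem cross_le (x : Fin n → ℝ) {A A' B B' : Finset (Fin n)} (hA : A' ⊆ A) (hB : B' ⊆ B)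
    {v w : Fin n} (hv : v ∈ A) (hw : w ∈ B) :
    cross x A' B' ≤ #A' * #B' * |x v - x w| + 2 * #B' * spread x A + 2 * #A' * spread x B := by
  have h1 : cross x A' B' ≤ ∑ s ∈ A', ∑ t ∈ B', (|x s - x v| + |x v - x w| + |x t - x w|) := by
    refine sum_le_sum fun s _ => sum_le_sum fun t _ => ?_
    have e1 := abs_sub_le (x s) (x v) (x t)
    have e2 := abs_sub_le (x v) (x w) (x t)
    rw [abs_sub_comm (x w) (x t)] at e2
    linarith
  have h2 : ∑ s ∈ A', |x s - x v| ≤ 2 * spread x A :=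
    (sum_le_sum_of_subset_of_nonneg hA fun _ _ _ => abs_nonneg _).trans
      (sum_dist_le_two_spread x hv)
  have h3 : ∑ s ∈ B', |x s - x w| ≤ 2 * spread x B :=
    (sum_le_sum_of_subset_of_nonneg hB fun _ _ _ => abs_nonneg _).trans
      (sum_dist_le_two_spread x hw)
  simp only [sum_add_distrib, sum_const, nsmul_eq_mul, ← mul_sum] at h1
  have hA' : (0 : ℝ) ≤ #A' := Nat.cast_nonneg _
  have hB' : (0 : ℝ) ≤ #B' := Nat.cast_nonneg _
  have h4 := mul_le_mul_of_nonneg_left h2 hB'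
  have h5 := mul_le_mul_of_nonneg_left h3 hA'
  nlinarith

/-- Inclusion–exclusion on pairs: the pairs of the union that lie in neither block join `B \ C` to
`C \ B`. -/
theorem spread_union_add_inter (x : Fin n → ℝ) (B C : Finset (Fin n)) :
    spread x (B ∪ C) + spread x (B ∩ C) =
      spread x B + spread x C + 1 / 2 * cross x (B \ C) (C \ B) := by
  have e1 : B ∪ C = B ∪ (C \ B) := by simp
  have e2 : C = (B ∩ C) ∪ (C \ B) := by
    rw [inter_comm, union_comm, sdiff_union_inter]
  have e3 : B = (B ∩ C) ∪ (B \ C) := by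
    rw [union_comm, sdiff_union_inter]
  have d1 : Disjoint B (C \ B) := disjoint_sdiff
  have d2 : Disjoint (B ∩ C) (C \ B) := d1.mono_left inter_subset_left
  have d3 : Disjoint (B ∩ C) (B \ C) :=
    (disjoint_sdiff (s := C)).mono_left inter_subset_right
  have h1 := spread_union x d1
  have h2 := spread_union x d2
  rw [← e2] at h2
  have h3 : cross x B (C \ B) = cross x (B ∩ C) (C \ B) + cross x (B \ C) (C \ B) := by
    rw [← cross_union_left x _ d3, ← e3]
  rw [e1]
  linarith

/-- Two blocks with small spread that share a value (or an element) have a union of much smaller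
gap, unless one contains the other. -/
theorem gap_union_lt {e : ℕ → ℝ} (h : Growth n e) (x : Fin n → ℝ) {B C : Finset (Fin n)}
    (hB : spread x B ≤ e #B) (hC : spread x C ≤ e #C) {v w : Fin n} (hv : v ∈ B) (hw : w ∈ C)
    (hvw : x v = x w) (hBC : ¬ B ⊆ C) (hCB : ¬ C ⊆ B) :
    spread x (B ∪ C) < e #(B ∪ C) ∧
      gap e x (B ∪ C) + gap e x (B ∩ C) < gap e x B + gap e x C := by
  have h1 := spread_union_add_inter x B C
  have h2 := cross_le x (sdiff_subset (s := B) (t := C)) (sdiff_subset (s := C) (t := B)) hv hw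
  rw [hvw, sub_self, abs_zero, mul_zero, zero_add] at h2
  have c1 : #(B ∪ C) = #B + #(C \ B) := by
    rw [← card_union_of_disjoint disjoint_sdiff, union_sdiff_self_eq_union]
  have c2 : #(B ∪ C) = #C + #(B \ C) := by
    rw [← card_union_of_disjoint disjoint_sdiff, union_sdiff_self_eq_union, union_comm]
  have p1 : 1 ≤ #(C \ B) := card_pos.2 (sdiff_nonempty.2 hCB)
  have p2 : 1 ≤ #(B \ C) := card_pos.2 (sdiff_nonempty.2 hBC)
  have p3 : 1 ≤ #B := card_pos.2 ⟨v, hv⟩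
  have p4 : 1 ≤ #C := card_pos.2 ⟨w, hw⟩
  have hn : #(B ∪ C) ≤ n := (card_le_univ _).trans_eq (Fintype.card_fin n)
  -- Half the cross term is at most #(C \ B) e #B + #(B \ C) e #C. Together with e #B + e #C this
  -- costs (1 + #(C \ B)) e #B + (1 + #(B \ C)) e #C, and `g1`, `g2` bound each summand by half of e
  -- #(B ∪ C).
  have g1 := h.two_mul_lt p3 p1 (c1 ▸ hn)
  have g2 := h.two_mul_lt p4 p2 (c2 ▸ hn)
  rw [← c1] at g1
  rw [← c2] at g2
  have z1 := spread_nonneg x (B ∩ C)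
  have z2 : 0 ≤ e #(B ∩ C) :=
    h.nonneg ((card_le_univ _).trans_eq (Fintype.card_fin n))
  have k1 := mul_le_mul_of_nonneg_left hB (Nat.cast_nonneg (α := ℝ) #(C \ B))
  have k2 := mul_le_mul_of_nonneg_left hC (Nat.cast_nonneg (α := ℝ) #(B \ C))
  unfold gap
  constructor <;> linarith

end Spread

end Permutoassoc

namespace Permutoassoc

open Finset

/-! ### Ordered partitions -/

section Forms

variable {n : ℕ}

/-- The class of `s` in the ordered partition of `Fin n` given by `q`. -/
def cls {α : Type*} [DecidableEq α] (q : Fin n → α) (s : Fin n) : Finset (Fin n) :=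
  univ.filter fun t => q t = q s

/-- The sum of `G` over the traces on `S` of the classes of `q` (each counted once). -/
noncomputable def blockSum {α : Type*} [DecidableEq α] (G : Finset (Fin n) → ℝ) (q : Fin n → α)
    (S : Finset (Fin n)) : ℝ :=
  ∑ s ∈ S, G (S.filter fun t => q t = q s) / #(S.filter fun t => q t = q s)

/-- The linear form of the half-space attached to the ordered partition `q`. -/
noncomputable def form {α : Type*} [LinearOrder α] (q : Fin n → α) (x : Fin n → ℝ) : ℝ :=
  1 / 2 * ∑ s, ∑ t, if q s < q t then x s - x t else 0

/-- The right-hand side of the half-space attached to the ordered partition `q`. -/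
noncomputable def bound {α : Type*} [DecidableEq α] (e : ℕ → ℝ) (q : Fin n → α) : ℝ :=
  e n - blockSum (fun B => e #B) q univ

/-- `q` has at least two blocks. -/
def Nonconst {α : Type*} (q : Fin n → α) : Prop := ∃ s t, q s ≠ q t

/-- `x` is weakly decreasing along `q`. -/
def Sorted {α : Type*} [LT α] (x : Fin n → ℝ) (q : Fin n → α) : Prop :=
  ∀ s t, q s < q t → x t ≤ x s

/-! ### Sums over the blocks of a map -/

theorem blockSum_eq_sum_image {α : Type*} [DecidableEq α] (G : Finset (Fin n) → ℝ) (q : Fin n → α)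
    (S : Finset (Fin n)) :
    blockSum G q S = ∑ v ∈ S.image q, G (S.filter fun t => q t = v) := by
  unfold blockSum
  rw [← sum_fiberwise_of_maps_to (g := q) (t := S.image q) fun s hs => mem_image_of_mem q hs]
  refine sum_congr rfl fun v hv => ?_
  obtain ⟨s, hs, rfl⟩ := mem_image.1 hv
  have hpos : (0 : ℝ) < #(S.filter fun t => q t = q s) := by
    exact_mod_cast card_pos.2 ⟨s, by simp [hs]⟩
  rw [sum_congr rfl (g := fun _ => G (S.filter fun t => q t = q s) /
    #(S.filter fun t => q t = q s)) (fun a ha => by rw [(mem_filter.1 ha).2])]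
  rw [sum_const, nsmul_eq_mul]
  field_simp

theorem blockSum_congr {α β : Type*} [DecidableEq α] [DecidableEq β] (G : Finset (Fin n) → ℝ)
    {q : Fin n → α} {r : Fin n → β} {S : Finset (Fin n)}
    (h : ∀ s ∈ S, ∀ t ∈ S, q s = q t ↔ r s = r t) : blockSum G q S = blockSum G r S := by
  refine sum_congr rfl fun s hs => ?_
  rw [filter_congr fun t ht => h t ht s hs]

theorem blockSum_union {α : Type*} [DecidableEq α] (G : Finset (Fin n) → ℝ) (q : Fin n → α)
    {S T : Finset (Fin n)} (h : ∀ s ∈ S, ∀ t ∈ T, q s ≠ q t) :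
    blockSum G q (S ∪ T) = blockSum G q S + blockSum G q T := by
  have hd : Disjoint S T := disjoint_left.2 fun s hs ht => h s hs s ht rfl
  unfold blockSum
  rw [sum_union hd]
  congr 1
  · refine sum_congr rfl fun s hs => ?_
    rw [filter_union, filter_false_of_mem (s := T) fun t ht => (h s hs t ht).symm, union_empty]
  · refine sum_congr rfl fun s hs => ?_
    rw [filter_union, filter_false_of_mem (s := S) fun t ht => h t ht s hs, empty_union]

theorem blockSum_const {α : Type*} [DecidableEq α] (G : Finset (Fin n) → ℝ) {q : Fin n → α}
    {S : Finset (Fin n)} (hS : S.Nonempty) (h : ∀ s ∈ S, ∀ t ∈ S, q s = q t) :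
    blockSum G q S = G S := by
  obtain ⟨a, ha⟩ := hS
  rw [blockSum_eq_sum_image]
  have : S.image q = {q a} := by
    ext v
    simp only [mem_image, mem_singleton]
    constructor
    · rintro ⟨s, hs, rfl⟩
      exact h s hs a ha
    · rintro rfl
      exact ⟨a, ha, rfl⟩
  rw [this, sum_singleton, filter_true_of_mem fun s hs => h s hs a ha]

theorem blockSum_injOn {α : Type*} [DecidableEq α] (G : Finset (Fin n) → ℝ) {q : Fin n → α}
    {S : Finset (Fin n)} (h : Set.InjOn q S) : blockSum G q S = ∑ s ∈ S, G {s} := by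
  refine sum_congr rfl fun s hs => ?_
  have : (S.filter fun t => q t = q s) = {s} := by
    ext t
    simp only [mem_filter, mem_singleton]
    refine ⟨fun ⟨ht, hq⟩ => h ht hs hq, ?_⟩
    rintro rfl
    exact ⟨hs, rfl⟩
  rw [this]
  simp

theorem blockSum_sub {α : Type*} [DecidableEq α] (G H : Finset (Fin n) → ℝ) (q : Fin n → α)
    (S : Finset (Fin n)) :
    blockSum (fun B => G B - H B) q S = blockSum G q S - blockSum H q S := by
  unfold blockSum
  rw [← sum_sub_distrib]
  exact sum_congr rfl fun s _ => sub_div _ _ _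

/-- A union of classes contributes separately from its complement. -/
theorem blockSum_split {α : Type*} [DecidableEq α] (G : Finset (Fin n) → ℝ) (q : Fin n → α)
    {S : Finset (Fin n)} (h : ∀ s ∈ S, ∀ t, q t = q s → t ∈ S) :
    blockSum G q univ = blockSum G q S + blockSum G q Sᶜ := by
  rw [← blockSum_union, union_compl]
  intro s hs t ht hst
  exact (mem_compl.1 ht) (h s hs t hst.symm)

theorem blockSum_spread {α : Type*} [DecidableEq α] (q : Fin n → α) (x : Fin n → ℝ) :
    blockSum (spread x) q univ = 1 / 4 * ∑ s, ∑ t, if q s = q t then |x s - x t| else 0 := by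
  rw [blockSum_eq_sum_image, ← sum_fiberwise_of_maps_to (g := q) (t := univ.image q)
    (fun s hs => mem_image_of_mem q hs), mul_sum]
  refine sum_congr rfl fun v _ => ?_
  unfold spread cross
  congr 1
  refine sum_congr rfl fun s hs => ?_
  rw [sum_filter]
  refine sum_congr rfl fun t _ => ?_
  rw [(mem_filter.1 hs).2]
  simp only [eq_comm]

/-! ### The slack of an inequality in terms of gaps -/

section Order

variable {α : Type*} [LinearOrder α]

theorem form_eq_neg_sum (q : Fin n → α) (x : Fin n → ℝ) :
    form q x = 1 / 4 * ∑ s, ∑ t, ((if q s < q t then x s - x t else 0) +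
      if q t < q s then x t - x s else 0) := by
  simp only [sum_add_distrib]
  rw [sum_comm (f := fun s t => if q t < q s then x t - x s else 0), form]
  ring

/-- The difference of the spreads sums |x_s - x_t| over the pairs in different blocks, and `form`
sums the same pairs with the sign dictated by `q`. What is left is the defect of sortedness. -/
theorem spread_univ_sub_blockSum_sub_form (q : Fin n → α) (x : Fin n → ℝ) :
    spread x univ - blockSum (spread x) q univ - form q x =
      1 / 4 * ∑ s, ∑ t, ((if q s < q t then |x s - x t| - (x s - x t) else 0) +
        if q t < q s then |x t - x s| - (x t - x s) else 0) := by
  rw [blockSum_spread, form_eq_neg_sum, spread, cross, ← mul_sub, ← mul_sub, ← sum_sub_distrib,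
    ← sum_sub_distrib]
  congr 1
  refine sum_congr rfl fun s _ => ?_
  rw [← sum_sub_distrib, ← sum_sub_distrib]
  refine sum_congr rfl fun t _ => ?_
  rcases lt_trichotomy (q s) (q t) with h | h | h
  · simp [h, h.ne, h.not_gt]
  · simp [h]
  · simp [h, h.ne', h.not_gt, abs_sub_comm]

/-- The basic identity: it turns questions about tight inequalities into questions about how far the
gap is from being additive over blocks. -/
theorem slack_eq (e : ℕ → ℝ) (q : Fin n → α) (x : Fin n → ℝ) :
    bound e q - form q x = blockSum (gap e x) q univ - gap e x univ +
      (spread x univ - blockSum (spread x) q univ - form q x) := by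
  have : blockSum (gap e x) q univ =
      blockSum (spread x) q univ - blockSum (fun B => e #B) q univ := by
    rw [← blockSum_sub]
    rfl
  rw [this, bound, gap, card_univ, Fintype.card_fin]
  ring

theorem slack_ge (e : ℕ → ℝ) (q : Fin n → α) (x : Fin n → ℝ) :
    blockSum (gap e x) q univ - gap e x univ ≤ bound e q - form q x := by
  rw [slack_eq, spread_univ_sub_blockSum_sub_form]
  have : 0 ≤ ∑ s, ∑ t, ((if q s < q t then |x s - x t| - (x s - x t) else 0) +
        if q t < q s then |x t - x s| - (x t - x s) else 0) := by
    refine sum_nonneg fun s _ => sum_nonneg fun t _ => add_nonneg ?_ ?_ <;> split_ifs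
    all_goals first | exact sub_nonneg.2 (le_abs_self _) | exact le_rfl
  linarith

theorem slack_of_sorted (e : ℕ → ℝ) {q : Fin n → α} {x : Fin n → ℝ} (h : Sorted x q) :
    bound e q - form q x = blockSum (gap e x) q univ - gap e x univ := by
  rw [slack_eq, spread_univ_sub_blockSum_sub_form]
  have : ∑ s, ∑ t, ((if q s < q t then |x s - x t| - (x s - x t) else 0) +
        if q t < q s then |x t - x s| - (x t - x s) else 0) = 0 := by
    refine sum_eq_zero fun s _ => sum_eq_zero fun t _ => ?_
    have a1 : (if q s < q t then |x s - x t| - (x s - x t) else 0) = 0 := by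
      split_ifs with hq
      · rw [abs_of_nonneg (sub_nonneg.2 (h s t hq)), sub_self]
      · rfl
    have a2 : (if q t < q s then |x t - x s| - (x t - x s) else 0) = 0 := by
      split_ifs with hq
      · rw [abs_of_nonneg (sub_nonneg.2 (h t s hq)), sub_self]
      · rfl
    rw [a1, a2, add_zero]
  rw [this]
  ring

theorem sorted_of_slack_eq (e : ℕ → ℝ) {q : Fin n → α} {x : Fin n → ℝ}
    (h : bound e q - form q x = blockSum (gap e x) q univ - gap e x univ) : Sorted x q := by
  rw [slack_eq, spread_univ_sub_blockSum_sub_form] at h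
  have hnn : ∀ s t, 0 ≤ ((if q s < q t then |x s - x t| - (x s - x t) else 0) +
        if q t < q s then |x t - x s| - (x t - x s) else 0) := by
    intro s t
    refine add_nonneg ?_ ?_ <;> split_ifs
    all_goals first | exact sub_nonneg.2 (le_abs_self _) | exact le_rfl
  have h0 : ∑ s, ∑ t, ((if q s < q t then |x s - x t| - (x s - x t) else 0) +
        if q t < q s then |x t - x s| - (x t - x s) else 0) = 0 := by linarith
  intro s t hst
  have h1 := (sum_eq_zero_iff_of_nonneg fun s _ => sum_nonneg fun t _ => hnn s t).1 h0 s
    (mem_univ s)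
  have h2 := (sum_eq_zero_iff_of_nonneg fun t _ => hnn s t).1 h1 t (mem_univ t)
  rw [if_pos hst, if_neg hst.not_gt, add_zero] at h2
  have := abs_nonneg (x s - x t)
  linarith

theorem form_congr {β : Type*} [LinearOrder β] {q : Fin n → α} {r : Fin n → β}
    (h : ∀ s t, q s < q t ↔ r s < r t) : form q = form r := by
  funext x
  simp only [form, h]

theorem eq_iff_of_lt_iff {β : Type*} [LinearOrder β] {q : Fin n → α} {r : Fin n → β}
    (h : ∀ s t, q s < q t ↔ r s < r t) (s t : Fin n) : q s = q t ↔ r s = r t := by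
  have h1 := h s t
  have h2 := h t s
  constructor <;> intro h3
  · rw [h3] at h1 h2
    simp only [lt_irrefl, false_iff, not_lt] at h1 h2
    exact le_antisymm h2 h1
  · rw [h3] at h1 h2
    simp only [lt_irrefl, iff_false, not_lt] at h1 h2
    exact le_antisymm h2 h1

theorem bound_congr {β : Type*} [LinearOrder β] (e : ℕ → ℝ) {q : Fin n → α} {r : Fin n → β}
    (h : ∀ s t, q s < q t ↔ r s < r t) : bound e q = bound e r := by
  unfold bound
  rw [blockSum_congr _ fun s _ t _ => eq_iff_of_lt_iff h s t]

/-- Replace each value by its rank among the values. `InPoly` quantifies only over maps to `Fin n`,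
whereas refinements and collapses take values in other linear orders; only the induced ordered
partition matters. -/
theorem exists_fin_relabel (q : Fin n → α) :
    ∃ r : Fin n → Fin n, ∀ s t, q s < q t ↔ r s < r t := by
  have hlt : ∀ s, #((univ.image q).filter (· < q s)) < n := fun s => by
    have h1 : #((univ.image q).filter (· < q s)) < #(univ.image q) :=
      card_lt_card (filter_ssubset.2 ⟨q s, by simp⟩)
    exact h1.trans_le (card_image_le.trans_eq (by simp))
  refine ⟨fun s => ⟨_, hlt s⟩, fun s t => ?_⟩
  rw [Fin.mk_lt_mk]
  constructor
  · intro h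
    refine card_lt_card ⟨fun v hv => ?_, fun hsub => ?_⟩
    · simp only [mem_filter] at hv ⊢
      exact ⟨hv.1, hv.2.trans h⟩
    · have := hsub (mem_filter.2 ⟨mem_image_of_mem q (mem_univ s), h⟩)
      simp at this
  · intro h
    by_contra! hc
    refine h.not_ge (card_le_card fun v hv => ?_)
    simp only [mem_filter] at hv ⊢
    exact ⟨hv.1, hv.2.trans_le hc⟩

end Order

/-- The points satisfying the inequalities of all the ordered partitions with at least two
blocks. -/
def InPoly (e : ℕ → ℝ) (x : Fin n → ℝ) : Prop :=
  ∀ q : Fin n → Fin n, Nonconst q → form q x ≤ bound e q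

/-- The inequality of `q` is an equality at `x`. -/
def Active {α : Type*} [LinearOrder α] (e : ℕ → ℝ) (x : Fin n → ℝ) (q : Fin n → α) : Prop :=
  Nonconst q ∧ form q x = bound e q

theorem InPoly.form_le {e : ℕ → ℝ} {x : Fin n → ℝ} (h : InPoly e x) {α : Type*} [LinearOrder α]
    {q : Fin n → α} (hq : Nonconst q) : form q x ≤ bound e q := by
  obtain ⟨r, hr⟩ := exists_fin_relabel q
  rw [form_congr hr, bound_congr e hr]
  obtain ⟨s, t, hst⟩ := hq
  exact h r ⟨s, t, fun hc => hst ((eq_iff_of_lt_iff hr s t).2 hc)⟩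

theorem InPoly.gap_univ_le {e : ℕ → ℝ} {x : Fin n → ℝ} (h : InPoly e x) {α : Type*}
    [LinearOrder α] {q : Fin n → α} (hq : Nonconst q) (hs : Sorted x q) :
    gap e x univ ≤ blockSum (gap e x) q univ := by
  have h1 := h.form_le hq
  have h2 := slack_of_sorted e hs
  linarith

end Forms

end Permutoassoc

namespace Permutoassoc

open Finset

section Active

variable {n : ℕ} {α β : Type*} [LinearOrder α] [LinearOrder β]

/-! ### Permuting coordinates -/

theorem form_comp_perm (q : Fin n → α) (x : Fin n → ℝ) (σ : Equiv.Perm (Fin n)) :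
    form (q ∘ σ) (x ∘ σ) = form q x := by
  unfold form
  rw [← Equiv.sum_comp σ fun s => ∑ t, if q s < q t then x s - x t else 0]
  congr 1
  refine sum_congr rfl fun s _ => ?_
  rw [← Equiv.sum_comp σ fun t => if q (σ s) < q t then x (σ s) - x t else 0]
  rfl

theorem bound_comp_perm (e : ℕ → ℝ) (q : Fin n → α) (σ : Equiv.Perm (Fin n)) :
    bound e (q ∘ σ) = bound e q := by
  have hc : ∀ s, #(univ.filter fun t => (q ∘ σ) t = (q ∘ σ) s) =
      #(univ.filter fun t => q t = q (σ s)) := by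
    intro s
    rw [← card_map σ.toEmbedding]
    congr 1
    ext t
    simp only [mem_map_equiv, mem_filter, mem_univ, true_and, Function.comp, Equiv.apply_symm_apply]
  unfold bound blockSum
  rw [← Equiv.sum_comp σ fun s => e #(univ.filter fun t => q t = q s) /
    #(univ.filter fun t => q t = q s)]
  simp only [hc]

/-! ### The inequalities that are equalities at a point of the polytope -/

/-- Twice the coefficient of `x s` in `form q x`. -/
noncomputable def coef (q : Fin n → α) (s : Fin n) : ℝ :=
  (#(univ.filter fun t => q s < q t) : ℝ) - #(univ.filter fun t => q t < q s)

theorem form_eq_sum_coef (q : Fin n → α) (x : Fin n → ℝ) :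
    form q x = 1 / 2 * ∑ s, x s * coef q s := by
  have h1 : ∑ s, ∑ t, (if q s < q t then x s - x t else 0) =
      ∑ s, ∑ t, ((if q s < q t then x s else 0) - if q s < q t then x t else 0) := by
    refine sum_congr rfl fun s _ => sum_congr rfl fun t _ => ?_
    split_ifs <;> simp
  rw [form, h1]
  simp only [sum_sub_distrib]
  rw [sum_comm (f := fun s t => if q s < q t then x t else 0), ← sum_sub_distrib]
  congr 1
  refine sum_congr rfl fun s _ => ?_
  rw [← sum_filter, ← sum_filter, sum_const, sum_const, nsmul_eq_mul, nsmul_eq_mul, coef]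
  ring

theorem coef_lt (q : Fin n → α) {s t : Fin n} (h : q s < q t) : coef q t < coef q s := by
  have h1 : #(univ.filter fun r => q t < q r) < #(univ.filter fun r => q s < q r) := by
    refine card_lt_card ⟨fun r hr => ?_, fun hsub => ?_⟩
    · simp only [mem_filter, mem_univ, true_and] at hr ⊢
      exact h.trans hr
    · have := hsub (by simpa using h : t ∈ _)
      simp at this
  have h2 : #(univ.filter fun r => q r < q s) ≤ #(univ.filter fun r => q r < q t) := by
    refine card_le_card fun r hr => ?_
    simp only [mem_filter, mem_univ, true_and] at hr ⊢
    exact hr.trans h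
  have h1' : (#(univ.filter fun r => q t < q r) : ℝ) < #(univ.filter fun r => q s < q r) := by
    exact_mod_cast h1
  have h2' : (#(univ.filter fun r => q r < q s) : ℝ) ≤ #(univ.filter fun r => q r < q t) := by
    exact_mod_cast h2
  unfold coef
  linarith

theorem form_comp_swap (q : Fin n → α) (x : Fin n → ℝ) {s t : Fin n} (hst : s ≠ t) :
    form q (x ∘ Equiv.swap s t) - form q x = 1 / 2 * ((x t - x s) * (coef q s - coef q t)) := by
  rw [form_eq_sum_coef, form_eq_sum_coef, ← mul_sub, ← sum_sub_distrib]
  congr 1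
  rw [← sum_subset (subset_univ {s, t}), sum_pair hst]
  · simp only [Function.comp, Equiv.swap_apply_left, Equiv.swap_apply_right]
    ring
  · intro r _ hr
    simp only [mem_insert, mem_singleton, not_or] at hr
    rw [Function.comp, Equiv.swap_apply_of_ne_of_ne hr.1 hr.2, sub_self]

variable {e : ℕ → ℝ} {x : Fin n → ℝ}

/-- If two coordinates were in the wrong order, exchanging them would raise the form and keep the
bound. Equivalently, the inequality of `q ∘ swap s t`, which also holds at `x`, would be violated.
-/
theorem Active.sorted (hx : InPoly e x) {q : Fin n → α} (hq : Active e x q) : Sorted x q := by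
  intro s t hst
  by_contra! hlt
  obtain ⟨⟨a, b, hab⟩, heq⟩ := hq
  have hne : s ≠ t := fun h => hst.ne (by rw [h])
  have h1 : Nonconst (q ∘ Equiv.swap s t) :=
    ⟨Equiv.swap s t a, Equiv.swap s t b, by simpa using hab⟩
  have h2 := hx.form_le h1
  have h3 := form_comp_perm q (x ∘ Equiv.swap s t) (Equiv.swap s t)
  rw [Function.comp_assoc, ← Equiv.coe_trans, Equiv.swap_swap, Equiv.coe_refl,
    Function.comp_id] at h3
  rw [h3, bound_comp_perm] at h2
  have h4 := form_comp_swap q x hne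
  have h5 : 0 < (x t - x s) * (coef q s - coef q t) :=
    mul_pos (sub_pos.2 hlt) (sub_pos.2 (coef_lt q hst))
  linarith

theorem Active.gap_univ (hx : InPoly e x) {q : Fin n → α} (hq : Active e x q) :
    gap e x univ = blockSum (gap e x) q univ := by
  have := slack_of_sorted e (hq.sorted hx)
  rw [hq.2] at this
  linarith

/-! ### Refining and merging the classes of a tight partition -/

/-- The refinement of `q` that splits the class of `c` along `r`. -/
def splitClass (q : Fin n → α) (r : Fin n → β) (c : Fin n) (s : Fin n) : Lex (α × β) :=
  toLex (q s, if q s = q c then r s else r c)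

theorem splitClass_lt {q : Fin n → α} {r : Fin n → β} {c s t : Fin n} :
    splitClass q r c s < splitClass q r c t ↔
      q s < q t ∨ q s = q t ∧ q s = q c ∧ r s < r t := by
  rw [splitClass, splitClass, Prod.Lex.toLex_lt_toLex]
  refine or_congr Iff.rfl (and_congr_right fun h => ?_)
  simp only at h
  simp only [← h]
  by_cases hc : q s = q c
  · simp [hc]
  · simp [hc]

theorem splitClass_eq {γ : Type*} {q : Fin n → α} {r : Fin n → γ} {c s t : Fin n} :
    splitClass q r c s = splitClass q r c t ↔ q s = q t ∧ (q s = q c → r s = r t) := by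
  rw [splitClass, splitClass, toLex_inj, Prod.mk.injEq]
  refine and_congr_right fun h => ?_
  simp only [← h]
  by_cases hc : q s = q c
  · simp [hc]
  · simp [hc]

theorem sorted_splitClass {q : Fin n → α} {r : Fin n → β} (hq : Sorted x q) (hr : Sorted x r)
    (c : Fin n) : Sorted x (splitClass q r c) := by
  intro s t hst
  rcases splitClass_lt.1 hst with h | h
  · exact hq s t h
  · exact hr s t h.2.2

theorem nonconst_splitClass {γ : Type*} {q : Fin n → α} {r : Fin n → γ} (hq : Nonconst q) (c : Fin n) :
    Nonconst (splitClass q r c) := by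
  obtain ⟨s, t, hst⟩ := hq
  exact ⟨s, t, fun h => hst (splitClass_eq.1 h).1⟩

theorem mem_cls {q : Fin n → α} {s t : Fin n} : t ∈ cls q s ↔ q t = q s := by
  simp [cls]

theorem self_mem_cls (q : Fin n → α) (s : Fin n) : s ∈ cls q s := mem_cls.2 rfl

theorem blockSum_cls (G : Finset (Fin n) → ℝ) (q : Fin n → α) (s : Fin n) :
    blockSum G q (cls q s) = G (cls q s) :=
  blockSum_const G ⟨s, self_mem_cls q s⟩ fun _ ha _ hb =>
    (mem_cls.1 ha).trans (mem_cls.1 hb).symm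

theorem blockSum_splitClass (G : Finset (Fin n) → ℝ) (q : Fin n → α) (r : Fin n → β)
    (c : Fin n) : blockSum G (splitClass q r c) univ =
      blockSum G q univ - G (cls q c) + blockSum G r (cls q c) := by
  have h1 : ∀ s ∈ cls q c, ∀ t, q t = q s → t ∈ cls q c := fun s hs t ht =>
    mem_cls.2 (ht.trans (mem_cls.1 hs))
  rw [blockSum_split G q h1, blockSum_split G (splitClass q r c) (S := cls q c)
    fun s hs t ht => h1 s hs t (splitClass_eq.1 ht).1, blockSum_cls]
  rw [blockSum_congr G (r := r) (S := cls q c), blockSum_congr G (r := q) (S := (cls q c)ᶜ)]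
  · ring
  · intro s hs t _
    rw [splitClass_eq, and_iff_left]
    exact fun h => absurd (mem_cls.2 h) (mem_compl.1 hs)
  · intro s hs t ht
    rw [mem_cls] at hs ht
    rw [splitClass_eq]
    simp [hs, ht]

/-- The inequality of the refinement that splits one class, minus the equality for `q`: all the
other classes cancel. -/
theorem Active.gap_cls_le (hx : InPoly e x) {q : Fin n → α} (hq : Active e x q) {r : Fin n → β}
    (hr : Sorted x r) (c : Fin n) : gap e x (cls q c) ≤ blockSum (gap e x) r (cls q c) := by
  have h1 := hx.gap_univ_le (nonconst_splitClass (r := r) hq.1 c)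
    (sorted_splitClass (hq.sorted hx) hr c)
  rw [blockSum_splitClass, hq.gap_univ hx] at h1
  linarith

/-- The converse inequality for one class leaves no slack in the refined inequality. -/
theorem Active.splitClass (hx : InPoly e x) {q : Fin n → α} (hq : Active e x q) {r : Fin n → β}
    (hr : Sorted x r) {c : Fin n} (h : blockSum (gap e x) r (cls q c) ≤ gap e x (cls q c)) :
    Active e x (splitClass q r c) := by
  refine ⟨nonconst_splitClass hq.1 c, le_antisymm (hx.form_le (nonconst_splitClass hq.1 c)) ?_⟩
  have h1 := slack_of_sorted e (sorted_splitClass (hq.sorted hx) hr c)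
  rw [blockSum_splitClass, hq.gap_univ hx] at h1
  linarith

/-- Compare `q` with its coarsening in which the classes making up `D` are merged into one; the
blocks outside `D` cancel. -/
theorem Active.blockSum_le_gap (hx : InPoly e x) {q : Fin n → α} (hq : Active e x q)
    {D : Finset (Fin n)} {d : Fin n} (hd : d ∈ D) (hD : ∀ s ∈ D, ∀ t, q t = q s → t ∈ D)
    (hs : Sorted x fun s => if s ∈ D then q d else q s) :
    blockSum (gap e x) q D ≤ gap e x D := by
  have h0 := hq.gap_univ hx
  by_cases hn : Nonconst fun s => if s ∈ D then q d else q s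
  · have h1 := hx.gap_univ_le hn hs
    rw [h0, blockSum_split _ q hD, blockSum_split _ (fun s => if s ∈ D then q d else q s) (S := D),
      blockSum_const _ (q := fun s => if s ∈ D then q d else q s) (S := D) ⟨d, hd⟩,
      blockSum_congr _ (q := fun s => if s ∈ D then q d else q s) (r := q) (S := Dᶜ)] at h1
    · linarith
    · intro s hs t ht
      rw [mem_compl] at hs ht
      simp [hs, ht]
    · intro s hs t ht
      simp [hs, ht]
    · intro s hs t ht
      by_contra hc
      simp only [hs, hc, if_true, if_false] at ht
      exact hc (hD d hd t ht)
  -- The coarsening has a single block, so it gives no inequality; but then `D` is everything and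
  -- the claim is the equality for `q`.
  · have hu : D = univ := by
      refine eq_univ_of_forall fun t => ?_
      by_contra hc
      refine hn ⟨d, t, ?_⟩
      simp only [hd, hc, if_true, if_false]
      exact fun h => hc (hD d hd t h.symm)
    rw [hu, h0]

theorem exists_injective_sorted (x : Fin n → ℝ) :
    ∃ r : Fin n → Fin n, Function.Injective r ∧ Sorted x r := by
  refine ⟨(Tuple.sort fun s => -x s).symm, Equiv.injective _, fun s t hst => ?_⟩
  have h := Tuple.monotone_sort (fun s => -x s) hst.le
  simpa using h

/-- Split the class into singletons along a sorted order of the coordinates; singletons have gap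
zero, so the gap of the class is at most zero. -/
theorem Active.spread_cls_le (he : Growth n e) (hx : InPoly e x) {q : Fin n → α}
    (hq : Active e x q) (c : Fin n) : spread x (cls q c) ≤ e #(cls q c) := by
  obtain ⟨r, hr, hs⟩ := exists_injective_sorted x
  have h := hq.gap_cls_le hx hs c
  rw [blockSum_injOn _ hr.injOn, sum_eq_zero fun s _ => gap_singleton he x s] at h
  exact sub_nonpos.1 h

/-- Equal values in different classes produce equal values in two consecutive classes. Merging these
keeps `x` sorted, so their union would have gap at least the sum of the two gaps, against
`gap_union_lt`. -/
theorem Active.strict (he : Growth n e) (hx : InPoly e x) {q : Fin n → α}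
    (hq : Active e x q) {s t : Fin n} (hst : q s < q t) : x t < x s := by
  have hw := hq.sorted hx
  refine lt_of_le_of_ne (hw s t hst) fun heq => ?_
  -- `t'` lies in the class right after that of `s`; its value is squeezed between those of `s` and
  -- `t`, which agree.
  obtain ⟨t', ht', hmin, hxt⟩ : ∃ t', q s < q t' ∧ (∀ r, q s < q r → q t' ≤ q r) ∧
      x s = x t' := by
    obtain ⟨t', ht', hmin⟩ := exists_min_image (univ.filter fun r => q s < q r) q
      ⟨t, by simpa using hst⟩
    simp only [mem_filter, mem_univ, true_and] at ht' hmin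
    rcases (hmin t hst).eq_or_lt with h | h
    · exact ⟨t, hst, fun r hr => h ▸ hmin r hr, heq.symm⟩
    · exact ⟨t', ht', hmin, le_antisymm (heq.symm.le.trans (hw t' t h)) (hw s t' ht')⟩
  have hB := hq.spread_cls_le he hx s
  have hC := hq.spread_cls_le he hx t'
  have hdis : cls q s ∩ cls q t' = ∅ := by
    ext a
    simp only [mem_inter, mem_cls, notMem_empty, iff_false, not_and]
    exact fun h1 h2 => ht'.ne (h1.symm.trans h2)
  have hlt := (gap_union_lt he x hB hC (self_mem_cls q s) (self_mem_cls q t') hxt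
    (fun h => by
      have := mem_cls.1 (h (self_mem_cls q s))
      exact ht'.ne this)
    (fun h => by
      have := mem_cls.1 (h (self_mem_cls q t'))
      exact ht'.ne' this)).2
  rw [hdis, gap_empty he, add_zero] at hlt
  have hle := hq.blockSum_le_gap hx (D := cls q s ∪ cls q t') (d := s)
    (mem_union_left _ (self_mem_cls q s)) ?_ ?_
  · rw [blockSum_union, blockSum_cls, blockSum_cls] at hle
    · linarith
    · intro a ha b hb
      rw [mem_cls.1 ha, mem_cls.1 hb]
      exact ht'.ne
  · intro a ha b hab
    simp only [mem_union, mem_cls] at ha ⊢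
    rwa [hab]
  · intro a b hab
    simp only [mem_union, mem_cls] at hab
    split_ifs at hab with h1 h2 h2
    · exact absurd hab (lt_irrefl _)
    · have h3 := (hmin b hab).lt_of_ne fun h => h2 (Or.inr h.symm)
      refine hw a b ?_
      rcases h1 with h1 | h1
      · rwa [h1]
      · rwa [h1]
    · refine hw a b (hab.trans_le ?_)
      rcases h2 with h2 | h2
      · exact h2.ge
      · rw [h2]
        exact ht'.le
    · exact hw a b hab

/-- `D` is the union of the `p`-classes that meet a given `q`-class. Merging them keeps `x` sorted:
by strictness, an element of a `p`-class strictly between two of them has a value strictly between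
two values of the `q`-class, hence lies in that `q`-class too. -/
theorem Active.blockSum_saturation_le (he : Growth n e) (hx : InPoly e x) {p : Fin n → α}
    {q : Fin n → β} (hp : Active e x p) (hq : Active e x q) (s : Fin n) {D : Finset (Fin n)}
    (hmemD : ∀ t, t ∈ D ↔ ∃ c ∈ cls q s, p c = p t) :
    blockSum (gap e x) p D ≤ gap e x D := by
  obtain ⟨d, hdC, hdmin⟩ := exists_min_image (cls q s) p ⟨s, self_mem_cls q s⟩
  have hsat : ∀ a ∈ D, ∀ t, p t = p a → t ∈ D := by
    intro a ha t hta
    rw [hmemD] at ha ⊢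
    rwa [hta]
  refine hp.blockSum_le_gap hx (D := D) (d := d) ((hmemD d).2 ⟨d, hdC, rfl⟩) hsat ?_
  · intro a b hab
    simp only at hab
    split_ifs at hab with h1 h2 h2
    · exact absurd hab (lt_irrefl _)
    · by_cases hpab : p a < p b
      · exact (hp.strict he hx hpab).le
      · exfalso
        obtain ⟨c, hc, hca⟩ := (hmemD a).1 h1
        have hne : p b ≠ p a := fun h => h2 (hsat a h1 b h)
        have hba : p b < p c := hca ▸ lt_of_le_of_ne (not_lt.1 hpab) hne
        have x1 := hp.strict he hx hab
        have x2 := hp.strict he hx hba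
        have hqd : q d = q s := mem_cls.1 hdC
        have hqc : q c = q s := mem_cls.1 hc
        refine h2 ((hmemD b).2 ⟨b, mem_cls.2 ?_, rfl⟩)
        rcases lt_trichotomy (q b) (q s) with h | h | h
        · have := hq.strict he hx (s := b) (t := d) (hqd ▸ h)
          linarith
        · exact h
        · have := hq.strict he hx (s := c) (t := b) (hqc ▸ h)
          linarith
    · obtain ⟨c, hc, hcb⟩ := (hmemD b).1 h2
      exact (hp.strict he hx (hab.trans_le (hcb ▸ hdmin c hc))).le
    · exact (hp.strict he hx hab).le

/-- Classes of ordered partitions whose inequalities are equalities at the same point do not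
cross. -/
theorem Active.cls_nested (he : Growth n e) (hx : InPoly e x) {p : Fin n → α} {q : Fin n → β}
    (hp : Active e x p) (hq : Active e x q) (s : Fin n) :
    cls p s ⊆ cls q s ∨ cls q s ⊆ cls p s := by
  by_contra! hcon
  obtain ⟨hcon1, hcon2⟩ := hcon
  set C := cls q s with hC
  have hsC : s ∈ C := self_mem_cls q s
  let P : α → Finset (Fin n) := fun v => univ.filter fun t => p t = v
  have hP : ∀ t, P (p t) = cls p t := fun t => rfl
  -- Enlarge `C` by the `p`-classes that meet it, one at a time. Each step is either an inclusion or
  -- a strict loss by `gap_union_lt`, and the class of `s`, which neither contains `C` nor lies in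
  -- it, forces a strict loss. The total contradicts the two inequalities from splitting `C` along
  -- `p` (`hsplit`) and from merging the `p`-classes that meet `C` (`hmerge`).
  have key : ∀ V : Finset α, V ⊆ C.image p →
      spread x (C ∪ V.biUnion P) ≤ e #(C ∪ V.biUnion P) ∧
      gap e x (C ∪ V.biUnion P) + ∑ v ∈ V, gap e x (C.filter fun t => p t = v) ≤
        gap e x C + ∑ v ∈ V, gap e x (P v) ∧
      (p s ∈ V → gap e x (C ∪ V.biUnion P) + ∑ v ∈ V, gap e x (C.filter fun t => p t = v) <
        gap e x C + ∑ v ∈ V, gap e x (P v)) := by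
    intro V
    induction V using Finset.induction_on with
    | empty =>
      intro _
      simp [hC, hq.spread_cls_le he hx s]
    | insert v V hv ih =>
      intro hV
      obtain ⟨ih1, ih2, ih3⟩ := ih fun w hw => hV (mem_insert_of_mem hw)
      obtain ⟨c, hc, rfl⟩ := mem_image.1 (hV (mem_insert_self v V))
      set D := C ∪ V.biUnion P with hD
      have hun : C ∪ (insert (p c) V).biUnion P = D ∪ P (p c) := by
        rw [biUnion_insert, hD, union_assoc, union_comm (P (p c))]
      have hint : D ∩ P (p c) = C.filter fun t => p t = p c := by
        ext t
        simp only [hD, P, mem_inter, mem_union, mem_biUnion, mem_filter, mem_univ, true_and]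
        constructor
        · rintro ⟨h1 | ⟨w, hw, rfl⟩, h2⟩
          · exact ⟨h1, h2⟩
          · exact absurd (h2 ▸ hw) hv
        · exact fun h => ⟨Or.inl h.1, h.2⟩
      rw [hun, sum_insert hv, sum_insert hv, ← hint]
      have hcD : c ∈ D := mem_union_left _ hc
      have hcP : c ∈ P (p c) := by simp [P]
      have hPs : spread x (P (p c)) ≤ e #(P (p c)) := hq.1.elim fun _ _ => hp.spread_cls_le he hx c
      by_cases h1 : D ⊆ P (p c)
      -- In the two inclusion cases union and intersection are the two sets themselves, so nothing
      -- changes; the class of `s` cannot be the one added, unless the strict loss has already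
      -- occurred.
      · rw [union_eq_right.2 h1, inter_eq_left.2 h1]
        refine ⟨hPs, by linarith, fun hs => ?_⟩
        rcases mem_insert.1 hs with h | h
        · refine absurd (subset_union_left.trans (hD ▸ h1)) ?_
          rw [← h]
          exact hcon2
        · have := ih3 h
          linarith
      by_cases h2 : P (p c) ⊆ D
      · rw [union_eq_left.2 h2, inter_eq_right.2 h2]
        refine ⟨ih1, by linarith, fun hs => ?_⟩
        rcases mem_insert.1 hs with h | h
        · refine absurd ?_ hcon1
          rw [← hP, h, ← inter_eq_right.2 h2, hint]
          exact filter_subset _ _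
        · have := ih3 h
          linarith
      obtain ⟨k1, k2⟩ := gap_union_lt he x ih1 hPs hcD hcP rfl h1 h2
      refine ⟨k1.le, by linarith, fun _ => by linarith⟩
  obtain ⟨-, -, hkey⟩ := key _ (Subset.refl (C.image p))
  have hlt := hkey (mem_image_of_mem p hsC)
  have hsplit := hq.gap_cls_le hx (hp.sorted hx) s
  rw [blockSum_eq_sum_image, ← hC] at hsplit
  have hmemD : ∀ t, t ∈ C ∪ (C.image p).biUnion P ↔ ∃ c ∈ C, p c = p t := by
    intro t
    simp only [P, mem_union, mem_biUnion, mem_image, mem_filter, mem_univ, true_and]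
    constructor
    · rintro (h | ⟨_, ⟨c, hc, rfl⟩, h⟩)
      · exact ⟨t, h, rfl⟩
      · exact ⟨c, hc, h.symm⟩
    · rintro ⟨c, hc, h⟩
      exact Or.inr ⟨p c, ⟨c, hc, rfl⟩, h.symm⟩
  set D := C ∪ (C.image p).biUnion P
  have hmerge := hp.blockSum_saturation_le he hx hq s hmemD
  have himg : D.image p = C.image p := by
    ext v
    simp only [mem_image, hmemD]
    constructor
    · rintro ⟨t, ⟨c, hc, hct⟩, rfl⟩
      exact ⟨c, hc, hct⟩
    · rintro ⟨c, hc, rfl⟩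
      exact ⟨c, ⟨c, hc, rfl⟩, rfl⟩
  rw [blockSum_eq_sum_image, himg] at hmerge
  have hfil : ∀ v ∈ C.image p, (D.filter fun t => p t = v) = P v := by
    intro v hv
    obtain ⟨c, hc, rfl⟩ := mem_image.1 hv
    ext t
    simp only [P, mem_filter, mem_univ, true_and, and_iff_right_iff_imp, hmemD]
    exact fun h => ⟨c, hc, h.symm⟩
  rw [sum_congr rfl fun v hv => by rw [hfil v hv]] at hmerge
  linarith

end Active

end Permutoassoc

namespace Permutoassoc

open Finset

/-! ### Labels of the faces -/

section Labels

variable {n : ℕ}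

/-- `f` is an ordered partition of `Fin n` into `l` blocks, numbered `0, …, l - 1`. -/
def IsLayering (f : Fin n → ℕ) (l : ℕ) : Prop := (∀ s, f s < l) ∧ ∀ i < l, ∃ s, f s = i

/-- A family of pairwise noncrossing chords of a polygon with vertices `0, …, l`; the
chord `(a, b)` stands for the bracket around the letters `a, …, b - 1` of a word of length `l`. -/
structure IsNoncrossing (l : ℕ) (T : Finset (ℕ × ℕ)) : Prop where
  add_two_le : ∀ d ∈ T, d.1 + 2 ≤ d.2
  le : ∀ d ∈ T, d.2 ≤ l
  noncrossing : ∀ d ∈ T, ∀ d' ∈ T, d.1 < d'.1 → d'.1 < d.2 → d'.2 ≤ d.2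

/-- The ordered partition `q` arises from `f` by collapsing some disjoint brackets in `T`. -/
def Compatible {α : Type*} [LinearOrder α] (f : Fin n → ℕ) (T : Finset (ℕ × ℕ)) (q : Fin n → α) :
    Prop :=
  Nonconst q ∧ (∀ s t, f s = f t → q s = q t) ∧ (∀ s t, f s < f t → q s ≤ q t) ∧
    ∀ s t, f s < f t → q s = q t → ∃ d ∈ T, ∀ r, q r = q s ↔ d.1 ≤ f r ∧ f r < d.2

theorem exists_interval_cls {α : Type*} [LinearOrder α] {f : Fin n → ℕ} {q : Fin n → α}
    (h2 : ∀ s t, f s = f t → q s = q t) (h3 : ∀ s t, f s < f t → q s ≤ q t) (s : Fin n) :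
    ∃ a b : Fin n, ∀ r, q r = q s ↔ f a ≤ f r ∧ f r < f b + 1 := by
  have hmono : ∀ s t, f s ≤ f t → q s ≤ q t := fun s t hst =>
    hst.eq_or_lt.elim (fun h => (h2 s t h).le) (h3 s t)
  obtain ⟨a, ha, hamin⟩ := exists_min_image (cls q s) f ⟨s, self_mem_cls q s⟩
  obtain ⟨b, hb, hbmax⟩ := exists_max_image (cls q s) f ⟨s, self_mem_cls q s⟩
  refine ⟨a, b, fun r => ⟨fun hr => ?_, fun hr => ?_⟩⟩
  · have h4 := hamin r (mem_cls.2 hr)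
    have h5 := hbmax r (mem_cls.2 hr)
    omega
  · have h4 := hmono a r hr.1
    have h5 := hmono r b (by omega)
    rw [mem_cls.1 ha] at h4
    rw [mem_cls.1 hb] at h5
    exact le_antisymm h5 h4

theorem exists_layering {α : Type*} [LinearOrder α] (p : Fin n → α) :
    ∃ f : Fin n → ℕ, IsLayering f #(univ.image p) ∧ ∀ s t, f s < f t ↔ p s < p t := by
  let φ := (univ.image p).orderIsoOfFin rfl
  refine ⟨fun s => (φ.symm ⟨p s, mem_image_of_mem p (mem_univ s)⟩ : ℕ), ⟨fun s => Fin.is_lt _,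
    fun i hi => ?_⟩, fun s t => ?_⟩
  · obtain ⟨s, -, hs⟩ := mem_image.1 (φ ⟨i, hi⟩).2
    refine ⟨s, ?_⟩
    have : (⟨p s, mem_image_of_mem p (mem_univ s)⟩ : univ.image p) = φ ⟨i, hi⟩ := Subtype.ext hs
    change ((φ.symm ⟨p s, _⟩ : Fin _) : ℕ) = i
    rw [this, OrderIso.symm_apply_apply]
  · rw [← Fin.lt_def, OrderIso.lt_iff_lt, Subtype.mk_lt_mk]

theorem card_image_lt_of_refine {α β : Type*} [DecidableEq α] [DecidableEq β] {p : Fin n → α}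
    {r : Fin n → β} (h : ∀ s t, r s = r t → p s = p t) {s t : Fin n} (hp : p s = p t)
    (hr : r s ≠ r t) : #(univ.image p) < #(univ.image r) := by
  have hf : Function.FactorsThrough p r := fun a b hab => h a b hab
  have himg : univ.image p = (univ.image r).image (Function.extend r p fun _ => p s) := by
    rw [image_image]
    congr 1
    funext a
    exact (hf.extend_apply _ a).symm
  rw [himg]
  refine lt_of_le_of_ne card_image_le fun hc => hr ?_
  refine card_image_iff.1 hc (by simp) (by simp) ?_
  rw [hf.extend_apply, hf.extend_apply, hp]

variable {e : ℕ → ℝ} {x : Fin n → ℝ}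

theorem Active.relabel {α β : Type*} [LinearOrder α] [LinearOrder β] {q : Fin n → α}
    {r : Fin n → β} (hq : Active e x q) (h : ∀ s t, q s < q t ↔ r s < r t) : Active e x r := by
  obtain ⟨⟨s, t, hst⟩, h2⟩ := hq
  refine ⟨⟨s, t, fun hc => hst ((eq_iff_of_lt_iff h s t).2 hc)⟩, ?_⟩
  rw [← form_congr h, ← bound_congr e h, h2]

/-- Take a tight `p` with the largest number of blocks. If a tight `q` separated two elements of a
`p`-class, splitting that class along `q` would give a tight partition with more blocks. -/
theorem exists_finest_active (he : Growth n e) (hx : InPoly e x)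
    (h : ∃ q : Fin n → Fin n, Active e x q) :
    ∃ p : Fin n → Fin n, Active e x p ∧ ∀ q : Fin n → Fin n, Active e x q →
      ∀ s t, p s = p t → q s = q t := by
  classical
  obtain ⟨q₀, hq₀⟩ := h
  obtain ⟨p, hp, hmax⟩ := exists_max_image (univ.filter fun q : Fin n → Fin n => Active e x q)
    (fun q => #(univ.image q)) ⟨q₀, by simpa using hq₀⟩
  simp only [mem_filter, mem_univ, true_and] at hp hmax
  refine ⟨p, hp, fun q hq s t hst => ?_⟩
  by_contra hne
  -- A `q`-class that meets `cls p s` cannot contain it, since `q` separates `s` and `t`; by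
  -- nestedness it lies inside. So `cls p s` is a union of `q`-classes, and merging them in `q`
  -- gives the inequality needed for the split.
  have hle : blockSum (gap e x) q (cls p s) ≤ gap e x (cls p s) := by
    refine hq.blockSum_saturation_le he hx hp s fun a => ⟨fun ha => ⟨a, ha, rfl⟩, ?_⟩
    rintro ⟨c, hc, hca⟩
    rcases hp.cls_nested he hx hq c with h | h
    · exfalso
      have h1 := mem_cls.1 hc
      have h2 := mem_cls.1 (h (mem_cls.2 h1.symm))
      have h3 := mem_cls.1 (h (mem_cls.2 (hst.symm.trans h1.symm)))
      exact hne (h2.trans h3.symm)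
    · exact mem_cls.2 ((mem_cls.1 (h (mem_cls.2 hca.symm))).trans (mem_cls.1 hc))
  have hact := hp.splitClass hx (hq.sorted hx) hle
  obtain ⟨r, hr⟩ := exists_fin_relabel (splitClass p q s)
  have h1 := hmax r (hact.relabel hr)
  refine h1.not_gt (card_image_lt_of_refine (fun a b hab => ?_) hst fun hc => ?_)
  · exact (splitClass_eq.1 ((eq_iff_of_lt_iff hr a b).2 hab)).1
  · exact hne ((splitClass_eq.1 ((eq_iff_of_lt_iff hr s t).2 hc)).2 rfl)

theorem blockSum_eq_sum_blockSum {α β : Type*} [DecidableEq α] [DecidableEq β]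
    (G : Finset (Fin n) → ℝ) {p : Fin n → α} {q : Fin n → β} (h : ∀ s t, p s = p t → q s = q t) :
    blockSum G p univ = ∑ v ∈ univ.image q, blockSum G p (univ.filter fun t => q t = v) := by
  unfold blockSum
  rw [← sum_fiberwise_of_maps_to (g := q) (t := univ.image q) fun s hs => mem_image_of_mem q hs]
  refine sum_congr rfl fun v _ => sum_congr rfl fun s hs => ?_
  have : ((univ.filter fun t => q t = v).filter fun t => p t = p s) =
      univ.filter fun t => p t = p s := by
    rw [filter_filter]
    refine filter_congr fun t _ => and_iff_right_of_imp fun ht => ?_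
    rw [h t s ht]
    exact (mem_filter.1 hs).2
  rw [this]

/-- The set of inequalities that are equalities at a boundary point of the polytope is described
by an ordered partition with a bracketing of its blocks. -/
theorem exists_label (he : Growth n e) (hx : InPoly e x)
    (h : ∃ q : Fin n → Fin n, Active e x q) :
    ∃ l f T, 2 ≤ l ∧ IsLayering f l ∧ IsNoncrossing l T ∧ (0, l) ∈ T ∧
      ∀ q : Fin n → Fin n, Active e x q ↔ Compatible f T q := by
  classical
  obtain ⟨p, hp, hcoarse⟩ := exists_finest_active he hx h
  obtain ⟨f, hf, hfp⟩ := exists_layering p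
  have hfeq := eq_iff_of_lt_iff hfp
  set l := #(univ.image p) with hl
  have hl2 : 2 ≤ l := by
    obtain ⟨s, t, hst⟩ := hp.1
    have h1 := hf.1 s
    have h2 := hf.1 t
    have h3 : f s ≠ f t := fun hc => hst ((hfeq s t).1 hc)
    omega
  -- The brackets are the intervals of at least two layers that form a class of some tight
  -- partition, with the full interval added. They do not cross because tight classes are nested.
  let T : Finset (ℕ × ℕ) := (range l ×ˢ range (l + 1)).filter fun d => d.1 + 2 ≤ d.2 ∧
    (d = (0, l) ∨ ∃ q : Fin n → Fin n, Active e x q ∧ ∃ s, ∀ r, q r = q s ↔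
      d.1 ≤ f r ∧ f r < d.2)
  have hT : ∀ d, d ∈ T ↔ d.2 ≤ l ∧ d.1 + 2 ≤ d.2 ∧ (d = (0, l) ∨ ∃ q : Fin n → Fin n,
      Active e x q ∧ ∃ s, ∀ r, q r = q s ↔ d.1 ≤ f r ∧ f r < d.2) := by
    intro d
    simp only [T, mem_filter, mem_product, mem_range]
    constructor
    · exact fun h => ⟨by omega, h.2⟩
    · exact fun h => ⟨by omega, h.2⟩
  have hcross : ∀ d ∈ T, ∀ d' ∈ T, d.1 < d'.1 → d'.1 < d.2 → d'.2 ≤ d.2 := by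
    intro d hd d' hd' h1 h2
    by_contra! h3
    obtain ⟨hd1, hd2, hd3⟩ := (hT d).1 hd
    obtain ⟨hd1', hd2', hd3'⟩ := (hT d').1 hd'
    rcases hd3 with rfl | ⟨q, hq, s, hs⟩
    · simp only at h3
      omega
    rcases hd3' with rfl | ⟨q', hq', s', hs'⟩
    · simp at h1
    obtain ⟨a, ha⟩ := hf.2 d.1 (by omega)
    obtain ⟨b, hb⟩ := hf.2 d'.1 (by omega)
    obtain ⟨c, hc⟩ := hf.2 d.2 (by omega)
    have qa := (hs a).2 (by omega)
    have qb := (hs b).2 (by omega)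
    have qb' := (hs' b).2 (by omega)
    have qc' := (hs' c).2 (by omega)
    rcases hq.cls_nested he hx hq' b with hsub | hsub
    · have := (hs' a).1 ((mem_cls.1 (hsub (mem_cls.2 (qa.trans qb.symm)))).trans qb')
      omega
    · have := (hs c).1 ((mem_cls.1 (hsub (mem_cls.2 (qc'.trans qb'.symm)))).trans qb)
      omega
  refine ⟨l, f, T, hl2, hf, ⟨fun d hd => ((hT d).1 hd).2.1, fun d hd => ((hT d).1 hd).1, hcross⟩,
    (hT _).2 ⟨le_rfl, by simpa using hl2, Or.inl rfl⟩, fun q => ⟨fun hq => ?_, ?_⟩⟩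
  · have h2 : ∀ s t, f s = f t → q s = q t := fun s t hst =>
      hcoarse q hq s t ((hfeq s t).1 hst)
    have h3 : ∀ s t, f s < f t → q s ≤ q t := by
      intro s t hst
      by_contra! hc
      exact lt_asymm (hp.strict he hx ((hfp s t).1 hst)) (hq.strict he hx hc)
    refine ⟨hq.1, h2, h3, fun s t hst hqst => ?_⟩
    obtain ⟨a, b, hcl⟩ := exists_interval_cls h2 h3 s
    refine ⟨(f a, f b + 1), (hT _).2 ⟨hf.1 b, ?_, Or.inr ⟨q, hq, s, hcl⟩⟩, hcl⟩
    have h4 := (hcl s).1 rfl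
    have h5 := (hcl t).1 hqst.symm
    simp only
    omega
  · rintro ⟨hnc, h2, h3, h4⟩
    have hlt : ∀ s t, q s < q t → p s < p t := by
      intro s t hst
      rw [← hfp]
      by_contra! hc
      rcases hc.eq_or_lt with hc | hc
      · exact hst.ne' (h2 t s hc)
      · exact (h3 t s hc).not_gt hst
    have hsort : Sorted x q := fun s t hst => hp.sorted hx s t (hlt s t hst)
    refine ⟨hnc, le_antisymm (hx.form_le hnc) ?_⟩
    have h5 := slack_of_sorted e hsort
    -- Each class of `q` is a single layer or a bracket of `T`. A proper bracket is a class of some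
    -- other tight `q'`, for which splitting along the finest `p` bounds its gap by those of its
    -- layers. Summing gives the gap of the whole set, since `p` is tight.
    have h6 : blockSum (gap e x) q univ ≤ gap e x univ := by
      rw [hp.gap_univ hx, blockSum_eq_sum_image,
        blockSum_eq_sum_blockSum _ (p := p) (q := q) fun s t hst => h2 s t ((hfeq s t).2 hst)]
      refine sum_le_sum fun v hv => ?_
      obtain ⟨s, -, rfl⟩ := mem_image.1 hv
      change gap e x (cls q s) ≤ blockSum (gap e x) p (cls q s)
      by_cases hs : ∀ a ∈ cls q s, ∀ b ∈ cls q s, f a = f b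
      · rw [blockSum_const _ ⟨s, self_mem_cls q s⟩ fun a ha b hb => (hfeq a b).1 (hs a ha b hb)]
      · push Not at hs
        obtain ⟨a, ha, b, hb, hab⟩ := hs
        wlog hlt' : f a < f b generalizing a b
        · exact this b hb a ha hab.symm (by omega)
        rw [mem_cls] at ha hb
        obtain ⟨d, hd, hdr⟩ := h4 a b hlt' (ha.trans hb.symm)
        -- The full bracket belongs to `T` without being a class of a tight partition; it is
        -- excluded here because collapsing it would make `q` constant.
        rcases ((hT d).1 hd).2.2 with rfl | ⟨q', hq', s', hs'⟩
        · exfalso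
          obtain ⟨c, c', hcc⟩ := hnc
          exact hcc (((hdr c).2 ⟨Nat.zero_le _, hf.1 c⟩).trans
            ((hdr c').2 ⟨Nat.zero_le _, hf.1 c'⟩).symm)
        · have : cls q s = cls q' s' := by
            ext r
            rw [mem_cls, mem_cls, hs', ← hdr, ha]
          rw [this]
          exact hq'.gap_cls_le hx (hp.sorted hx) s'
    linarith

end Labels

end Permutoassoc

namespace Permutoassoc

open Finset

/-! ### Points with prescribed equalities -/

section Realize

variable {n : ℕ} {e : ℕ → ℝ}

/-- All the gaps inside `S` are nonnegative, and the gap of `S` itself vanishes. -/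
def Good (e : ℕ → ℝ) (x : Fin n → ℝ) (S : Finset (Fin n)) : Prop :=
  spread x S = e #S ∧ ∀ B ⊆ S, e #B ≤ spread x B

theorem spread_congr {x y : Fin n → ℝ} {S B : Finset (Fin n)}
    (h : ∀ s ∈ S, ∀ t ∈ S, x s - x t = y s - y t) (hB : B ⊆ S) : spread x B = spread y B := by
  unfold spread cross
  congr 1
  refine sum_congr rfl fun s hs => sum_congr rfl fun t ht => ?_
  rw [h s (hB hs) t (hB ht)]

/-- Place `S₁` above `S₂` at the distance `D` that makes the spread of the union exactly e #(S₁ ∪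
S₂). The growth condition makes `D` so large that every proper subset meeting both parts has
strictly positive gap, so gluing creates a single new set of gap zero, the union itself. -/
theorem Good.union (he : Growth n e) {x₁ x₂ : Fin n → ℝ} {S₁ S₂ : Finset (Fin n)}
    (h₁ : Good e x₁ S₁) (h₂ : Good e x₂ S₂) (hd : Disjoint S₁ S₂) (hS₁ : S₁.Nonempty)
    (hS₂ : S₂.Nonempty) :
    ∃ x : Fin n → ℝ, (∀ s ∈ S₁, ∀ t ∈ S₁, x s - x t = x₁ s - x₁ t) ∧
      (∀ s ∈ S₂, ∀ t ∈ S₂, x s - x t = x₂ s - x₂ t) ∧ (∀ s ∈ S₁, ∀ t ∈ S₂, x t < x s) ∧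
      Good e x (S₁ ∪ S₂) ∧ ∀ B ⊆ S₁ ∪ S₂, spread x B = e #B → B ⊆ S₁ ∨ B ⊆ S₂ ∨ B = S₁ ∪ S₂ := by
  obtain ⟨v, hv, hvmin⟩ := exists_min_image S₁ x₁ hS₁
  obtain ⟨w, hw, hwmax⟩ := exists_max_image S₂ x₂ hS₂
  have hcard : #(S₁ ∪ S₂) = #S₁ + #S₂ := card_union_of_disjoint hd
  have hn : #S₁ + #S₂ ≤ n := hcard ▸ (card_le_univ _).trans_eq (Fintype.card_fin n)
  have ha : 1 ≤ #S₁ := card_pos.2 hS₁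
  have hb : 1 ≤ #S₂ := card_pos.2 hS₂
  have ha' : (1 : ℝ) ≤ #S₁ := by exact_mod_cast ha
  have hb' : (1 : ℝ) ≤ #S₂ := by exact_mod_cast hb
  have hab : (0 : ℝ) < (#S₁ : ℝ) * #S₂ := by positivity
  set K₁ := ∑ s ∈ S₁, (x₁ s - x₁ v) with hK₁
  set K₂ := ∑ t ∈ S₂, (x₂ w - x₂ t) with hK₂
  have k1 : K₁ ≤ 2 * e #S₁ := by
    rw [← h₁.1]
    exact (sum_le_sum fun s _ => le_abs_self _).trans (sum_dist_le_two_spread x₁ hv)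
  have k2 : K₂ ≤ 2 * e #S₂ := by
    rw [← h₂.1]
    refine (sum_le_sum fun s _ => ?_).trans (sum_dist_le_two_spread x₂ hw)
    rw [abs_sub_comm]
    exact le_abs_self _
  set E := e (#S₁ + #S₂) - e #S₁ - e #S₂ with hE
  -- `D` solves the linear equation `1 / 2 * cross x S₁ S₂ = E`: every distance across is `D` plus
  -- the height of `s` over the bottom of `S₁` plus the depth of `t` below the top of `S₂`, and
  -- these add up to `K₁` and `K₂`.
  set D := (2 * E - (#S₂ * K₁ + #S₁ * K₂)) / ((#S₁ : ℝ) * #S₂) with hD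
  have hDeq : (#S₁ : ℝ) * #S₂ * D = 2 * E - (#S₂ * K₁ + #S₁ * K₂) := by
    rw [hD]
    field_simp
  have hDge : e (#S₁ + #S₂) ≤ (#S₁ : ℝ) * #S₂ * D := by
    have h3 := he.two_mul_add_le ha hb hn
    have h4 := mul_le_mul_of_nonneg_left k1 (zero_le_one.trans hb')
    have h5 := mul_le_mul_of_nonneg_left k2 (zero_le_one.trans ha')
    rw [hDeq, hE]
    linarith
  have hepos : 0 < e (#S₁ + #S₂) := he.pos (by omega) hn
  have hDpos : 0 < D := pos_of_mul_pos_right (hepos.trans_le hDge) hab.le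
  let x : Fin n → ℝ := fun s => if s ∈ S₁ then x₁ s - x₁ v + D else x₂ s - x₂ w
  have hx1 : ∀ s ∈ S₁, x s = x₁ s - x₁ v + D := fun s hs => if_pos hs
  have hx2 : ∀ s ∈ S₂, x s = x₂ s - x₂ w := fun s hs => if_neg (disjoint_right.1 hd hs)
  have hc1 : ∀ s ∈ S₁, ∀ t ∈ S₁, x s - x t = x₁ s - x₁ t := by
    intro s hs t ht
    rw [hx1 s hs, hx1 t ht]
    ring
  have hc2 : ∀ s ∈ S₂, ∀ t ∈ S₂, x s - x t = x₂ s - x₂ t := by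
    intro s hs t ht
    rw [hx2 s hs, hx2 t ht]
    ring
  have hge : ∀ s ∈ S₁, ∀ t ∈ S₂, D ≤ x s - x t := by
    intro s hs t ht
    have := hvmin s hs
    have := hwmax t ht
    rw [hx1 s hs, hx2 t ht]
    linarith
  have hcross : 1 / 2 * cross x S₁ S₂ = E := by
    have : cross x S₁ S₂ = ∑ s ∈ S₁, ∑ t ∈ S₂, ((x₁ s - x₁ v) + D + (x₂ w - x₂ t)) := by
      refine sum_congr rfl fun s hs => sum_congr rfl fun t ht => ?_
      rw [abs_of_nonneg (hDpos.le.trans (hge s hs t ht)), hx1 s hs, hx2 t ht]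
      ring
    rw [this]
    simp only [sum_add_distrib, sum_const, nsmul_eq_mul, ← mul_sum]
    rw [← hK₁, ← hK₂]
    linarith
  have htot : spread x (S₁ ∪ S₂) = e #(S₁ ∪ S₂) := by
    rw [spread_union x hd, spread_congr hc1 Subset.rfl, spread_congr hc2 Subset.rfl, hcross, h₁.1,
      h₂.1, hcard, hE]
    ring
  have hlt : ∀ B ⊆ S₁ ∪ S₂, ¬ B ⊆ S₁ → ¬ B ⊆ S₂ → B ≠ S₁ ∪ S₂ → e #B < spread x B := by
    intro B hB hB1 hB2 hne
    have hBu : B = (B ∩ S₁) ∪ (B ∩ S₂) := by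
      rw [← inter_union_distrib_left, inter_eq_left.2 hB]
    have hdB : Disjoint (B ∩ S₁) (B ∩ S₂) := hd.mono inter_subset_right inter_subset_right
    have p1 : 1 ≤ #(B ∩ S₁) := by
      obtain ⟨b, hbB, hb2⟩ := not_subset.1 hB2
      exact card_pos.2 ⟨b, mem_inter.2 ⟨hbB, (mem_union.1 (hB hbB)).resolve_right hb2⟩⟩
    have p2 : 1 ≤ #(B ∩ S₂) := by
      obtain ⟨b, hbB, hb2⟩ := not_subset.1 hB1
      exact card_pos.2 ⟨b, mem_inter.2 ⟨hbB, (mem_union.1 (hB hbB)).resolve_left hb2⟩⟩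
    have hcB : #B = #(B ∩ S₁) + #(B ∩ S₂) := by
      conv_lhs => rw [hBu]
      exact card_union_of_disjoint hdB
    have hcl : #B < #S₁ + #S₂ := hcard ▸ card_lt_card (hB.ssubset_of_ne hne)
    have hsp : 1 / 2 * (#(B ∩ S₁) * #(B ∩ S₂) * D) ≤ spread x B := by
      conv_rhs => rw [hBu]
      rw [spread_union x hdB]
      have c1 : ∑ s ∈ B ∩ S₁, ∑ t ∈ B ∩ S₂, D ≤ cross x (B ∩ S₁) (B ∩ S₂) :=
        sum_le_sum fun s hs => sum_le_sum fun t ht =>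
          (hge s (mem_inter.1 hs).2 t (mem_inter.1 ht).2).trans (le_abs_self _)
      simp only [sum_const, nsmul_eq_mul] at c1
      have := spread_nonneg x (B ∩ S₁)
      have := spread_nonneg x (B ∩ S₂)
      linarith
    obtain ⟨s, hs⟩ : ∃ s, #S₁ + #S₂ = s + 1 := ⟨#S₁ + #S₂ - 1, by omega⟩
    -- With `s = #S₁ + #S₂ - 1 ≥ #B`, the growth condition gives 2 e s < (s - 1) D, and `slope_le`
    -- passes from `s` to `#B`. Finally #B - 1 ≤ #(B ∩ S₁) #(B ∩ S₂), and that product times D is at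
    -- most twice the spread of `B`.
    have g1 := he.step s #S₁ #S₂ (by omega) (by omega) hs ha hb
    rw [hs] at hDge
    have g2 := he.slope_le (b := #B) (s := s) (by omega) (by omega) (by omega)
    have hs1 : (0 : ℝ) < (s : ℝ) - 1 := by
      have : (2 : ℝ) ≤ s := by exact_mod_cast (by omega : 2 ≤ s)
      linarith
    have g3 : 2 * e s < ((s : ℝ) - 1) * D := by
      have : (#S₁ : ℝ) * #S₂ * (2 * e s) < (#S₁ : ℝ) * #S₂ * (((s : ℝ) - 1) * D) := by
        have := mul_le_mul_of_nonneg_left hDge hs1.le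
        linarith
      exact lt_of_mul_lt_mul_left this hab.le
    have hβ : (0 : ℝ) < (#B : ℝ) - 1 := by
      have : (2 : ℝ) ≤ #B := by exact_mod_cast (by omega : 2 ≤ #B)
      linarith
    have g4 : 2 * e #B < ((#B : ℝ) - 1) * D := by
      have h5 := mul_lt_mul_of_pos_left g3 hβ
      have : ((s : ℝ) - 1) * (2 * e #B) < ((s : ℝ) - 1) * (((#B : ℝ) - 1) * D) := by linarith
      exact lt_of_mul_lt_mul_left this hs1.le
    have g5 : (#B : ℝ) - 1 ≤ #(B ∩ S₁) * #(B ∩ S₂) := by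
      have q1 : (1 : ℝ) ≤ #(B ∩ S₁) := by exact_mod_cast p1
      have q2 : (1 : ℝ) ≤ #(B ∩ S₂) := by exact_mod_cast p2
      rw [hcB]
      push_cast
      nlinarith
    have g6 := mul_le_mul_of_nonneg_right g5 hDpos.le
    linarith
  refine ⟨x, hc1, hc2, fun s hs t ht => ?_, ⟨htot, fun B hB => ?_⟩, fun B hB hBe => ?_⟩
  · have := hge s hs t ht
    linarith
  · by_cases hB1 : B ⊆ S₁
    · rw [spread_congr hc1 hB1]
      exact h₁.2 B hB1
    by_cases hB2 : B ⊆ S₂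
    · rw [spread_congr hc2 hB2]
      exact h₂.2 B hB2
    by_cases hne : B = S₁ ∪ S₂
    · rw [hne, htot]
    exact (hlt B hB hB1 hB2 hne).le
  · by_contra! hc
    exact (hlt B hB hc.1 hc.2.1 hc.2.2).ne' hBe

theorem good_singleton (he : Growth n e) (x : Fin n → ℝ) (a : Fin n) : Good e x {a} := by
  have h1 : spread x {a} = e #({a} : Finset (Fin n)) := by
    rw [spread_singleton, card_singleton, he.one]
  refine ⟨h1, fun B hB => ?_⟩
  rcases subset_singleton_iff.1 hB with rfl | rfl
  · rw [spread_empty, card_empty, he.zero]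
  · exact h1.ge

/-- Glue the elements one by one, the largest index at the bottom. This fills a single layer; the
strict order inside it is used later to show that tight partitions do not split layers. -/
theorem exists_good_antitone (he : Growth n e) (S : Finset (Fin n)) (hS : S.Nonempty) :
    ∃ x : Fin n → ℝ, Good e x S ∧ ∀ s ∈ S, ∀ t ∈ S, s < t → x t < x s := by
  induction S using Finset.induction_on_max with
  | empty => exact absurd hS (by simp)
  | insert a S ha ih =>
    rcases S.eq_empty_or_nonempty with rfl | hS'
    · refine ⟨0, by simpa using good_singleton he 0 a, ?_⟩
      simp
    · obtain ⟨y, hy, hyS⟩ := ih hS'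
      obtain ⟨x, hx1, -, hx3, hx4, -⟩ := hy.union he (good_singleton he 0 a)
        (disjoint_singleton_right.2 fun h => (ha a h).false) hS' (singleton_nonempty a)
      rw [union_comm, ← insert_eq] at hx4
      refine ⟨x, hx4, fun s hs t ht hst => ?_⟩
      rcases mem_insert.1 hs with rfl | hs'
      · rcases mem_insert.1 ht with rfl | ht'
        · exact absurd hst (lt_irrefl _)
        · exact absurd hst (ha t ht').not_gt
      · rcases mem_insert.1 ht with rfl | ht'
        · exact hx3 s hs' t (mem_singleton_self t)
        · have h1 := hx1 s hs' t ht'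
          have h2 := hyS s hs' t ht' hst
          linarith

/-! ### Gluing the layers along a tree of cuts -/

/-- The union of the blocks of `f` numbered `a, …, b - 1`. -/
def layers (f : Fin n → ℕ) (a b : ℕ) : Finset (Fin n) := univ.filter fun s => a ≤ f s ∧ f s < b

theorem mem_layers {f : Fin n → ℕ} {a b : ℕ} {s : Fin n} :
    s ∈ layers f a b ↔ a ≤ f s ∧ f s < b := by
  simp [layers]

theorem layers_union (f : Fin n → ℕ) {a c b : ℕ} (hac : a ≤ c) (hcb : c ≤ b) :
    layers f a c ∪ layers f c b = layers f a b := by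
  ext s
  simp only [mem_union, mem_layers]
  omega

theorem layers_subset_iff {f : Fin n → ℕ} {l : ℕ} (hf : IsLayering f l) {a b c d : ℕ}
    (hab : a < b) (hb : b ≤ l) : layers f a b ⊆ layers f c d ↔ c ≤ a ∧ b ≤ d := by
  constructor
  · intro h
    obtain ⟨s, hs⟩ := hf.2 a (by omega)
    obtain ⟨t, ht⟩ := hf.2 (b - 1) (by omega)
    have h1 := mem_layers.1 (h (mem_layers.2 (by omega : a ≤ f s ∧ f s < b)))
    have h2 := mem_layers.1 (h (mem_layers.2 (by omega : a ≤ f t ∧ f t < b)))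
    omega
  · intro h s hs
    rw [mem_layers] at hs ⊢
    omega

/-- Cut off at the right end the longest proper bracket that ends at `b`, or the last letter if
there is none. Noncrossing then forces every other bracket inside [a, b) to one side of the cut. -/
theorem exists_cut {l : ℕ} {T : Finset (ℕ × ℕ)} (hT : IsNoncrossing l T) {a b : ℕ}
    (hab : a + 2 ≤ b) : ∃ c, a < c ∧ c < b ∧ ((c, b) ∈ T ∨ c + 1 = b) ∧
      ∀ d ∈ T, a ≤ d.1 → d.2 ≤ b → d = (a, b) ∨ d.2 ≤ c ∨ c ≤ d.1 := by
  classical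
  have hex : ∃ c, a < c ∧ c < b ∧ ((c, b) ∈ T ∨ c + 1 = b) :=
    ⟨b - 1, by omega, by omega, Or.inr (by omega)⟩
  obtain ⟨h1, h2, h3⟩ := Nat.find_spec hex
  refine ⟨Nat.find hex, h1, h2, h3, fun d hd hd1 hd2 => ?_⟩
  have hmin := fun m => Nat.find_min hex (m := m)
  set c := Nat.find hex
  by_contra! hc
  obtain ⟨hc1, hc2, hc3⟩ := hc
  have hd2b : d.2 = b := by
    rcases h3 with h3 | h3
    · have := hT.noncrossing d hd (c, b) h3 hc3 hc2
      simp only at this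
      omega
    · omega
  have hd1a : d.1 ≠ a := fun h => hc1 (Prod.ext h hd2b)
  exact hmin d.1 hc3 ⟨by omega, by omega, Or.inl (hd2b ▸ hd)⟩

/-- Glue recursively at the cuts of `exists_cut`, so that all the brackets of `T` get gap zero.
Since the right piece is always a bracket of `T` or one layer, the unwanted intervals of gap zero
are prefixes: they start at the left end of the current interval, or of a bracket of `T` that
contains them. The hypothesis on `T` says that no bracket crosses an end of [a, b). -/
theorem exists_good_layers (he : Growth n e) {l : ℕ} {f : Fin n → ℕ} (hf : IsLayering f l)
    {T : Finset (ℕ × ℕ)} (hT : IsNoncrossing l T) (k : ℕ) : ∀ a b : ℕ, b - a ≤ k → a < b → b ≤ l →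
    (∀ d ∈ T, ¬ (d.1 < a ∧ a < d.2 ∧ d.2 < b) ∧ ¬ (a < d.1 ∧ d.1 < b ∧ b < d.2)) →
    ∃ x : Fin n → ℝ, Good e x (layers f a b) ∧
      (∀ s ∈ layers f a b, ∀ t ∈ layers f a b, f s < f t → x t < x s) ∧
      (∀ s ∈ layers f a b, ∀ t ∈ layers f a b, f s = f t → s < t → x t < x s) ∧
      (∀ d ∈ T, a ≤ d.1 → d.2 ≤ b → spread x (layers f d.1 d.2) = e #(layers f d.1 d.2)) ∧
      (∀ i, a ≤ i → i < b → spread x (layers f i (i + 1)) = e #(layers f i (i + 1))) ∧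
      ∀ a' b', a ≤ a' → a' + 2 ≤ b' → b' ≤ b → spread x (layers f a' b') = e #(layers f a' b') →
        (∃ b'' ≥ b', (a', b'') ∈ T) ∨ a' = a := by
  induction k with
  | zero =>
    intro a b h1 h2
    omega
  | succ k ih =>
    intro a b hk hab hb hcross
    rcases (by omega : b = a + 1 ∨ a + 2 ≤ b) with rfl | hab2
    · obtain ⟨s, hs⟩ := hf.2 a (by omega)
      obtain ⟨x, hx1, hx2⟩ := exists_good_antitone he (layers f a (a + 1))
        ⟨s, mem_layers.2 (by omega)⟩
      refine ⟨x, hx1, fun s hs t ht hst => ?_, fun s hs t ht _ => hx2 s hs t ht,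
        fun d hd h1 h2 => ?_, fun i h1 h2 => ?_, fun a' b' h1 h2 h3 => by omega⟩
      · rw [mem_layers] at hs ht
        omega
      · have := hT.add_two_le d hd
        omega
      · obtain rfl : i = a := by omega
        exact hx1.1
    · obtain ⟨c, hac, hcb, hcT, hcut⟩ := exists_cut hT hab2
      obtain ⟨y, y1, y2, y3, y4, y5, y6⟩ := ih a c (by omega) hac (by omega) fun d hd => by
        have h1 := hcross d hd
        refine ⟨by omega, fun h2 => ?_⟩
        rcases le_or_gt d.2 b with h3 | h3
        · rcases hcut d hd (by omega) h3 with h4 | h4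
          · rw [h4] at h2
            exact absurd h2.1 (lt_irrefl a)
          · omega
        · omega
      obtain ⟨z, z1, z2, z3, z4, z5, z6⟩ := ih c b (by omega) hcb hb fun d hd => by
        have h1 := hcross d hd
        refine ⟨fun h2 => ?_, by omega⟩
        rcases lt_or_ge d.1 a with h3 | h3
        · omega
        · rcases hcut d hd h3 (by omega) with h4 | h4
          · rw [h4] at h2
            exact absurd h2.2.2 (lt_irrefl b)
          · omega
      have hd : Disjoint (layers f a c) (layers f c b) := by
        rw [disjoint_left]
        intro s hs ht
        rw [mem_layers] at hs ht
        omega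
      have ne1 : (layers f a c).Nonempty := by
        obtain ⟨s, hs⟩ := hf.2 a (by omega)
        exact ⟨s, mem_layers.2 (by omega)⟩
      have ne2 : (layers f c b).Nonempty := by
        obtain ⟨s, hs⟩ := hf.2 c (by omega)
        exact ⟨s, mem_layers.2 (by omega)⟩
      obtain ⟨x, hx1, hx2, hx3, hx4, hx5⟩ := y1.union he z1 hd ne1 ne2
      rw [layers_union f hac.le hcb.le] at hx4 hx5
      have hcase : ∀ s ∈ layers f a b, s ∈ layers f a c ∨ s ∈ layers f c b := by
        intro s hs
        rwa [← mem_union, layers_union f hac.le hcb.le]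
      refine ⟨x, hx4, fun s hs t ht hst => ?_, fun s hs t ht hst hlt => ?_,
        fun d hd h1 h2 => ?_, fun i h1 h2 => ?_, fun a' b' h1 h2 h3 h4 => ?_⟩
      · rcases hcase s hs with hs | hs <;> rcases hcase t ht with ht | ht
        · have := hx1 s hs t ht
          have := y2 s hs t ht hst
          linarith
        · exact hx3 s hs t ht
        · rw [mem_layers] at hs ht
          omega
        · have := hx2 s hs t ht
          have := z2 s hs t ht hst
          linarith
      · rcases hcase s hs with hs | hs <;> rcases hcase t ht with ht | ht
        · have := hx1 s hs t ht
          have := y3 s hs t ht hst hlt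
          linarith
        · rw [mem_layers] at hs ht
          omega
        · rw [mem_layers] at hs ht
          omega
        · have := hx2 s hs t ht
          have := z3 s hs t ht hst hlt
          linarith
      · have hd12 := hT.add_two_le d hd
        rcases hcut d hd h1 h2 with rfl | h3 | h3
        · exact hx4.1
        · rw [spread_congr hx1 ((layers_subset_iff hf (by omega) (by omega)).2 ⟨h1, h3⟩)]
          exact y4 d hd h1 h3
        · rw [spread_congr hx2 ((layers_subset_iff hf (by omega) (by omega)).2 ⟨h3, h2⟩)]
          exact z4 d hd h3 h2
      · rcases lt_or_ge i c with h3 | h3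
        · rw [spread_congr hx1 ((layers_subset_iff hf (by omega) (by omega)).2 ⟨h1, h3⟩)]
          exact y5 i h1 h3
        · rw [spread_congr hx2 ((layers_subset_iff hf (by omega) (by omega)).2 ⟨h3, h2⟩)]
          exact z5 i h3 h2
      · have hsub := (layers_subset_iff hf (a := a') (b := b') (by omega) (by omega)).2 ⟨h1, h3⟩
        rcases hx5 _ hsub h4 with h5 | h5 | h5
        · have h6 := (layers_subset_iff hf (by omega) (by omega)).1 h5
          rw [spread_congr hx1 h5] at h4
          exact y6 a' b' h1 h2 h6.2 h4
        · have h6 := (layers_subset_iff hf (by omega) (by omega)).1 h5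
          rw [spread_congr hx2 h5] at h4
          rcases z6 a' b' h6.1 h2 h3 h4 with h7 | rfl
          · exact Or.inl h7
          · rcases hcT with hcT | hcT
            · exact Or.inl ⟨b, h3, hcT⟩
            · omega
        · have h6 := (layers_subset_iff hf (by omega) (by omega)).1 h5.ge
          exact Or.inr (by omega)

/-- A vertex of the polytope on the face labelled by `f` and `T`. -/
theorem exists_vertex (he : Growth n e) {l : ℕ} (hl : 1 ≤ l) {f : Fin n → ℕ}
    (hf : IsLayering f l) {T : Finset (ℕ × ℕ)} (hT : IsNoncrossing l T) (h0 : (0, l) ∈ T) :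
    ∃ x : Fin n → ℝ, Good e x univ ∧
      (∀ s t, f s < f t → x t < x s) ∧ (∀ s t, f s = f t → s < t → x t < x s) ∧
      (∀ d ∈ T, spread x (layers f d.1 d.2) = e #(layers f d.1 d.2)) ∧
      (∀ i, i < l → spread x (layers f i (i + 1)) = e #(layers f i (i + 1))) ∧
      ∀ a b, a + 2 ≤ b → b ≤ l → spread x (layers f a b) = e #(layers f a b) →
        ∃ b' ≥ b, (a, b') ∈ T := by
  have hu : layers f 0 l = univ := by
    ext s
    simp [mem_layers, hf.1 s]
  obtain ⟨x, x1, x2, x3, x4, x5, x6⟩ := exists_good_layers he hf hT l 0 l (by omega) hl le_rfl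
    fun d hd => by
      have := hT.le d hd
      omega
  rw [hu] at x1 x2 x3
  refine ⟨x, x1, fun s t => x2 s (mem_univ s) t (mem_univ t),
    fun s t => x3 s (mem_univ s) t (mem_univ t), fun d hd => x4 d hd (Nat.zero_le _) (hT.le d hd),
    fun i => x5 i (Nat.zero_le i), fun a b hab hb h => ?_⟩
  rcases x6 a b (Nat.zero_le a) hab hb h with h1 | rfl
  · exact h1
  · exact ⟨l, hb, h0⟩

end Realize

end Permutoassoc

namespace Permutoassoc

open Finset

/-! ### Points with a prescribed active set, and positivity of the bounds -/

section Average

variable {n : ℕ} {e : ℕ → ℝ}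

theorem Good.slack_ge {x : Fin n → ℝ} (hx : Good e x univ) {α : Type*} [LinearOrder α]
    (q : Fin n → α) : blockSum (gap e x) q univ ≤ bound e q - form q x := by
  have h1 := Permutoassoc.slack_ge e q x
  have h2 : gap e x univ = 0 := sub_eq_zero.2 hx.1
  linarith

theorem Good.gap_nonneg {x : Fin n → ℝ} (hx : Good e x univ) (B : Finset (Fin n)) :
    0 ≤ gap e x B := sub_nonneg.2 (hx.2 B (subset_univ B))

theorem Good.inPoly {x : Fin n → ℝ} (hx : Good e x univ) : InPoly e x := by
  intro q _
  have h1 := hx.slack_ge q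
  have h2 : 0 ≤ blockSum (gap e x) q univ := by
    rw [blockSum_eq_sum_image]
    exact sum_nonneg fun v _ => hx.gap_nonneg _
  linarith

/-- All the gaps are nonnegative and the gap of the whole set is zero, so the slack is a sum of
nonnegative contributions: the gaps of the blocks and the defect of sortedness. -/
theorem Good.active_iff {x : Fin n → ℝ} (hx : Good e x univ) {α : Type*} [LinearOrder α]
    (q : Fin n → α) :
    Active e x q ↔ Nonconst q ∧ Sorted x q ∧ ∀ s, gap e x (cls q s) = 0 := by
  have h0 : gap e x univ = 0 := sub_eq_zero.2 hx.1
  refine and_congr_right fun _ => ⟨fun h => ?_, fun ⟨h1, h2⟩ => ?_⟩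
  · have h1 := hx.slack_ge q
    have h2 : 0 ≤ blockSum (gap e x) q univ := by
      rw [blockSum_eq_sum_image]
      exact sum_nonneg fun v _ => hx.gap_nonneg _
    have h3 : blockSum (gap e x) q univ = 0 := by linarith
    refine ⟨sorted_of_slack_eq e (by rw [h3, h0, h, sub_self, sub_self]), fun s => ?_⟩
    rw [blockSum_eq_sum_image, sum_eq_zero_iff_of_nonneg fun v _ => hx.gap_nonneg _] at h3
    exact h3 (q s) (mem_image_of_mem q (mem_univ s))
  · have h3 := slack_of_sorted e h1
    have h4 : blockSum (gap e x) q univ = 0 := by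
      rw [blockSum_eq_sum_image]
      refine sum_eq_zero fun v hv => ?_
      obtain ⟨s, -, rfl⟩ := mem_image.1 hv
      exact h2 s
    rw [h4, h0] at h3
    linarith

theorem spread_neg (x : Fin n → ℝ) (B : Finset (Fin n)) : spread (-x) B = spread x B := by
  unfold spread cross
  congr 1
  refine sum_congr rfl fun s _ => sum_congr rfl fun t _ => ?_
  rw [Pi.neg_apply, Pi.neg_apply, ← abs_neg]
  congr 1
  ring

/-- The mirror image of `exists_vertex`. -/
theorem exists_vertex_mirror (he : Growth n e) {l : ℕ} (hl : 1 ≤ l) {f : Fin n → ℕ}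
    (hf : IsLayering f l) {T : Finset (ℕ × ℕ)} (hT : IsNoncrossing l T) (h0 : (0, l) ∈ T) :
    ∃ x : Fin n → ℝ, Good e x univ ∧
      (∀ s t, f s < f t → x t < x s) ∧ (∀ s t, f s = f t → s < t → x s < x t) ∧
      (∀ d ∈ T, spread x (layers f d.1 d.2) = e #(layers f d.1 d.2)) ∧
      (∀ i, i < l → spread x (layers f i (i + 1)) = e #(layers f i (i + 1))) ∧
      ∀ a b, a + 2 ≤ b → b ≤ l → spread x (layers f a b) = e #(layers f a b) →
        ∃ a' ≤ a, (a', b) ∈ T := by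
  classical
  let g : Fin n → ℕ := fun s => l - 1 - f s
  let R : Finset (ℕ × ℕ) := T.image fun d => (l - d.2, l - d.1)
  have hg : IsLayering g l := by
    refine ⟨fun s => ?_, fun i hi => ?_⟩
    · have := hf.1 s
      simp only [g]
      omega
    · obtain ⟨s, hs⟩ := hf.2 (l - 1 - i) (by omega)
      refine ⟨s, ?_⟩
      simp only [g]
      omega
  have hR : IsNoncrossing l R := by
    refine ⟨fun d hd => ?_, fun d hd => ?_, fun d hd d' hd' => ?_⟩
    · obtain ⟨c, hc, rfl⟩ := mem_image.1 hd
      have := hT.add_two_le c hc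
      have := hT.le c hc
      simp only
      omega
    · obtain ⟨c, hc, rfl⟩ := mem_image.1 hd
      simp only
      omega
    · obtain ⟨c, hc, rfl⟩ := mem_image.1 hd
      obtain ⟨c', hc', rfl⟩ := mem_image.1 hd'
      have h1 := hT.add_two_le c hc
      have h2 := hT.le c hc
      have h3 := hT.add_two_le c' hc'
      have h4 := hT.le c' hc'
      have h5 := hT.noncrossing c' hc' c hc
      simp only
      omega
  have hl2 := hT.add_two_le _ h0
  have hlay : ∀ a b, b ≤ l → layers f a b = layers g (l - b) (l - a) := by
    intro a b hb
    ext s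
    have := hf.1 s
    rw [mem_layers, mem_layers]
    simp only [g]
    omega
  obtain ⟨y, y1, y2, y3, y4, y5, y6⟩ := exists_vertex he hl hg hR
    (mem_image.2 ⟨(0, l), h0, by simp⟩)
  refine ⟨-y, ⟨?_, fun B hB => ?_⟩, fun s t hst => ?_, fun s t hst hlt => ?_, fun d hd => ?_,
    fun i hi => ?_, fun a b hab hb h => ?_⟩
  · rw [spread_neg, y1.1]
  · rw [spread_neg]
    exact y1.2 B hB
  · have h1 := hf.1 t
    have h2 := y2 t s (by simp only [g]; omega)
    simpa using h2
  · have h2 := y3 s t (by simp only [g]; omega) hlt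
    simpa using h2
  · rw [spread_neg, hlay _ _ (hT.le d hd)]
    exact y4 _ (mem_image_of_mem _ hd)
  · rw [spread_neg, hlay _ _ (by omega)]
    have := y5 (l - (i + 1)) (by omega)
    rwa [show l - (i + 1) + 1 = l - i by omega] at this
  · rw [spread_neg, hlay _ _ hb] at h
    obtain ⟨b', hb', hmem⟩ := y6 (l - b) (l - a) (by omega) (by omega) h
    obtain ⟨c, hc, hceq⟩ := mem_image.1 hmem
    rw [Prod.mk.injEq] at hceq
    have h1 := hT.add_two_le c hc
    have h2 := hT.le c hc
    refine ⟨c.1, by omega, ?_⟩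
    rwa [show (c.1, b) = c from Prod.ext rfl (by simp only; omega)]

theorem form_add (α : Type*) [LinearOrder α] (q : Fin n → α) (x y : Fin n → ℝ) :
    form q (x + y) = form q x + form q y := by
  unfold form
  rw [← mul_add, ← sum_add_distrib]
  congr 1
  refine sum_congr rfl fun s _ => ?_
  rw [← sum_add_distrib]
  refine sum_congr rfl fun t _ => ?_
  split_ifs
  · simp only [Pi.add_apply]
    ring
  · simp

theorem form_smul (α : Type*) [LinearOrder α] (q : Fin n → α) (c : ℝ) (x : Fin n → ℝ) :
    form q (c • x) = c * form q x := by
  unfold form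
  rw [mul_left_comm, mul_sum (a := c)]
  congr 1
  refine sum_congr rfl fun s _ => ?_
  rw [mul_sum]
  refine sum_congr rfl fun t _ => ?_
  split_ifs
  · simp only [Pi.smul_apply, smul_eq_mul]
    ring
  · simp

/-- A class of a compatible partition is a single layer or a bracket of `T`, and both have gap zero
at such a point. -/
theorem Compatible.active {l : ℕ} {f : Fin n → ℕ} (hf : IsLayering f l)
    {T : Finset (ℕ × ℕ)} {x : Fin n → ℝ} (x1 : Good e x univ)
    (x2 : ∀ s t, f s < f t → x t < x s)
    (x4 : ∀ d ∈ T, spread x (layers f d.1 d.2) = e #(layers f d.1 d.2))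
    (x5 : ∀ i, i < l → spread x (layers f i (i + 1)) = e #(layers f i (i + 1)))
    {q : Fin n → Fin n} (hq : Compatible f T q) : Active e x q := by
  obtain ⟨h1, h2, h3, h4⟩ := hq
  rw [x1.active_iff]
  refine ⟨h1, fun s t hst => ?_, fun s => ?_⟩
  · rcases lt_trichotomy (f s) (f t) with h | h | h
    · exact (x2 s t h).le
    · exact absurd (h2 s t h) hst.ne
    · exact absurd (h3 t s h) hst.not_ge
  · refine sub_eq_zero.2 ?_
    obtain ⟨a, b, hab⟩ := exists_interval_cls h2 h3 s
    have ha := (hab s).1 rfl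
    by_cases hlt : f a < f b
    · have hqa := (hab a).2 ⟨le_rfl, by omega⟩
      have hqb := (hab b).2 ⟨by omega, by omega⟩
      obtain ⟨d, hd, hdr⟩ := h4 a b hlt (hqa.trans hqb.symm)
      have : cls q s = layers f d.1 d.2 := by
        ext r
        rw [mem_cls, mem_layers, ← hdr, hqa]
      rw [this, x4 d hd]
    · have : cls q s = layers f (f s) (f s + 1) := by
        ext r
        rw [mem_cls, mem_layers, hab]
        omega
      rw [this, x5 _ (hf.1 s)]

/-- Every ordered partition with a bracketing of its blocks is the label of a face. -/
theorem exists_point_of_label (he : Growth n e) {l : ℕ} {f : Fin n → ℕ}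
    (hf : IsLayering f l) {T : Finset (ℕ × ℕ)} (hT : IsNoncrossing l T) (h0 : (0, l) ∈ T) :
    ∃ x : Fin n → ℝ, InPoly e x ∧ ∀ q : Fin n → Fin n, Active e x q ↔ Compatible f T q := by
  have hl2 := hT.add_two_le _ h0
  simp only at hl2
  obtain ⟨x, x1, x2, x3, x4, x5, x6⟩ := exists_vertex he (by omega) hf hT h0
  obtain ⟨y, y1, y2, y3, y4, y5, y6⟩ := exists_vertex_mirror he (by omega) hf hT h0
  have hform : ∀ q : Fin n → Fin n, form q ((1 / 2 : ℝ) • (x + y)) =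
      1 / 2 * (form q x + form q y) := by
    intro q
    rw [form_smul, form_add]
  -- At a midpoint an inequality is tight exactly when it is tight at both ends.
  have hact : ∀ q : Fin n → Fin n, Active e ((1 / 2 : ℝ) • (x + y)) q ↔
      Active e x q ∧ Active e y q := by
    intro q
    unfold Active
    rw [hform]
    constructor
    · rintro ⟨h1, h2⟩
      have h3 := x1.inPoly q h1
      have h4 := y1.inPoly q h1
      exact ⟨⟨h1, by linarith⟩, ⟨h1, by linarith⟩⟩
    · rintro ⟨⟨h1, h2⟩, ⟨-, h3⟩⟩
      exact ⟨h1, by linarith⟩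
  refine ⟨(1 / 2 : ℝ) • (x + y), fun q hq => ?_, fun q => ?_⟩
  · have h3 := x1.inPoly q hq
    have h4 := y1.inPoly q hq
    rw [hform]
    linarith
  rw [hact]
  refine ⟨fun ⟨hx, hy⟩ => ?_, fun hq => ⟨hq.active hf x1 x2 x4 x5, hq.active hf y1 y2 y4 y5⟩⟩
  obtain ⟨h1, sx, gx⟩ := (x1.active_iff q).1 hx
  obtain ⟨-, sy, gy⟩ := (y1.active_iff q).1 hy
  -- Inside a layer `x` decreases and `y` increases with the index, and both are sorted along `q`;
  -- so `q` cannot separate two elements of a layer.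
  have h2 : ∀ s t, f s = f t → q s = q t := by
    have key : ∀ s t, f s = f t → s < t → q s = q t := by
      intro s t hst hlt
      rcases lt_trichotomy (q s) (q t) with h | h | h
      · exact absurd (sy s t h) (y3 s t hst hlt).not_ge
      · exact h
      · exact absurd (sx t s h) (x3 s t hst hlt).not_ge
    intro s t hst
    rcases lt_trichotomy s t with h | h | h
    · exact key s t hst h
    · rw [h]
    · exact (key t s hst.symm h).symm
  have h3 : ∀ s t, f s < f t → q s ≤ q t := by
    intro s t hst
    by_contra! hc
    exact (sx t s hc).not_gt (x2 s t hst)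
  refine ⟨h1, h2, h3, fun s t hst hq => ?_⟩
  obtain ⟨a, b, hab⟩ := exists_interval_cls h2 h3 s
  have hs := (hab s).1 rfl
  have ht := (hab t).1 hq.symm
  have hcls : cls q s = layers f (f a) (f b + 1) := by
    ext r
    rw [mem_cls, mem_layers, hab]
  have hb := hf.1 b
  have gx' := sub_eq_zero.1 (gx s)
  have gy' := sub_eq_zero.1 (gy s)
  rw [hcls] at gx' gy'
  obtain ⟨b', hb', hbT⟩ := x6 _ _ (by omega) (by omega) gx'
  obtain ⟨a', ha', haT⟩ := y6 _ _ (by omega) (by omega) gy'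
  refine ⟨(f a, f b + 1), ?_, hab⟩
  -- At `x` the interval is a prefix of a bracket (a, b'), at `y` a suffix of a bracket (a', b). If
  -- both were longer than the interval, the two brackets would cross; hence the interval itself is
  -- in `T`.
  rcases ha'.eq_or_lt with rfl | ha'
  · exact haT
  · have := hT.noncrossing _ haT _ hbT ha' (by simp only; omega)
    rwa [show f b + 1 = b' from le_antisymm hb' this]

theorem bound_pos (he : Growth n e) {α : Type*} [LinearOrder α] {q : Fin n → α}
    (hq : Nonconst q) : 0 < bound e q := by
  obtain ⟨a, b, hab⟩ := hq
  have hn : 2 ≤ n := by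
    have : a ≠ b := fun h => hab (by rw [h])
    omega
  have hn0 : (0 : ℝ) < n := by exact_mod_cast (by omega : 0 < n)
  have hpos := he.pos hn le_rfl
  have h1 : ∀ s, e #(univ.filter fun t => q t = q s) / #(univ.filter fun t => q t = q s) ≤
      e n / (2 * n) := by
    intro s
    have hc : 1 ≤ #(univ.filter fun t => q t = q s) := card_pos.2 ⟨s, by simp⟩
    have hlt : #(univ.filter fun t => q t = q s) < n := by
      refine lt_of_lt_of_eq (card_lt_card (filter_ssubset.2 ?_)) (card_fin n)
      by_contra! hcon
      exact hab ((hcon a (mem_univ a)).trans (hcon b (mem_univ b)).symm)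
    have h2 := he.proportion_le hc hlt
    rw [div_le_div_iff₀ (by exact_mod_cast hc) (by positivity)]
    linarith
  have h2 : blockSum (fun B => e #B) q univ ≤ ∑ _s : Fin n, e n / (2 * n) :=
    sum_le_sum fun s _ => h1 s
  rw [sum_const, card_univ, Fintype.card_fin, nsmul_eq_mul] at h2
  have h3 : (n : ℝ) * (e n / (2 * n)) = e n / 2 := by field_simp
  unfold bound
  linarith

end Average

end Permutoassoc

namespace Permutoassoc

open Permutonest Topology

/-! ### Faces of a polyhedron and active sets -/

section Polyhedron

variable {V : Type*} [NormedAddCommGroup V] [InnerProductSpace ℝ V]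
variable {ι : Type*}

/-- The polyhedron defined by the inequalities `L i x ≤ c i`. -/
def polyhedron (L : ι → V →ₗ[ℝ] ℝ) (c : ι → ℝ) : Set V := {x | ∀ i, L i x ≤ c i}

/-- The set of inequalities that are equalities at `x`. -/
def activeSet (L : ι → V →ₗ[ℝ] ℝ) (c : ι → ℝ) (x : V) : Set ι := {i | L i x = c i}

/-- The points of the polyhedron at which all the inequalities in `A` are equalities. -/
def faceOf (L : ι → V →ₗ[ℝ] ℝ) (c : ι → ℝ) (A : Set ι) : Set V :=
  {y | y ∈ polyhedron L c ∧ A ⊆ activeSet L c y}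

variable {L : ι → V →ₗ[ℝ] ℝ} {c : ι → ℝ}

/-- The active inequalities do not change along `d`, and the others, finitely many and strict at
`x`, survive a small step. -/
theorem exists_pos_add_smul_mem [Finite ι] {x d : V} (hx : x ∈ polyhedron L c)
    (hd : ∀ i ∈ activeSet L c x, L i d = 0) : ∃ t : ℝ, 0 < t ∧ x + t • d ∈ polyhedron L c := by
  have h : ∀ᶠ t : ℝ in 𝓝 0, ∀ i, L i (x + t • d) ≤ c i := by
    rw [Filter.eventually_all]
    intro i
    by_cases hi : L i x = c i
    · refine Filter.Eventually.of_forall fun t => ?_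
      rw [map_add, map_smul, hd i hi, smul_zero, add_zero]
      exact hi.le
    · have hlt : L i x < c i := lt_of_le_of_ne (hx i) hi
      have hc : ContinuousAt (fun t : ℝ => L i (x + t • d)) 0 := by
        have : (fun t : ℝ => L i (x + t • d)) = fun t => L i x + t * L i d := by
          funext t
          rw [map_add, map_smul, smul_eq_mul]
        rw [this]
        fun_prop
      have h2 := Filter.Tendsto.eventually_lt_const (v := L i (x + (0 : ℝ) • d)) (u := c i)
        (by simpa using hlt) hc
      exact h2.mono fun t ht => ht.le
  obtain ⟨r, hr, hball⟩ := Metric.eventually_nhds_iff.1 h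
  refine ⟨r / 2, by positivity, fun i => hball ?_ i⟩
  rw [dist_zero_right, Real.norm_eq_abs, abs_of_pos (by positivity)]
  linarith

/-- The active set is recovered from the face: each of the two points lies in the face of the other.
-/
theorem injOn_faceOf : Set.InjOn (faceOf L c) {A | ∃ x ∈ polyhedron L c, activeSet L c x = A} := by
  rintro _ ⟨x, hx, rfl⟩ _ ⟨y, hy, rfl⟩ h
  have h1 : x ∈ faceOf L c (activeSet L c y) := h ▸ ⟨hx, Set.Subset.rfl⟩
  have h2 : y ∈ faceOf L c (activeSet L c x) := h ▸ ⟨hy, Set.Subset.rfl⟩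
  exact Set.Subset.antisymm h2.2 h1.2

/-- Choose in the face a point `x` with the fewest active inequalities. The midpoint of `x` and
another point of the face has as active set the intersection of the two, so by minimality the active
set of `x` is contained in every other. -/
theorem exists_eq_faceOf [Finite ι] {F : Set V} (hF : F.Nonempty)
    (hexp : IsExposed ℝ (polyhedron L c) F) :
    ∃ x ∈ polyhedron L c, F = faceOf L c (activeSet L c x) := by
  obtain ⟨l, hl⟩ := hexp hF
  obtain ⟨x, hxF, hmin⟩ : ∃ x ∈ F, ∀ y ∈ F, (activeSet L c x).ncard ≤ (activeSet L c y).ncard := by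
    obtain ⟨x, hx, hmin⟩ := WellFounded.has_min (InvImage.wf (fun x => (activeSet L c x).ncard)
      (wellFounded_lt (α := ℕ))) F hF
    exact ⟨x, hx, fun y hy => not_lt.1 (hmin y hy)⟩
  have hx := hxF
  rw [hl] at hx
  refine ⟨x, hx.1, Set.Subset.antisymm (fun y hyF => ?_) fun y hy => ?_⟩
  · have hy := hyF
    rw [hl] at hy
    refine ⟨hy.1, ?_⟩
    have hLz : ∀ i, L i ((1 / 2 : ℝ) • (x + y)) = 1 / 2 * (L i x + L i y) := by
      intro i
      rw [map_smul, map_add, smul_eq_mul]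
    have hz : (1 / 2 : ℝ) • (x + y) ∈ F := by
      rw [hl]
      refine ⟨fun i => ?_, fun w hw => ?_⟩
      · have := hx.1 i
        have := hy.1 i
        rw [hLz]
        linarith
      · have h1 := hx.2 w hw
        have h2 := hy.2 w hw
        rw [map_smul, map_add, smul_eq_mul]
        linarith
    have hsub : activeSet L c ((1 / 2 : ℝ) • (x + y)) ⊆ activeSet L c x ∩ activeSet L c y := by
      intro i hi
      have h1 := hx.1 i
      have h2 := hy.1 i
      have h3 : 1 / 2 * (L i x + L i y) = c i := (hLz i).symm.trans hi
      exact ⟨show L i x = c i by linarith, show L i y = c i by linarith⟩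
    have heq := Set.eq_of_subset_of_ncard_le (hsub.trans Set.inter_subset_left) (hmin _ hz)
    rw [← heq]
    exact hsub.trans Set.inter_subset_right
  · rw [hl]
    refine ⟨hy.1, fun w hw => (hx.2 w hw).trans ?_⟩
    -- Conversely, the segment from `y` to `x` can be prolonged a little beyond `x` inside the
    -- polyhedron. As `l` is maximal at `x`, its value at `y` cannot be smaller.
    obtain ⟨t, ht, hmem⟩ := exists_pos_add_smul_mem (d := x - y) hx.1 fun i hi => by
      rw [map_sub, show L i x = c i from hi, show L i y = c i from hy.2 hi, sub_self]
    have h1 := hx.2 _ hmem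
    rw [map_add, map_smul, map_sub, smul_eq_mul] at h1
    nlinarith

/-- The sum of the active forms is a functional that attains its maximum exactly on this face. -/
theorem isExposed_faceOf [FiniteDimensional ℝ V] [Finite ι] {x : V} (hx : x ∈ polyhedron L c) :
    IsExposed ℝ (polyhedron L c) (faceOf L c (activeSet L c x)) := by
  classical
  intro _
  have hfin : (activeSet L c x).Finite := Set.toFinite _
  refine ⟨LinearMap.toContinuousLinearMap (∑ i ∈ hfin.toFinset, L i), ?_⟩
  have hle : ∀ y ∈ polyhedron L c, (∑ i ∈ hfin.toFinset, L i) y ≤ ∑ i ∈ hfin.toFinset, c i := by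
    intro y hy
    rw [LinearMap.sum_apply]
    exact Finset.sum_le_sum fun i _ => hy i
  have hxe : (∑ i ∈ hfin.toFinset, L i) x = ∑ i ∈ hfin.toFinset, c i := by
    rw [LinearMap.sum_apply]
    exact Finset.sum_congr rfl fun i hi => (hfin.mem_toFinset.1 hi)
  ext y
  simp only [LinearMap.coe_toContinuousLinearMap']
  constructor
  · rintro ⟨h1, h2⟩
    refine ⟨h1, fun z hz => (hle z hz).trans ?_⟩
    rw [LinearMap.sum_apply]
    exact (Finset.sum_congr rfl fun i hi => (h2 (hfin.mem_toFinset.1 hi)).symm).le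
  · rintro ⟨h1, h2⟩
    refine ⟨h1, fun i hi => ?_⟩
    have h3 := h2 x hx
    rw [hxe, LinearMap.sum_apply] at h3
    have h4 : ∑ i ∈ hfin.toFinset, L i y = ∑ i ∈ hfin.toFinset, c i :=
      le_antisymm (Finset.sum_le_sum fun i _ => h1 i) h3
    exact (Finset.sum_eq_sum_iff_of_le fun i _ => h1 i).1 h4 i (hfin.mem_toFinset.2 hi)

theorem vectorSpan_faceOf [Finite ι] {x : V} (hx : x ∈ polyhedron L c) :
    vectorSpan ℝ (faceOf L c (activeSet L c x)) =
      (Submodule.span ℝ (L '' activeSet L c x)).dualCoannihilator := by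
  have hmem : ∀ d, d ∈ (Submodule.span ℝ (L '' activeSet L c x)).dualCoannihilator ↔
      ∀ i ∈ activeSet L c x, L i d = 0 := by
    intro d
    rw [Submodule.mem_dualCoannihilator]
    constructor
    · exact fun h i hi => h _ (Submodule.subset_span ⟨i, hi, rfl⟩)
    · intro h φ hφ
      induction hφ using Submodule.span_induction with
      | mem φ hφ =>
        obtain ⟨i, hi, rfl⟩ := hφ
        exact h i hi
      | zero => rfl
      | add φ ψ _ _ h1 h2 => rw [LinearMap.add_apply, h1, h2, add_zero]
      | smul a φ _ h1 => rw [LinearMap.smul_apply, h1, smul_zero]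
  refine le_antisymm ?_ fun d hd => ?_
  · rw [vectorSpan_def, Submodule.span_le]
    rintro _ ⟨y, hy, z, hz, rfl⟩
    rw [SetLike.mem_coe, hmem]
    intro i hi
    change L i (y - z) = 0
    rw [map_sub, show L i y = c i from hy.2 hi, show L i z = c i from hz.2 hi, sub_self]
  · rw [hmem] at hd
    obtain ⟨t, ht, h1⟩ := exists_pos_add_smul_mem hx hd
    have h2 : x + t • d ∈ faceOf L c (activeSet L c x) := by
      refine ⟨h1, fun i hi => ?_⟩
      change L i (x + t • d) = c i
      rw [map_add, map_smul, hd i hi, smul_zero, add_zero]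
      exact hi
    have h3 := vsub_mem_vectorSpan ℝ h2 (⟨hx, Set.Subset.rfl⟩ : x ∈ faceOf L c (activeSet L c x))
    rw [vsub_eq_sub, add_sub_cancel_left] at h3
    exact (Submodule.smul_mem_iff _ ht.ne').1 h3

variable [FiniteDimensional ℝ V]

theorem finrank_vectorSpan_faceOf [Finite ι] {x : V} (hx : x ∈ polyhedron L c) :
    Module.finrank ℝ (vectorSpan ℝ (faceOf L c (activeSet L c x))) +
      Module.finrank ℝ (Submodule.span ℝ (L '' activeSet L c x)) = Module.finrank ℝ V := by
  rw [vectorSpan_faceOf hx, add_comm]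
  exact Subspace.finrank_add_finrank_dualCoannihilator_eq _

/-- The origin has no active inequality, so its face is the whole polyhedron and the rank is zero.
-/
theorem finrank_vectorSpan_polyhedron [Finite ι] (hc : ∀ i, 0 < c i) :
    Module.finrank ℝ (vectorSpan ℝ (polyhedron L c)) = Module.finrank ℝ V := by
  have h0 : (0 : V) ∈ polyhedron L c := fun i => by
    rw [map_zero]
    exact (hc i).le
  have h1 : activeSet L c (0 : V) = ∅ := by
    ext i
    simp [activeSet, (hc i).ne]
  have h2 := finrank_vectorSpan_faceOf h0
  rw [h1] at h2
  have h3 : faceOf L c (∅ : Set ι) = polyhedron L c := by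
    ext y
    simp [faceOf]
  rw [h3, Set.image_empty, Submodule.span_empty, finrank_bot, add_zero] at h2
  exact h2

/-- The faces of codimension `k` of a polyhedron with the origin in its interior correspond to
the active sets of rank `k`. -/
theorem facesOfCodim_polyhedron [Finite ι] (hc : ∀ i, 0 < c i) (k : ℕ) :
    facesOfCodim (polyhedron L c) k = faceOf L c '' {A | (∃ x ∈ polyhedron L c,
      activeSet L c x = A) ∧ Module.finrank ℝ (Submodule.span ℝ (L '' A)) = k} := by
  ext F
  constructor
  · rintro ⟨h1, h2, h3⟩
    obtain ⟨x, hx, rfl⟩ := exists_eq_faceOf h1 h2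
    refine ⟨_, ⟨⟨x, hx, rfl⟩, ?_⟩, rfl⟩
    have := finrank_vectorSpan_faceOf hx
    have := finrank_vectorSpan_polyhedron (L := L) hc
    omega
  · rintro ⟨_, ⟨⟨x, hx, rfl⟩, h⟩, rfl⟩
    refine ⟨⟨x, hx, Set.Subset.rfl⟩, isExposed_faceOf hx, ?_⟩
    have := finrank_vectorSpan_faceOf hx
    have := finrank_vectorSpan_polyhedron (L := L) hc
    omega

end Polyhedron

end Permutoassoc

namespace Permutoassoc

open Finset

/-! ### The rank of the active set of a face -/

section Rank

variable {n : ℕ}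

/-- The form of the bracket `d` on the blocks of `f`. -/
noncomputable def bracketForm (f : Fin n → ℕ) (d : ℕ × ℕ) : (Fin n → ℝ) →ₗ[ℝ] ℝ where
  toFun x := 1 / 2 * ∑ s, ∑ t, if d.1 ≤ f s ∧ f s < f t ∧ f t < d.2 then x s - x t else 0
  map_add' x y := by
    rw [← mul_add, ← sum_add_distrib]
    congr 1
    refine sum_congr rfl fun s _ => ?_
    rw [← sum_add_distrib]
    refine sum_congr rfl fun t _ => ?_
    split_ifs
    · simp only [Pi.add_apply]
      ring
    · simp
  map_smul' c x := by
    rw [RingHom.id_apply, smul_eq_mul, mul_left_comm, mul_sum (a := c)]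
    congr 1
    refine sum_congr rfl fun s _ => ?_
    rw [mul_sum]
    refine sum_congr rfl fun t _ => ?_
    split_ifs
    · simp only [Pi.smul_apply, smul_eq_mul]
      ring
    · simp

theorem bracketForm_apply (f : Fin n → ℕ) (d : ℕ × ℕ) (x : Fin n → ℝ) : bracketForm f d x =
    1 / 2 * ∑ s, ∑ t, if d.1 ≤ f s ∧ f s < f t ∧ f t < d.2 then x s - x t else 0 := rfl

/-- `form` as a linear map. -/
noncomputable def formL {α : Type*} [LinearOrder α] (q : Fin n → α) : (Fin n → ℝ) →ₗ[ℝ] ℝ where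
  toFun := form q
  map_add' := form_add α q
  map_smul' := form_smul α q

theorem formL_apply {α : Type*} [LinearOrder α] (q : Fin n → α) (x : Fin n → ℝ) :
    formL q x = form q x := rfl

/-- The ordered partition obtained from `f` by collapsing the bracket `d`. -/
def collapse (f : Fin n → ℕ) (d : ℕ × ℕ) (s : Fin n) : ℕ :=
  if d.1 ≤ f s ∧ f s < d.2 then d.1 else f s

theorem collapse_lt {f : Fin n → ℕ} {d : ℕ × ℕ} {s t : Fin n} : collapse f d s < collapse f d t ↔
    f s < f t ∧ ¬ (d.1 ≤ f s ∧ f t < d.2) := by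
  unfold collapse
  split_ifs <;> omega

theorem collapse_eq {f : Fin n → ℕ} {d : ℕ × ℕ} {s t : Fin n} : collapse f d s = collapse f d t ↔
    f s = f t ∨ ((d.1 ≤ f s ∧ f s < d.2) ∧ d.1 ≤ f t ∧ f t < d.2) := by
  unfold collapse
  split_ifs <;> omega

theorem formL_layering {l : ℕ} {f : Fin n → ℕ} (hf : IsLayering f l) :
    formL f = bracketForm f (0, l) := by
  refine LinearMap.ext fun x => ?_
  rw [formL_apply, bracketForm_apply, form]
  simp only [zero_le, true_and, hf.1, and_true]

/-- Collapsing a bracket removes exactly the pairs in different layers inside it. -/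
theorem formL_collapse {l : ℕ} {f : Fin n → ℕ} (hf : IsLayering f l) (d : ℕ × ℕ) :
    formL (collapse f d) = bracketForm f (0, l) - bracketForm f d := by
  refine LinearMap.ext fun x => ?_
  rw [LinearMap.sub_apply, formL_apply, bracketForm_apply, bracketForm_apply, form, ← mul_sub,
    ← sum_sub_distrib]
  congr 1
  refine sum_congr rfl fun s _ => ?_
  rw [← sum_sub_distrib]
  refine sum_congr rfl fun t _ => ?_
  have := hf.1 t
  simp only [zero_le, true_and, this, and_true, collapse_lt]
  by_cases h1 : f s < f t <;> by_cases h2 : d.1 ≤ f s ∧ f t < d.2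
  · simp [h1, h2]
  · simp [h1, h2]
  · simp [h1]
  · simp [h1]

theorem compatible_layering {l : ℕ} (hl : 2 ≤ l) {f : Fin n → ℕ} (hf : IsLayering f l)
    (T : Finset (ℕ × ℕ)) : Compatible f T f := by
  obtain ⟨s, hs⟩ := hf.2 0 (by omega)
  obtain ⟨t, ht⟩ := hf.2 1 (by omega)
  exact ⟨⟨s, t, by omega⟩, fun _ _ => id, fun _ _ => le_of_lt, fun s t h1 h2 => absurd h2 h1.ne⟩

theorem compatible_collapse {l : ℕ} {f : Fin n → ℕ} (hf : IsLayering f l)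
    {T : Finset (ℕ × ℕ)} (hT : IsNoncrossing l T) {d : ℕ × ℕ} (hd : d ∈ T) (hd0 : d ≠ (0, l)) :
    Compatible f T (collapse f d) := by
  have h1 := hT.add_two_le d hd
  have h2 := hT.le d hd
  refine ⟨?_, fun s t h => collapse_eq.2 (Or.inl h), fun s t h => ?_, fun s t hlt heq => ?_⟩
  · obtain ⟨s, hs⟩ := hf.2 d.1 (by omega)
    rcases Nat.eq_zero_or_pos d.1 with h3 | h3
    · have h4 : d.2 ≠ l := fun h => hd0 (Prod.ext h3 h)
      obtain ⟨t, ht⟩ := hf.2 d.2 (by omega)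
      exact ⟨s, t, fun h => by rw [collapse_eq] at h; omega⟩
    · obtain ⟨t, ht⟩ := hf.2 0 (by omega)
      exact ⟨s, t, fun h => by rw [collapse_eq] at h; omega⟩
  · by_contra! hc
    rw [collapse_lt] at hc
    omega
  · refine ⟨d, hd, fun r => ?_⟩
    rw [collapse_eq] at heq ⊢
    omega

theorem Compatible.relabel {α β : Type*} [LinearOrder α] [LinearOrder β] {f : Fin n → ℕ}
    {T : Finset (ℕ × ℕ)} {q : Fin n → α} {r : Fin n → β} (hq : Compatible f T q)
    (h : ∀ s t, q s < q t ↔ r s < r t) : Compatible f T r := by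
  have heq := eq_iff_of_lt_iff h
  obtain ⟨⟨a, b, hab⟩, h2, h3, h4⟩ := hq
  refine ⟨⟨a, b, fun hc => hab ((heq a b).2 hc)⟩, fun s t hst => (heq s t).1 (h2 s t hst),
    fun s t hst => ?_, fun s t hst hrst => ?_⟩
  · exact not_lt.1 fun hc => (h3 s t hst).not_gt ((h t s).2 hc)
  · obtain ⟨d, hd, hdr⟩ := h4 s t hst ((heq s t).2 hrst)
    exact ⟨d, hd, fun r => (heq r s).symm.trans (hdr r)⟩

theorem formL_congr {α β : Type*} [LinearOrder α] [LinearOrder β] {q : Fin n → α}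
    {r : Fin n → β} (h : ∀ s t, q s < q t ↔ r s < r t) : formL q = formL r :=
  LinearMap.ext fun x => congrFun (form_congr h) x

/-- The form of a compatible ordered partition in terms of the forms of the brackets. -/
theorem Compatible.formL_eq {α : Type*} [LinearOrder α] {l : ℕ} {f : Fin n → ℕ}
    (hf : IsLayering f l) {T : Finset (ℕ × ℕ)} (hT : IsNoncrossing l T) {q : Fin n → α}
    (hq : Compatible f T q) : ∃ R ⊆ T, formL q = bracketForm f (0, l) - ∑ d ∈ R, bracketForm f d := by
  classical
  obtain ⟨-, h2, h3, h4⟩ := hq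
  refine ⟨T.filter fun d => ∃ s, ∀ r, q r = q s ↔ d.1 ≤ f r ∧ f r < d.2, filter_subset _ _, ?_⟩
  set R := T.filter fun d => ∃ s, ∀ r, q r = q s ↔ d.1 ≤ f r ∧ f r < d.2 with hR
  refine LinearMap.ext fun x => ?_
  rw [LinearMap.sub_apply, LinearMap.sum_apply, formL_apply]
  simp only [bracketForm_apply]
  rw [form, ← mul_sum, ← mul_sub, sum_comm (s := R), ← sum_sub_distrib]
  congr 1
  refine sum_congr rfl fun s _ => ?_
  rw [sum_comm (s := R), ← sum_sub_distrib]
  refine sum_congr rfl fun t _ => ?_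
  have hfs := hf.1 t
  simp only [zero_le, true_and, hfs, and_true]
  rcases lt_trichotomy (f s) (f t) with hlt | heq | hlt
  · rcases (h3 s t hlt).lt_or_eq with hq | hq
    · rw [if_pos hq, if_pos hlt, sum_eq_zero, sub_zero]
      intro d hd
      refine if_neg fun hc => ?_
      obtain ⟨-, a, ha⟩ := mem_filter.1 hd
      exact hq.ne (((ha s).2 (by omega)).trans ((ha t).2 (by omega)).symm)
    · rw [if_neg hq.not_lt, if_pos hlt]
      obtain ⟨d, hd, hdr⟩ := h4 s t hlt hq
      have hs := (hdr s).1 rfl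
      have ht := (hdr t).1 hq.symm
      have hdR : d ∈ R := mem_filter.2 ⟨hd, s, hdr⟩
      rw [sum_eq_single_of_mem d hdR, if_pos (by omega), sub_self]
      intro d' hd' hne
      refine if_neg fun hc => hne ?_
      obtain ⟨hd'T, a, ha⟩ := mem_filter.1 hd'
      have hsa := (ha s).2 (by omega)
      have hsame : layers f d.1 d.2 = layers f d'.1 d'.2 := by
        ext r
        rw [mem_layers, mem_layers, ← hdr, ← ha, hsa]
      have k1 := hT.add_two_le d hd
      have k2 := hT.le d hd
      have k3 := hT.add_two_le d' hd'T
      have k4 := hT.le d' hd'T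
      have m1 := (layers_subset_iff hf (by omega) k2).1 hsame.le
      have m2 := (layers_subset_iff hf (by omega) k4).1 hsame.ge
      exact Prod.ext (by omega) (by omega)
  · rw [if_neg (h2 s t heq).not_lt, if_neg heq.not_lt, sum_eq_zero, sub_zero]
    exact fun d _ => if_neg fun hc => by omega
  · rw [if_neg (h3 t s hlt).not_gt, if_neg hlt.not_gt, sum_eq_zero, sub_zero]
    exact fun d _ => if_neg fun hc => by omega

/-! ### The rank of the active forms on a space that maps onto the sum-zero vectors -/

section Restrict

variable {H : Type*} [AddCommGroup H] [Module ℝ H] (j : H →ₗ[ℝ] (Fin n → ℝ))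

/-- A compatible form is the form of the full bracket minus forms of collapsed brackets. Conversely
the full bracket gives `f` itself, and every other bracket is the difference between `f` and its
collapse. -/
theorem span_compatible {l : ℕ} {f : Fin n → ℕ} (hf : IsLayering f l)
    {T : Finset (ℕ × ℕ)} (hT : IsNoncrossing l T) (h0 : (0, l) ∈ T) :
    Submodule.span ℝ ((fun q : Fin n → Fin n => formL q ∘ₗ j) '' {q | Compatible f T q}) =
      Submodule.span ℝ (Set.range fun d : T => bracketForm f d ∘ₗ j) := by
  have hl := hT.add_two_le _ h0
  simp only at hl
  apply le_antisymm
  · rw [Submodule.span_le]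
    rintro _ ⟨q, hq, rfl⟩
    obtain ⟨R, hR, hqR⟩ := Compatible.formL_eq hf hT hq
    simp only [SetLike.mem_coe]
    have hsum : (∑ d ∈ R, bracketForm f d) ∘ₗ j = ∑ d ∈ R, bracketForm f d ∘ₗ j := by
      ext h
      simp
    rw [hqR, LinearMap.sub_comp, hsum]
    exact sub_mem (Submodule.subset_span ⟨⟨_, h0⟩, rfl⟩)
      (sum_mem fun d hd => Submodule.subset_span ⟨⟨d, hR hd⟩, rfl⟩)
  · rw [Submodule.span_le]
    have hroot : bracketForm f (0, l) ∘ₗ j ∈ Submodule.span ℝ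
        ((fun q : Fin n → Fin n => formL q ∘ₗ j) '' {q | Compatible f T q}) := by
      obtain ⟨r, hr⟩ := exists_fin_relabel f
      rw [← formL_layering hf, formL_congr hr]
      exact Submodule.subset_span ⟨r, (compatible_layering (by omega) hf T).relabel hr, rfl⟩
    rintro _ ⟨⟨d, hd⟩, rfl⟩
    by_cases hd0 : d = (0, l)
    · subst hd0
      exact hroot
    · obtain ⟨r, hr⟩ := exists_fin_relabel (collapse f d)
      have h1 : formL r ∘ₗ j ∈ Submodule.span ℝ
          ((fun q : Fin n → Fin n => formL q ∘ₗ j) '' {q | Compatible f T q}) :=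
        Submodule.subset_span ⟨r, (compatible_collapse hf hT hd hd0).relabel hr, rfl⟩
      rw [← formL_congr hr, formL_collapse hf, LinearMap.sub_comp] at h1
      have h2 := sub_mem hroot h1
      rwa [sub_sub_cancel] at h2

/-- Split the bracket `d` at a cut and let `y` be constant on each of the two pieces and zero
outside, with the values weighted to sum to zero. A bracket strictly inside lies in one piece, a
disjoint one sees only zeros, so besides `d` only brackets containing `d` can detect `y`. -/
theorem exists_test_vector {l : ℕ} {f : Fin n → ℕ} (hf : IsLayering f l)
    {T : Finset (ℕ × ℕ)} (hT : IsNoncrossing l T) {d : ℕ × ℕ} (hd : d ∈ T) :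
    ∃ y : Fin n → ℝ, ∑ s, y s = 0 ∧ 0 < bracketForm f d y ∧
      ∀ d' ∈ T, d' ≠ d → ¬ (d'.1 ≤ d.1 ∧ d.2 ≤ d'.2) → bracketForm f d' y = 0 := by
  have h1 := hT.add_two_le d hd
  have h2 := hT.le d hd
  obtain ⟨c, hc1, hc2, -, hcut⟩ := exists_cut hT h1
  set A := layers f d.1 c with hA
  set B := layers f c d.2 with hB
  have hApos : (0 : ℝ) < #A := by
    obtain ⟨s, hs⟩ := hf.2 d.1 (by omega)
    exact_mod_cast card_pos.2 ⟨s, mem_layers.2 (by omega)⟩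
  have hBpos : (0 : ℝ) < #B := by
    obtain ⟨s, hs⟩ := hf.2 c (by omega)
    exact_mod_cast card_pos.2 ⟨s, mem_layers.2 (by omega)⟩
  let y : Fin n → ℝ := fun s => (if s ∈ A then (#B : ℝ) else 0) - if s ∈ B then (#A : ℝ) else 0
  have yA : ∀ s, d.1 ≤ f s → f s < c → y s = #B := by
    intro s h3 h4
    have h5 : s ∈ A := mem_layers.2 ⟨h3, h4⟩
    have h6 : s ∉ B := fun h => by
      have := mem_layers.1 h
      omega
    simp [y, h5, h6]
  have yB : ∀ s, c ≤ f s → f s < d.2 → y s = -#A := by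
    intro s h3 h4
    have h5 : s ∈ B := mem_layers.2 ⟨h3, h4⟩
    have h6 : s ∉ A := fun h => by
      have := mem_layers.1 h
      omega
    simp [y, h5, h6]
  have y0 : ∀ s, f s < d.1 ∨ d.2 ≤ f s → y s = 0 := by
    intro s h3
    have h5 : s ∉ A := fun h => by
      have := mem_layers.1 h
      omega
    have h6 : s ∉ B := fun h => by
      have := mem_layers.1 h
      omega
    simp [y, h5, h6]
  refine ⟨y, ?_, ?_, fun d' hd' hne hnot => ?_⟩
  · simp only [y, sum_sub_distrib, ← sum_filter, filter_mem_eq_inter, univ_inter, sum_const,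
      nsmul_eq_mul]
    ring
  · rw [bracketForm_apply]
    refine mul_pos (by norm_num) ?_
    have hterm : ∀ s t, 0 ≤ if d.1 ≤ f s ∧ f s < f t ∧ f t < d.2 then y s - y t else 0 := by
      intro s t
      split_ifs with h
      · rcases lt_or_ge (f s) c with hs | hs <;> rcases lt_or_ge (f t) c with ht | ht
        · rw [yA s h.1 hs, yA t (by omega) ht, sub_self]
        · rw [yA s h.1 hs, yB t ht h.2.2]
          linarith
        · omega
        · rw [yB s hs (by omega), yB t ht h.2.2, sub_self]
      · exact le_rfl
    obtain ⟨s, hs⟩ := hf.2 d.1 (by omega)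
    obtain ⟨t, ht⟩ := hf.2 c (by omega)
    refine sum_pos' (fun s _ => sum_nonneg fun t _ => hterm s t) ⟨s, mem_univ s,
      sum_pos' (fun t _ => hterm s t) ⟨t, mem_univ t, ?_⟩⟩
    rw [if_pos (by omega), yA s (by omega) (by omega), yB t (by omega) (by omega)]
    linarith
  · rw [bracketForm_apply, sum_eq_zero, mul_zero]
    intro s _
    refine sum_eq_zero fun t _ => ?_
    split_ifs with h
    · have h3 := hT.add_two_le d' hd'
      rcases lt_or_ge d'.1 d.1 with h4 | h4
      · rcases le_or_gt d'.2 d.1 with h5 | h5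
        · rw [y0 s (by omega), y0 t (by omega), sub_self]
        · exact absurd ⟨h4.le, hT.noncrossing d' hd' d hd h4 h5⟩ hnot
      · rcases le_or_gt d.2 d'.1 with h5 | h5
        · rw [y0 s (by omega), y0 t (by omega), sub_self]
        · have h6 : d'.2 ≤ d.2 := by
            rcases h4.eq_or_lt with h6 | h6
            · by_contra! h7
              exact hnot ⟨h6.ge, h7.le⟩
            · exact hT.noncrossing d hd d' hd' h6 h5
          rcases hcut d' hd' h4 h6 with h7 | h7 | h7
          · exact absurd h7 hne
          · rw [yA s (by omega) (by omega), yA t (by omega) (by omega), sub_self]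
          · rw [yB s (by omega) (by omega), yB t (by omega) (by omega), sub_self]
    · rfl

/-- Triangularity: the coefficients vanish from the outermost brackets inwards, by pairing a
relation with the test vector of each bracket. The induction parameter `d.1 + (l - d.2)` counts the
letters outside the bracket, so it drops for strictly larger brackets. -/
theorem linearIndependent_bracketForm (hj : ∀ y : Fin n → ℝ, ∑ s, y s = 0 → ∃ h, j h = y)
    {l : ℕ} {f : Fin n → ℕ} (hf : IsLayering f l)
    {T : Finset (ℕ × ℕ)} (hT : IsNoncrossing l T) :
    LinearIndependent ℝ fun d : T => bracketForm f d ∘ₗ j := by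
  rw [Fintype.linearIndependent_iff]
  intro g hg
  have key : ∀ k : ℕ, ∀ d : T, d.1.1 + (l - d.1.2) = k → g d = 0 := by
    intro k
    induction k using Nat.strong_induction_on with
    | _ k ih =>
      intro d hk
      obtain ⟨y, hy0, hy1, hy2⟩ := exists_test_vector hf hT d.2
      obtain ⟨h, rfl⟩ := hj y hy0
      have h1 := congrArg (fun φ : H →ₗ[ℝ] ℝ => φ h) hg
      simp only [LinearMap.sum_apply, LinearMap.smul_apply, LinearMap.comp_apply,
        LinearMap.zero_apply, smul_eq_mul] at h1
      rw [sum_eq_single d] at h1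
      · exact (mul_eq_zero.1 h1).resolve_right hy1.ne'
      · intro d' _ hne
        by_cases hsup : d'.1.1 ≤ d.1.1 ∧ d.1.2 ≤ d'.1.2
        · have hne' : ¬ (d'.1.1 = d.1.1 ∧ d'.1.2 = d.1.2) := fun h =>
            hne (Subtype.ext (Prod.ext h.1 h.2))
          have h3 := hT.le _ d'.2
          rw [ih _ (by omega) d' rfl, zero_mul]
        · rw [hy2 d' d'.2 (fun h => hne (Subtype.ext h)) hsup, mul_zero]
      · exact fun h => absurd (mem_univ d) h
  exact fun d => key _ d rfl

theorem finrank_span_compatible (hj : ∀ y : Fin n → ℝ, ∑ s, y s = 0 → ∃ h, j h = y)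
    {l : ℕ} {f : Fin n → ℕ} (hf : IsLayering f l)
    {T : Finset (ℕ × ℕ)} (hT : IsNoncrossing l T) (h0 : (0, l) ∈ T) :
    Module.finrank ℝ (Submodule.span ℝ
      ((fun q : Fin n → Fin n => formL q ∘ₗ j) '' {q | Compatible f T q})) = #T := by
  rw [span_compatible j hf hT h0,
    finrank_span_eq_card (linearIndependent_bracketForm j hj hf hT), Fintype.card_coe]

end Restrict

end Rank

end Permutoassoc

namespace Permutoassoc

open Finset Permutonest

/-! ### The faces are in bijection with their labels -/

section Bijection

variable {n : ℕ}

theorem IsLayering.le_of_lt_iff {f g : Fin n → ℕ} {l : ℕ} (hf : IsLayering f l)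
    (h : ∀ s t, f s < f t → g s < g t) (k : ℕ) : ∀ s, f s = k → f s ≤ g s := by
  induction k with
  | zero => exact fun s hs => hs ▸ Nat.zero_le _
  | succ k ih =>
    intro s hs
    have := hf.1 s
    obtain ⟨t, ht⟩ := hf.2 k (by omega)
    have h1 := h t s (by omega)
    have h2 := ih t ht
    omega

theorem IsLayering.le {f : Fin n → ℕ} {l : ℕ} (hf : IsLayering f l) : l ≤ n := by
  have h1 : (range l) ⊆ univ.image f := fun i hi => by
    obtain ⟨s, hs⟩ := hf.2 i (mem_range.1 hi)
    exact mem_image.2 ⟨s, mem_univ s, hs⟩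
  have h2 := (card_le_card h1).trans card_image_le
  simpa using h2

/-- The collapse of a single bracket is compatible, and its only class of more than one layer is
that bracket; so the bracket can be read off from the compatible partitions. -/
theorem label_subset {l : ℕ} {f : Fin n → ℕ} (hf : IsLayering f l) {T T' : Finset (ℕ × ℕ)}
    (hT : IsNoncrossing l T) (hT' : IsNoncrossing l T') (h0 : (0, l) ∈ T')
    (h : ∀ q : Fin n → Fin n, Compatible f T q → Compatible f T' q) : T ⊆ T' := by
  intro d hd
  by_cases hd0 : d = (0, l)
  · rwa [hd0]
  have h1 := hT.add_two_le d hd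
  have h2 := hT.le d hd
  obtain ⟨r, hr⟩ := exists_fin_relabel (collapse f d)
  have hc := (h r ((compatible_collapse hf hT hd hd0).relabel hr)).relabel fun s t => (hr s t).symm
  obtain ⟨s, hs⟩ := hf.2 d.1 (by omega)
  obtain ⟨t, ht⟩ := hf.2 (d.1 + 1) (by omega)
  obtain ⟨d', hd', hdr⟩ := hc.2.2.2 s t (by omega) (collapse_eq.2 (by omega))
  have h3 := hT'.add_two_le d' hd'
  have h4 := hT'.le d' hd'
  have hsame : layers f d.1 d.2 = layers f d'.1 d'.2 := by
    ext r
    rw [mem_layers, mem_layers, ← hdr, collapse_eq]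
    omega
  have m1 := (layers_subset_iff hf (by omega) h2).1 hsame.le
  have m2 := (layers_subset_iff hf (by omega) h4).1 hsame.ge
  rwa [show d = d' from Prod.ext (by omega) (by omega)]

/-- Each layering is compatible with the other label, so both refine each other and define the same
ordered partition; numbering the layers consecutively from zero then leaves no freedom. -/
theorem label_injective {l l' : ℕ} {f f' : Fin n → ℕ} (hf : IsLayering f l)
    (hf' : IsLayering f' l') {T T' : Finset (ℕ × ℕ)} (hT : IsNoncrossing l T)
    (hT' : IsNoncrossing l' T') (h0 : (0, l) ∈ T) (h0' : (0, l') ∈ T')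
    (h : ∀ q : Fin n → Fin n, Compatible f T q ↔ Compatible f' T' q) :
    l = l' ∧ f = f' ∧ T = T' := by
  have hl := hT.add_two_le _ h0
  have hl' := hT'.add_two_le _ h0'
  simp only at hl hl'
  have key : Compatible f' T' f := by
    obtain ⟨r, hr⟩ := exists_fin_relabel f
    exact ((h r).1 ((compatible_layering (by omega) hf T).relabel hr)).relabel
      fun s t => (hr s t).symm
  have key' : Compatible f T f' := by
    obtain ⟨r, hr⟩ := exists_fin_relabel f'
    exact ((h r).2 ((compatible_layering (by omega) hf' T').relabel hr)).relabel
      fun s t => (hr s t).symm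
  have hlt : ∀ s t, f s < f t → f' s < f' t := by
    intro s t hst
    rcases lt_trichotomy (f' s) (f' t) with h1 | h1 | h1
    · exact h1
    · exact absurd (key.2.1 s t h1) hst.ne
    · exact absurd (key.2.2.1 t s h1) hst.not_ge
  have hlt' : ∀ s t, f' s < f' t → f s < f t := by
    intro s t hst
    rcases lt_trichotomy (f s) (f t) with h1 | h1 | h1
    · exact h1
    · exact absurd (key'.2.1 s t h1) hst.ne
    · exact absurd (key'.2.2.1 t s h1) hst.not_ge
  obtain rfl : f = f' := funext fun s =>
    le_antisymm (hf.le_of_lt_iff hlt _ s rfl) (hf'.le_of_lt_iff hlt' _ s rfl)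
  obtain rfl : l = l' := by
    obtain ⟨s, hs⟩ := hf.2 (l - 1) (by omega)
    obtain ⟨t, ht⟩ := hf'.2 (l' - 1) (by omega)
    have := hf.1 t
    have := hf'.1 s
    omega
  exact ⟨rfl, rfl, (label_subset hf hT hT' h0' fun q => (h q).1).antisymm
    (label_subset hf hT' hT h0 fun q => (h q).2)⟩

/-! ### Finite sets of labels and the number of faces -/

open Classical in
/-- The ordered partitions of `Fin n` into `l` blocks. -/
noncomputable def layerings (n l : ℕ) : Finset (Fin n → ℕ) :=
  (Fintype.piFinset fun _ => range l).filter fun f => IsLayering f l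

open Classical in
theorem mem_layerings {l : ℕ} {f : Fin n → ℕ} : f ∈ layerings n l ↔ IsLayering f l := by
  rw [layerings, mem_filter, Fintype.mem_piFinset]
  exact and_iff_right_of_imp fun h s => mem_range.2 (h.1 s)

open Classical in
/-- The families of `j` pairwise noncrossing brackets on a word of length `l`. -/
noncomputable def families (l j : ℕ) : Finset (Finset (ℕ × ℕ)) :=
  ((range (l + 1) ×ˢ range (l + 1)).powersetCard j).filter (IsNoncrossing l)

open Classical in
theorem mem_families {l j : ℕ} {T : Finset (ℕ × ℕ)} :
    T ∈ families l j ↔ IsNoncrossing l T ∧ #T = j := by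
  rw [families, mem_filter, mem_powersetCard]
  constructor
  · exact fun h => ⟨h.2, h.1.2⟩
  · refine fun h => ⟨⟨fun d hd => ?_, h.2⟩, h.1⟩
    have h1 := h.1.add_two_le d hd
    have h2 := h.1.le d hd
    rw [mem_product, mem_range, mem_range]
    omega

/-- The families of `j` pairwise noncrossing brackets that contain the whole word. -/
noncomputable def bracketings (l j : ℕ) : Finset (Finset (ℕ × ℕ)) :=
  (families l j).filter fun T => (0, l) ∈ T

theorem mem_bracketings {l j : ℕ} {T : Finset (ℕ × ℕ)} :
    T ∈ bracketings l j ↔ IsNoncrossing l T ∧ #T = j ∧ (0, l) ∈ T := by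
  rw [bracketings, mem_filter, mem_families, and_assoc]

theorem form_sub_const {α : Type*} [LinearOrder α] (q : Fin n → α) (x : Fin n → ℝ) (c : ℝ) :
    form q (fun s => x s - c) = form q x := by
  unfold form
  simp only [sub_sub_sub_cancel_right]

variable {V : Type*} [NormedAddCommGroup V] [InnerProductSpace ℝ V]

/-- The restricted forms, indexed by the ordered partitions with at least two blocks. -/
noncomputable def formOn (j : V →ₗ[ℝ] (Fin n → ℝ)) (q : {q : Fin n → Fin n // Nonconst q}) :
    V →ₗ[ℝ] ℝ := formL q.1 ∘ₗ j

theorem finrank_span_formOn (j : V →ₗ[ℝ] (Fin n → ℝ))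
    (hj : ∀ y : Fin n → ℝ, ∑ s, y s = 0 → ∃ h, j h = y)
    {l : ℕ} {f : Fin n → ℕ} (hf : IsLayering f l)
    {T : Finset (ℕ × ℕ)} (hT : IsNoncrossing l T) (h0 : (0, l) ∈ T) :
    Module.finrank ℝ (Submodule.span ℝ (formOn j '' {q | Compatible f T q.1})) = #T := by
  rw [← finrank_span_compatible j hj hf hT h0]
  have : formOn j '' {q | Compatible f T q.1} =
      (fun q : Fin n → Fin n => formL q ∘ₗ j) '' {q | Compatible f T q} := by
    ext φ
    constructor
    · rintro ⟨q, hq, rfl⟩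
      exact ⟨q.1, hq, rfl⟩
    · rintro ⟨q, hq, rfl⟩
      exact ⟨⟨q, hq.1⟩, hq, rfl⟩
  rw [this]

open Classical in
/-- The number of faces in terms of ordered partitions and bracketings. -/
theorem ncard_facesOfCodim [FiniteDimensional ℝ V] {e : ℕ → ℝ} (he : Growth n e)
    (j : V →ₗ[ℝ] (Fin n → ℝ)) (hj : ∀ y : Fin n → ℝ, ∑ s, y s = 0 → ∃ h, j h = y) (k : ℕ) :
    (facesOfCodim (polyhedron (formOn j) fun q => bound e q.1) (k + 1)).Finite ∧
    (facesOfCodim (polyhedron (formOn j) fun q => bound e q.1) (k + 1)).ncard =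
      ∑ l ∈ range (n + 1), #(layerings n l) * #(bracketings l (k + 1)) := by
  set P := polyhedron (formOn j) fun q => bound e q.1 with hP
  let 𝒜 : Set (Set {q : Fin n → Fin n // Nonconst q}) :=
    {A | (∃ x ∈ P, activeSet (formOn j) (fun q => bound e q.1) x = A) ∧
      Module.finrank ℝ (Submodule.span ℝ (formOn j '' A)) = k + 1}
  let Λ : Finset (Σ _ : ℕ, (Fin n → ℕ) × Finset (ℕ × ℕ)) :=
    (range (n + 1)).sigma fun l => layerings n l ×ˢ bracketings l (k + 1)
  let Φ : (Σ _ : ℕ, (Fin n → ℕ) × Finset (ℕ × ℕ)) → Set {q : Fin n → Fin n // Nonconst q} :=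
    fun a => {q | Compatible a.2.1 a.2.2 q.1}
  have hmemΛ : ∀ a, a ∈ Λ ↔ IsLayering a.2.1 a.1 ∧ IsNoncrossing a.1 a.2.2 ∧ #a.2.2 = k + 1 ∧
      (0, a.1) ∈ a.2.2 := by
    intro a
    rw [mem_sigma, mem_product, mem_layerings, mem_bracketings, mem_range]
    exact and_iff_right_of_imp fun h => Nat.lt_succ_of_le h.1.le
  have hactive : ∀ x ∈ P, ∀ q : {q : Fin n → Fin n // Nonconst q},
      q ∈ activeSet (formOn j) (fun q => bound e q.1) x ↔ Active e (j x) q.1 :=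
    fun x _ q => ⟨fun h => ⟨q.2, h⟩, fun h => h.2⟩
  have hin : ∀ x, x ∈ P ↔ InPoly e (j x) :=
    fun x => ⟨fun h q hq => h ⟨q, hq⟩, fun h q => h q.1 q.2⟩
  have himg : Φ '' Λ = 𝒜 := by
    ext A
    constructor
    · rintro ⟨a, ha, rfl⟩
      obtain ⟨h1, h2, h3, h4⟩ := (hmemΛ a).1 ha
      refine ⟨?_, (finrank_span_formOn j hj h1 h2 h4).trans h3⟩
      obtain ⟨x, hx, hxa⟩ := exists_point_of_label he h1 h2 h4
      have hn : (n : ℝ) ≠ 0 := by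
        have := h1.le
        have := h2.add_two_le _ h4
        simp only at this
        exact_mod_cast (by omega : n ≠ 0)
      -- The point realizing the label need not have sum zero; subtracting its mean changes no form.
      obtain ⟨y, hy⟩ := hj (fun s => x s - (∑ t, x t) / n) (by
        rw [sum_sub_distrib, sum_const, card_univ, Fintype.card_fin, nsmul_eq_mul]
        field_simp
        ring)
      have hform : ∀ q : Fin n → Fin n, form q (j y) = form q x := fun q => by
        rw [hy, form_sub_const]
      have hyP : y ∈ P := (hin y).2 fun q hq => (hform q).trans_le (hx q hq)
      refine ⟨y, hyP, ?_⟩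
      ext q
      rw [hactive y hyP]
      refine Iff.trans ?_ (hxa q.1)
      unfold Active
      rw [hform]
    · rintro ⟨⟨x, hx, rfl⟩, hrank⟩
      -- The rank `k + 1` is positive, so some inequality is active and the point lies on the
      -- boundary, as `exists_label` requires.
      have hne : ∃ q : Fin n → Fin n, Active e (j x) q := by
        by_contra! hcon
        have : activeSet (formOn j) (fun q => bound e q.1) x = ∅ := by
          ext q
          rw [hactive x hx]
          simp [hcon]
        rw [this, Set.image_empty, Submodule.span_empty, finrank_bot] at hrank
        omega
      obtain ⟨l, f, T, -, hf, hT, h0, hfT⟩ := exists_label he ((hin x).1 hx) hne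
      have hA : activeSet (formOn j) (fun q => bound e q.1) x = {q | Compatible f T q.1} := by
        ext q
        rw [hactive x hx, hfT]
        rfl
      rw [hA] at hrank ⊢
      rw [finrank_span_formOn j hj hf hT h0] at hrank
      exact ⟨⟨l, f, T⟩, (hmemΛ _).2 ⟨hf, hT, hrank, h0⟩, rfl⟩
  have hinj : Set.InjOn Φ Λ := by
    rintro ⟨l, f, T⟩ ha ⟨l', f', T'⟩ ha' heq
    obtain ⟨h1, h2, h3, h4⟩ := (hmemΛ _).1 ha
    obtain ⟨h1', h2', h3', h4'⟩ := (hmemΛ _).1 ha'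
    obtain ⟨rfl, rfl, rfl⟩ := label_injective h1 h1' h2 h2' h4 h4' fun q => by
      constructor
      · exact fun hq => (Set.ext_iff.1 heq ⟨q, hq.1⟩).1 hq
      · exact fun hq => (Set.ext_iff.1 heq ⟨q, hq.1⟩).2 hq
    rfl
  have hfaces : facesOfCodim P (k + 1) = faceOf (formOn j) (fun q => bound e q.1) '' 𝒜 :=
    facesOfCodim_polyhedron (fun q => bound_pos he q.2) (k + 1)
  have hinj2 : Set.InjOn (faceOf (formOn j) fun q => bound e q.1) 𝒜 :=
    injOn_faceOf.mono fun A hA => hA.1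
  have hfin : 𝒜.Finite := himg ▸ Λ.finite_toSet.image Φ
  refine ⟨hfaces ▸ hfin.image _, ?_⟩
  rw [hfaces, Set.InjOn.ncard_image hinj2, ← himg, Set.InjOn.ncard_image hinj,
    Set.ncard_coe_finset, card_sigma]
  exact sum_congr rfl fun l _ => card_product _ _

end Bijection

end Permutoassoc

namespace Permutoassoc

open Finset

/-! ### Counting bracketings -/

section Bracketings

/-- The cuts of a word of length `l` that are not covered by a bracket. -/
def uncovered (l : ℕ) (T : Finset (ℕ × ℕ)) : Finset ℕ :=
  (Ioo 0 l).filter fun i => ∀ d ∈ T, ¬ (d.1 < i ∧ i < d.2)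

theorem mem_uncovered {l i : ℕ} {T : Finset (ℕ × ℕ)} :
    i ∈ uncovered l T ↔ (0 < i ∧ i < l) ∧ ∀ d ∈ T, ¬ (d.1 < i ∧ i < d.2) := by
  rw [uncovered, mem_filter, mem_Ioo]

/-- The number of families of `j` brackets on a word of length `l` with `c` uncovered cuts. -/
noncomputable def numFamilies (l j c : ℕ) : ℕ := #((families l j).filter fun T => #(uncovered l T) = c)

/-- The full bracket covers all the cuts. If it is absent, the cut of `exists_cut` for the whole
word is covered by no bracket. -/
theorem bracketings_eq {l : ℕ} (hl : 2 ≤ l) (j : ℕ) : #(bracketings l j) = numFamilies l j 0 := by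
  unfold bracketings numFamilies
  congr 1
  refine filter_congr fun T hT => ?_
  have hT' := (mem_families.1 hT).1
  rw [card_eq_zero, eq_empty_iff_forall_notMem]
  constructor
  · intro h i hi
    rw [mem_uncovered] at hi
    exact hi.2 _ h hi.1
  · intro h
    by_contra hc
    obtain ⟨c, h1, h2, -, h3⟩ := exists_cut hT' (a := 0) (b := l) (by omega)
    refine h c (mem_uncovered.2 ⟨⟨h1, h2⟩, fun d hd => ?_⟩)
    rcases h3 d hd (Nat.zero_le _) (hT'.le d hd) with rfl | h4 | h4
    · exact absurd hd hc
    · omega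
    · omega

theorem IsNoncrossing.subset {l : ℕ} {T T' : Finset (ℕ × ℕ)} (hT : IsNoncrossing l T)
    (h : T' ⊆ T) : IsNoncrossing l T' :=
  ⟨fun d hd => hT.add_two_le d (h hd), fun d hd => hT.le d (h hd),
    fun d hd d' hd' => hT.noncrossing d (h hd) d' (h hd')⟩

open Classical in
/-- The families without a bracket that ends at the last letter. -/
theorem card_filter_forall_ne {l : ℕ} (hl : 1 ≤ l) (j c : ℕ) :
    #((families (l + 1) j).filter fun T => #(uncovered (l + 1) T) = c ∧ ∀ a, (a, l + 1) ∉ T) =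
      if c = 0 then 0 else numFamilies l j (c - 1) := by
  have hunc : ∀ T, IsNoncrossing l T → uncovered (l + 1) T = insert l (uncovered l T) := by
    intro T hT
    ext i
    rw [mem_insert, mem_uncovered, mem_uncovered]
    constructor
    · rintro ⟨h1, h2⟩
      by_cases hi : i = l
      · exact Or.inl hi
      · exact Or.inr ⟨by omega, h2⟩
    · rintro (rfl | ⟨h1, h2⟩)
      · refine ⟨by omega, fun d hd => ?_⟩
        have := hT.le d hd
        omega
      · exact ⟨by omega, h2⟩
  have hcard : ∀ T, IsNoncrossing l T → #(uncovered (l + 1) T) = #(uncovered l T) + 1 := by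
    intro T hT
    rw [hunc T hT, card_insert_of_notMem]
    rw [mem_uncovered]
    omega
  have hfam : ∀ T, (T ∈ families (l + 1) j ∧ ∀ a, (a, l + 1) ∉ T) ↔ T ∈ families l j := by
    intro T
    rw [mem_families, mem_families]
    constructor
    · rintro ⟨⟨h1, h2⟩, h3⟩
      refine ⟨⟨h1.add_two_le, fun d hd => ?_, h1.noncrossing⟩, h2⟩
      have h4 := h1.le d hd
      have h5 : d.2 ≠ l + 1 := fun h => h3 d.1 (h ▸ hd)
      omega
    · rintro ⟨h1, h2⟩
      refine ⟨⟨⟨h1.add_two_le, fun d hd => (h1.le d hd).trans (Nat.le_succ l), h1.noncrossing⟩,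
        h2⟩, fun a ha => ?_⟩
      have := h1.le _ ha
      simp only at this
      omega
  split_ifs with hc
  · rw [card_eq_zero, filter_eq_empty_iff]
    rintro T hT ⟨h1, h2⟩
    have := hcard T (mem_families.1 ((hfam T).1 ⟨hT, h2⟩)).1
    omega
  · unfold numFamilies
    congr 1
    ext T
    rw [mem_filter, mem_filter, ← hfam]
    constructor
    · rintro ⟨h1, h2, h3⟩
      have := hcard T (mem_families.1 ((hfam T).1 ⟨h1, h3⟩)).1
      exact ⟨⟨h1, h3⟩, by omega⟩
    · rintro ⟨⟨h1, h3⟩, h2⟩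
      have := hcard T (mem_families.1 ((hfam T).1 ⟨h1, h3⟩)).1
      exact ⟨h1, by omega, h3⟩

/-- `a` is the c-th element of `U` in increasing order, or 0 when `c = 0`. The alternative `0 ∈ U`
is a degenerate case that does not occur for sets of uncovered cuts. -/
theorem exists_card_filter_le_eq (U : Finset ℕ) {c : ℕ} (hc : c < #U) :
    ∃ a, (a = 0 ∨ a ∈ U) ∧ #(U.filter fun i => 0 < i ∧ i ≤ a) = c ∨ 0 ∈ U := by
  by_cases h0 : 0 ∈ U
  · exact ⟨0, Or.inr h0⟩
  induction c with
  | zero =>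
    refine ⟨0, Or.inl ⟨Or.inl rfl, ?_⟩⟩
    rw [card_eq_zero, filter_eq_empty_iff]
    omega
  | succ c ih =>
    obtain ⟨a, ⟨-, ha⟩ | ha⟩ := ih (by omega)
    · have hne : (U.filter fun i => a < i).Nonempty := by
        by_contra hcon
        rw [not_nonempty_iff_eq_empty, filter_eq_empty_iff] at hcon
        have : (U.filter fun i => 0 < i ∧ i ≤ a) = U := by
          refine filter_true_of_mem fun i hi => ⟨?_, not_lt.1 (hcon hi)⟩
          exact Nat.pos_of_ne_zero fun h => h0 (h ▸ hi)
        rw [this] at ha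
        omega
      have hmin := mem_filter.1 (min'_mem _ hne)
      refine ⟨(U.filter fun i => a < i).min' hne, Or.inl ⟨Or.inr hmin.1, ?_⟩⟩
      have : (U.filter fun i => 0 < i ∧ i ≤ (U.filter fun i => a < i).min' hne) =
          insert ((U.filter fun i => a < i).min' hne) (U.filter fun i => 0 < i ∧ i ≤ a) := by
        ext i
        rw [mem_insert, mem_filter, mem_filter]
        constructor
        · rintro ⟨h1, h2, h3⟩
          by_cases hi : a < i
          · exact Or.inl (le_antisymm h3 (min'_le _ _ (mem_filter.2 ⟨h1, hi⟩)))
          · exact Or.inr ⟨h1, h2, not_lt.1 hi⟩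
        · rintro (rfl | ⟨h1, h2, h3⟩)
          · exact ⟨hmin.1, by omega, le_rfl⟩
          · exact ⟨h1, h2, by omega⟩
      rw [this, card_insert_of_notMem, ha]
      rw [mem_filter]
      omega
    · exact absurd ha h0

theorem zero_notMem_uncovered (l : ℕ) (T : Finset (ℕ × ℕ)) : 0 ∉ uncovered l T := by
  rw [mem_uncovered]
  omega

theorem sInf_last_eq {l a : ℕ} {T : Finset (ℕ × ℕ)} (ha : (a, l) ∈ T)
    (hmin : ∀ b, (b, l) ∈ T → a ≤ b) : sInf {b | (b, l) ∈ T} = a :=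
  le_antisymm (Nat.sInf_le ha) (hmin _ (Nat.sInf_mem (s := {b | (b, l) ∈ T}) ⟨a, ha⟩))

/-- Removing the longest bracket that ends at the last letter. -/
theorem uncovered_erase_last {l a : ℕ} {T : Finset (ℕ × ℕ)} (hT : IsNoncrossing l T)
    (ha : (a, l) ∈ T) (hmin : ∀ b, (b, l) ∈ T → a ≤ b) :
    (a = 0 ∨ a ∈ uncovered l (T.erase (a, l))) ∧
    uncovered l T = (uncovered l (T.erase (a, l))).filter (fun i => 0 < i ∧ i ≤ a) ∧
    #(uncovered l T) < #(uncovered l (T.erase (a, l))) := by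
  have h2 := hT.add_two_le _ ha
  simp only at h2
  have heq : uncovered l T = (uncovered l (T.erase (a, l))).filter fun i => 0 < i ∧ i ≤ a := by
    ext i
    rw [mem_filter, mem_uncovered, mem_uncovered]
    constructor
    · rintro ⟨h3, h4⟩
      have := h4 _ ha
      simp only at this
      exact ⟨⟨h3, fun d hd => h4 d (mem_of_mem_erase hd)⟩, by omega⟩
    · rintro ⟨⟨h3, h4⟩, h5⟩
      refine ⟨h3, fun d hd => ?_⟩
      by_cases hda : d = (a, l)
      · rw [hda]
        simp only
        omega
      · exact h4 d (mem_erase.2 ⟨hda, hd⟩)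
  refine ⟨?_, heq, ?_⟩
  · rcases Nat.eq_zero_or_pos a with h0 | h0
    · exact Or.inl h0
    · refine Or.inr (mem_uncovered.2 ⟨⟨h0, by omega⟩, fun d hd hc => ?_⟩)
      have h3 := hT.noncrossing d (mem_of_mem_erase hd) _ ha hc.1 hc.2
      have h4 := hT.le d (mem_of_mem_erase hd)
      simp only at h3
      have h5 := hmin d.1 (by rw [show (d.1, l) = d from Prod.ext rfl (by simp only; omega)]; exact mem_of_mem_erase hd)
      omega
  · obtain ⟨c, h3, h4, -, h5⟩ := exists_cut hT h2
    have hc : c ∈ uncovered l (T.erase (a, l)) := by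
      refine mem_uncovered.2 ⟨by omega, fun d hd hcon => ?_⟩
      have hdT := mem_of_mem_erase hd
      have hda : a ≤ d.1 := by
        by_contra! hlt
        have h6 := hT.noncrossing d hdT _ ha hlt (by simp only; omega)
        have h7 := hT.le d hdT
        simp only at h6
        have h8 := hmin d.1 (by rwa [show (d.1, l) = d from Prod.ext rfl (by simp only; omega)])
        omega
      rcases h5 d hdT hda (hT.le d hdT) with h6 | h6
      · exact (mem_erase.1 hd).1 h6
      · omega
    rw [heq]
    refine card_lt_card (filter_ssubset.2 ⟨c, hc, by omega⟩)

open Classical in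
/-- The families with a bracket that ends at the last letter. -/
theorem card_filter_exists (l j c : ℕ) :
    #((families l (j + 1)).filter fun T => #(uncovered l T) = c ∧ ∃ a, (a, l) ∈ T) =
      #((families l j).filter fun T => c < #(uncovered l T)) := by
  have hmin : ∀ T : Finset (ℕ × ℕ), (∃ a, (a, l) ∈ T) → (sInf {b | (b, l) ∈ T}, l) ∈ T ∧
      ∀ b, (b, l) ∈ T → sInf {b | (b, l) ∈ T} ≤ b := fun T h =>
    ⟨Nat.sInf_mem (s := {b | (b, l) ∈ T}) h, fun b hb => Nat.sInf_le hb⟩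
  -- Erase the longest bracket (a, l) that ends at the last letter. It hid all the uncovered cuts
  -- beyond `a`, so more than `c` cuts are uncovered afterwards. Conversely, given more than `c`
  -- uncovered cuts, `a` has to be the c-th of them, or 0 if `c = 0`.
  refine card_bij (fun T _ => T.erase (sInf {b | (b, l) ∈ T}, l)) ?_ ?_ ?_
  · intro T hT
    obtain ⟨hT1, hT2, hT3⟩ := mem_filter.1 hT
    obtain ⟨hT4, hT5⟩ := mem_families.1 hT1
    obtain ⟨h1, h2⟩ := hmin T hT3
    refine mem_filter.2 ⟨mem_families.2 ⟨hT4.subset (erase_subset _ _), ?_⟩, ?_⟩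
    · rw [card_erase_of_mem h1, hT5]
      rfl
    · rw [← hT2]
      exact (uncovered_erase_last hT4 h1 h2).2.2
  · intro T hT T' hT' heq
    obtain ⟨hT1, hT2, hT3⟩ := mem_filter.1 hT
    obtain ⟨hT4, hT5⟩ := mem_families.1 hT1
    obtain ⟨h1, h2⟩ := hmin T hT3
    obtain ⟨hT1', hT2', hT3'⟩ := mem_filter.1 hT'
    obtain ⟨hT4', hT5'⟩ := mem_families.1 hT1'
    obtain ⟨h1', h2'⟩ := hmin T' hT3'
    obtain ⟨k1, k2, -⟩ := uncovered_erase_last hT4 h1 h2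
    obtain ⟨k1', k2', -⟩ := uncovered_erase_last hT4' h1' h2'
    beta_reduce at heq
    set a := sInf {b | (b, l) ∈ T}
    set a' := sInf {b | (b, l) ∈ T'}
    rw [← heq] at k1' k2'
    set U := uncovered l (T.erase (a, l))
    -- Two admissible left ends with the same number of uncovered cuts up to them coincide, which
    -- makes the erased bracket recoverable.
    have key : ∀ x y, (y = 0 ∨ y ∈ U) → #(U.filter fun i => 0 < i ∧ i ≤ x) = c →
        #(U.filter fun i => 0 < i ∧ i ≤ y) = c → ¬ x < y := by
      intro x y hy hx1 hy1 hlt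
      have : (U.filter fun i => 0 < i ∧ i ≤ x) ⊂ U.filter fun i => 0 < i ∧ i ≤ y := by
        refine ⟨fun i hi => ?_, fun hsub => ?_⟩
        · rw [mem_filter] at hi ⊢
          exact ⟨hi.1, hi.2.1, by omega⟩
        · have := hsub (mem_filter.2 ⟨hy.resolve_left (by omega), by omega, le_rfl⟩)
          rw [mem_filter] at this
          omega
      have := card_lt_card this
      omega
    rw [k2] at hT2
    rw [k2'] at hT2'
    have haa : a = a' := le_antisymm (not_lt.1 (key a' a k1 hT2' hT2))
      (not_lt.1 (key a a' k1' hT2 hT2'))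
    rw [← insert_erase h1, ← insert_erase h1', heq, haa]
  · intro R hR
    obtain ⟨hR1, hR2⟩ := mem_filter.1 hR
    obtain ⟨hR3, hR4⟩ := mem_families.1 hR1
    obtain ⟨a, ⟨ha0, hac⟩ | ha⟩ := exists_card_filter_le_eq _ hR2
    swap
    · exact absurd ha (zero_notMem_uncovered l R)
    obtain ⟨u, hu, hua⟩ : ∃ u ∈ uncovered l R, a < u := by
      by_contra! hcon
      rw [filter_true_of_mem] at hac
      · omega
      · intro i hi
        exact ⟨(mem_uncovered.1 hi).1.1, hcon i hi⟩
    obtain ⟨hu1, hu2⟩ := mem_uncovered.1 hu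
    have hnot : (a, l) ∉ R := fun h => hu2 _ h ⟨hua, hu1.2⟩
    have hcov : ∀ d ∈ R, ¬ (d.1 < a ∧ a < d.2) := by
      intro d hd
      rcases ha0 with h0 | h0
      · omega
      · exact (mem_uncovered.1 h0).2 d hd
    have hT : IsNoncrossing l (insert (a, l) R) := by
      refine ⟨fun d hd => ?_, fun d hd => ?_, fun d hd d' hd' => ?_⟩
      · rcases mem_insert.1 hd with rfl | hd
        · simp only
          omega
        · exact hR3.add_two_le d hd
      · rcases mem_insert.1 hd with rfl | hd
        · exact le_rfl
        · exact hR3.le d hd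
      · rcases mem_insert.1 hd with rfl | hd <;> rcases mem_insert.1 hd' with rfl | hd'
        · omega
        · exact fun _ _ => hR3.le d' hd'
        · exact fun h1 h2 => absurd ⟨h1, h2⟩ (hcov d hd)
        · exact hR3.noncrossing d hd d' hd'
    have hmina : ∀ b, (b, l) ∈ insert (a, l) R → a ≤ b := by
      intro b hb
      rcases mem_insert.1 hb with hb | hb
      · exact (Prod.mk.inj hb).1.ge
      · by_contra! hlt
        exact hcov _ hb ⟨hlt, by simp only; omega⟩
    have hmem := mem_insert_self (a, l) R
    obtain ⟨-, k2, -⟩ := uncovered_erase_last hT hmem hmina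
    rw [erase_insert hnot] at k2
    refine ⟨insert (a, l) R, mem_filter.2 ⟨mem_families.2 ⟨hT, ?_⟩, ?_, ⟨a, hmem⟩⟩, ?_⟩
    · rw [card_insert_of_notMem hnot, hR4]
    · rw [k2, hac]
    · rw [sInf_last_eq hmem hmina, erase_insert hnot]

open Classical in
-- Either no bracket ends at the last letter, and dropping this letter removes one uncovered cut, or
-- the longest such bracket is erased.
theorem numFamilies_succ {l : ℕ} (hl : 1 ≤ l) (j c : ℕ) :
    numFamilies (l + 1) (j + 1) c = (if c = 0 then 0 else numFamilies l (j + 1) (c - 1)) +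
      #((families (l + 1) j).filter fun T => c < #(uncovered (l + 1) T)) := by
  rw [← card_filter_forall_ne hl, ← card_filter_exists, numFamilies,
    ← card_filter_add_card_filter_not (s := (families (l + 1) (j + 1)).filter fun T =>
      #(uncovered (l + 1) T) = c) fun T => ∀ a, (a, l + 1) ∉ T, filter_filter, filter_filter]
  congr 2
  refine filter_congr fun T _ => ?_
  rw [not_forall]
  simp only [not_not]

theorem numFamilies_zero {l : ℕ} (c : ℕ) :
    numFamilies (l + 1) 0 c = if c = l then 1 else 0 := by
  have hfam : families (l + 1) 0 = {∅} := by
    ext T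
    rw [mem_families, mem_singleton, card_eq_zero]
    refine and_iff_right_of_imp ?_
    rintro rfl
    exact ⟨fun d hd => absurd hd (notMem_empty d), fun d hd => absurd hd (notMem_empty d),
      fun d hd => absurd hd (notMem_empty d)⟩
  have hunc : #(uncovered (l + 1) ∅) = l := by
    rw [uncovered, filter_true_of_mem fun i _ d hd => absurd hd (notMem_empty d), Nat.card_Ioo]
    rfl
  rw [numFamilies, hfam, filter_singleton, hunc]
  split_ifs with h1 h2 h2
  · rfl
  · exact absurd h1.symm h2
  · exact absurd h2.symm h1
  · rfl

/-- A word of `l + 1` letters has `l` cuts, and `j` noncrossing brackets leave at most `l - j` of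
them uncovered. This makes the sums over the number of uncovered cuts finite. -/
theorem numFamilies_eq_zero (j : ℕ) : ∀ l c : ℕ, l < c + j → numFamilies (l + 1) j c = 0 := by
  induction j with
  | zero =>
    intro l c h
    rw [numFamilies_zero, if_neg (by omega)]
  | succ j ihj =>
    intro l
    induction l with
    | zero =>
      intro c _
      rw [numFamilies, card_eq_zero, filter_eq_empty_iff]
      intro T hT _
      obtain ⟨h1, h2⟩ := mem_families.1 hT
      obtain ⟨d, hd⟩ := card_pos.1 (by omega : 0 < #T)
      have := h1.add_two_le d hd
      have := h1.le d hd
      omega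
    | succ l ihl =>
      intro c h
      rw [numFamilies_succ (by omega)]
      have h2 : #((families (l + 1 + 1) j).filter fun T => c < #(uncovered (l + 1 + 1) T)) = 0 := by
        rw [card_eq_zero, filter_eq_empty_iff]
        intro T hT hc
        have h3 := ihj (l + 1) #(uncovered (l + 1 + 1) T) (by omega)
        rw [numFamilies, card_eq_zero, filter_eq_empty_iff] at h3
        exact h3 hT rfl
      rw [h2, add_zero]
      split_ifs with hc
      · rfl
      · exact ihl (c - 1) (by omega)

theorem card_filter_lt_uncovered (j c i : ℕ) :
    #((families (c + 1 + j + i + 1) j).filter fun T => c < #(uncovered (c + 1 + j + i + 1) T)) =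
      ∑ t ∈ range (i + 1), numFamilies (c + 1 + j + i + 1) j (c + 1 + t) := by
  rw [card_eq_sum_card_fiberwise (f := fun T => #(uncovered (c + 1 + j + i + 1) T) - (c + 1))
    (t := range (i + 1))]
  · refine sum_congr rfl fun t _ => ?_
    rw [numFamilies, filter_filter]
    congr 1
    refine filter_congr fun T _ => ?_
    omega
  · intro T hT
    obtain ⟨hT1, hT2⟩ := mem_filter.1 hT
    simp only [coe_range, Set.mem_Iio]
    by_contra! hcon
    have h3 := numFamilies_eq_zero j (c + 1 + j + i) #(uncovered (c + 1 + j + i + 1) T) (by omega)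
    rw [numFamilies, card_eq_zero, filter_eq_empty_iff] at h3
    exact h3 hT1 rfl

/-! ### The closed form of the number of families -/

/-- The closed form of `numFamilies`. -/
noncomputable def closedForm (c j i : ℕ) : ℚ :=
  (c + 1) / (c + 1 + 2 * j + i) * (c + 1 + 2 * j + i).choose j * Nat.multichoose j i

theorem mul_multichoose (j i : ℕ) : ((j : ℚ) + 1 + i) * Nat.multichoose (j + 1) i =
    (i + 1) * Nat.multichoose (j + 1) (i + 1) := by
  have h := Nat.add_one_mul_choose_eq (j + i) i
  rw [Nat.multichoose_eq, Nat.multichoose_eq, show j + 1 + i - 1 = j + i by omega,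
    show j + 1 + (i + 1) - 1 = j + i + 1 by omega]
  have h' : (((j + i + 1) * (j + i).choose i : ℕ) : ℚ) =
      ((j + i + 1).choose (i + 1) * (i + 1) : ℕ) := by rw [h]
  push_cast at h'
  linarith

/-- The weighted hockey-stick sum that remains of the recursion for `closedForm` after the factors
not involving `t` are taken out. Shifting `t` by one raises `c` by one, hence the induction on `i`
for all `c`. -/
theorem sum_multichoose (j i : ℕ) : ∀ c : ℕ,
    ∑ t ∈ range (i + 1), ((c : ℚ) + 2 + t) * Nat.multichoose j (i - t) =
      (c + 2 + i / (j + 1)) * Nat.multichoose (j + 1) i := by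
  induction i with
  | zero => simp
  | succ i ih =>
    intro c
    rw [sum_range_succ']
    have h1 := ih (c + 1)
    have h2 := mul_multichoose j i
    have h3 : (Nat.multichoose (j + 1) (i + 1) : ℚ) =
        Nat.multichoose j (i + 1) + Nat.multichoose (j + 1) i := by
      rw [Nat.multichoose_succ_succ]
      push_cast
      ring
    have h4 : ∑ t ∈ range (i + 1), ((c : ℚ) + 2 + (t + 1 : ℕ)) *
        Nat.multichoose j (i + 1 - (t + 1)) =
        ∑ t ∈ range (i + 1), (((c + 1 : ℕ) : ℚ) + 2 + t) * Nat.multichoose j (i - t) := by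
      refine sum_congr rfl fun t _ => ?_
      rw [Nat.add_sub_add_right]
      push_cast
      ring
    rw [h4, h1]
    have hj : (j : ℚ) + 1 ≠ 0 := by positivity
    push_cast
    simp only [add_zero]
    field_simp
    rw [h3] at h2 ⊢
    linear_combination h2

/-- The closed form satisfies the recursion of `numFamilies`. The number `M` is the upper index of
the binomial coefficient in every term of the sum, independently of `t`, so only the sum of
`sum_multichoose` has to be evaluated. -/
theorem closedForm_succ (c j i : ℕ) : closedForm c (j + 1) i =
    (if c = 0 then 0 else closedForm (c - 1) (j + 1) i) +
      ∑ t ∈ range (i + 1), closedForm (c + 1 + t) j (i - t) := by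
  set M := c + 2 + 2 * j + i with hM
  have hM0 : (M : ℚ) ≠ 0 := by
    have : 0 < M := by omega
    positivity
  have hM' : (M : ℚ) = c + 2 + 2 * j + i := by
    rw [hM]
    push_cast
    ring
  have e1 : closedForm c (j + 1) i =
      (c + 1) / (M + 1) * (M + 1).choose (j + 1) * Nat.multichoose (j + 1) i := by
    unfold closedForm
    rw [show c + 1 + 2 * (j + 1) + i = M + 1 by omega]
    push_cast
    rw [hM']
    ring
  have e2 : (if c = 0 then 0 else closedForm (c - 1) (j + 1) i) =
      (c : ℚ) / M * M.choose (j + 1) * Nat.multichoose (j + 1) i := by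
    split_ifs with hc
    · simp [hc]
    · obtain ⟨b, rfl⟩ : ∃ b, c = b + 1 := ⟨c - 1, by omega⟩
      unfold closedForm
      rw [show b + 1 - 1 = b by omega, show b + 1 + 2 * (j + 1) + i = M by omega, hM']
      push_cast
      ring
  have e3 : ∑ t ∈ range (i + 1), closedForm (c + 1 + t) j (i - t) =
      M.choose j / M * ((c + 2 + i / (j + 1)) * Nat.multichoose (j + 1) i) := by
    rw [← sum_multichoose, mul_sum]
    refine sum_congr rfl fun t ht => ?_
    have ht' : t ≤ i := Nat.lt_succ_iff.1 (mem_range.1 ht)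
    unfold closedForm
    rw [show c + 1 + t + 1 + 2 * j + (i - t) = M by omega, Nat.cast_sub ht', hM']
    push_cast
    ring
  rw [e1, e2, e3]
  have hj : (j : ℚ) + 1 ≠ 0 := by positivity
  have hM1 : (M : ℚ) + 1 ≠ 0 := by positivity
  have c1 : ((M + 1).choose (j + 1) : ℚ) = (M + 1) * M.choose j / (j + 1) := by
    rw [eq_div_iff hj]
    exact_mod_cast (Nat.add_one_mul_choose_eq M j).symm
  have c2 : (M.choose (j + 1) : ℚ) = (M - j) * M.choose j / (j + 1) := by
    rw [eq_div_iff hj]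
    have := Nat.choose_succ_right_eq M j
    have h : ((M.choose (j + 1) * (j + 1) : ℕ) : ℚ) = (M.choose j * (M - j) : ℕ) := by rw [this]
    rw [Nat.cast_mul, Nat.cast_mul, Nat.cast_sub (by omega)] at h
    push_cast at h
    linarith
  rw [c1, c2]
  field_simp
  rw [hM']
  ring

theorem numFamilies_eq (j : ℕ) :
    ∀ c i : ℕ, (numFamilies (c + 1 + j + i) j c : ℚ) = closedForm c j i := by
  induction j with
  | zero =>
    intro c i
    rw [show c + 1 + 0 + i = c + i + 1 by omega, numFamilies_zero]
    unfold closedForm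
    -- Without brackets all the cuts are uncovered, so only `i = 0` counts; correspondingly
    -- `Nat.multichoose 0 i` vanishes for `i > 0`.
    rcases i with _ | i
    · have : (c : ℚ) + 1 ≠ 0 := by positivity
      simp [this]
    · simp
  | succ j ihj =>
    have hsum : ∀ c i : ℕ, (#((families (c + 1 + j + i + 1) j).filter
        fun T => c < #(uncovered (c + 1 + j + i + 1) T)) : ℚ) =
        ∑ t ∈ range (i + 1), closedForm (c + 1 + t) j (i - t) := by
      intro c i
      rw [card_filter_lt_uncovered, Nat.cast_sum]
      refine sum_congr rfl fun t ht => ?_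
      have ht' : t ≤ i := Nat.lt_succ_iff.1 (mem_range.1 ht)
      rw [← ihj, show c + 1 + t + 1 + j + (i - t) = c + 1 + j + i + 1 by omega]
    intro c
    induction c with
    | zero =>
      intro i
      rw [show 0 + 1 + (j + 1) + i = 0 + 1 + j + i + 1 by omega, numFamilies_succ (by omega),
        closedForm_succ]
      push_cast
      rw [hsum]
    | succ c ihc =>
      intro i
      rw [show c + 1 + 1 + (j + 1) + i = c + 1 + 1 + j + i + 1 by omega,
        numFamilies_succ (by omega), closedForm_succ]
      push_cast
      rw [hsum]
      rw [← ihc, show c + 1 + (j + 1) + i = c + 1 + 1 + j + i by omega]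

/-- The number of bracketings of a word of length `l` with `k + 1` brackets. -/
theorem card_bracketings {l k : ℕ} (hl : k + 2 ≤ l) : (#(bracketings l (k + 1)) : ℚ) =
    1 / ((k : ℚ) + 1) * ((l - 2).choose k : ℚ) * ((l + k).choose k : ℚ) := by
  -- The closed form is used with `c = 0` and `j = k + 1`, and `i = l - (k + 2)` measures the excess
  -- length.
  obtain ⟨i, rfl⟩ : ∃ i, l = 0 + 1 + (k + 1) + i := ⟨l - (k + 2), by omega⟩
  have hs : (k + i).choose i = (k + i).choose k := (Nat.choose_symm_add (a := k) (b := i)).symm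
  rw [bracketings_eq (by omega), numFamilies_eq, closedForm, Nat.multichoose_eq,
    show k + 1 + i - 1 = k + i by omega, show 0 + 1 + (k + 1) + i - 2 = k + i by omega,
    show 0 + 1 + 2 * (k + 1) + i = 0 + 1 + (k + 1) + i + k + 1 by omega, hs]
  have h := Nat.add_one_mul_choose_eq (0 + 1 + (k + 1) + i + k) k
  have h' : (((0 + 1 + (k + 1) + i + k + 1) * (0 + 1 + (k + 1) + i + k).choose k : ℕ) : ℚ) =
      ((0 + 1 + (k + 1) + i + k + 1).choose (k + 1) * (k + 1) : ℕ) := by rw [h]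
  rw [Nat.cast_mul, Nat.cast_mul] at h'
  generalize ((0 + 1 + (k + 1) + i + k + 1).choose (k + 1) : ℚ) = X at *
  generalize ((0 + 1 + (k + 1) + i + k).choose k : ℚ) = Y at *
  generalize ((k + i).choose k : ℚ) = Z at *
  have hk : (k : ℚ) + 1 ≠ 0 := by positivity
  have hki : (0 : ℚ) + 1 + 2 * (k + 1) + i ≠ 0 := by positivity
  push_cast at h' ⊢
  have hX : X = (0 + 1 + 2 * (k + 1) + i) * Y / (k + 1) := by
    rw [eq_div_iff hk, ← h']
    ring
  rw [hX]
  field_simp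
  ring

theorem card_bracketings_eq_zero {l k : ℕ} (hl : l < k + 2) : #(bracketings l (k + 1)) = 0 := by
  by_cases h2 : 2 ≤ l
  · obtain ⟨l, rfl⟩ : ∃ a, l = a + 1 := ⟨l - 1, by omega⟩
    rw [bracketings_eq h2, numFamilies_eq_zero (k + 1) l 0 (by omega)]
  · rw [card_eq_zero, eq_empty_iff_forall_notMem]
    intro T hT
    obtain ⟨h3, -, h4⟩ := mem_bracketings.1 hT
    have := h3.add_two_le _ h4
    simp only at this
    omega

end Bracketings

end Permutoassoc

namespace Permutoassoc

open Finset Permutonest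

/-! ### Counting ordered partitions -/

section Layerings

theorem prod_apply_eq_prod_pow {ι R : Type*} [Fintype ι] [DecidableEq ι] [CommMonoid R] {N : ℕ}
    (f : Fin N → ι) (x : ι → R) : ∏ s, x (f s) = ∏ i, x i ^ #{s | f s = i} := by
  rw [← prod_fiberwise univ f fun s => x (f s)]
  refine prod_congr rfl fun i _ => ?_
  rw [prod_congr rfl fun s hs => by rw [(mem_filter.1 hs).2], prod_const]

/-- The number of maps with prescribed sizes of the fibres. -/
theorem card_filter_card_fiber {ι : Type*} [Fintype ι] [DecidableEq ι] {N : ℕ} (k : ι → ℕ)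
    (hk : ∑ i, k i = N) [DecidablePred fun f : Fin N → ι => ∀ i, #{s | f s = i} = k i] :
    (#{f : Fin N → ι | ∀ i, #{s | f s = i} = k i} : ℚ) = N.factorial / ∏ i, ((k i).factorial : ℚ) := by
  -- Expand the N-th power of the sum of the variables over all maps; each map contributes the
  -- monomial of its fibre sizes. The multinomial theorem evaluates the same coefficient.
  have h1 : ((∑ i : ι, MvPolynomial.X i : MvPolynomial ι ℕ) ^ N) =
      ∑ f : Fin N → ι, MvPolynomial.monomial
        (Finsupp.equivFunOnFinite.symm fun i => #{s | f s = i}) 1 := by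
    have := prod_univ_sum (R := MvPolynomial ι ℕ) (fun _ : Fin N => (univ : Finset ι))
      fun _ i => MvPolynomial.X i
    rw [prod_const, card_univ, Fintype.card_fin, Fintype.piFinset_univ] at this
    rw [this]
    refine sum_congr rfl fun f _ => ?_
    rw [prod_apply_eq_prod_pow f, MvPolynomial.monomial_eq, Finsupp.prod_fintype]
    · simp
    · simp
  have h2 : MvPolynomial.coeff (Finsupp.equivFunOnFinite.symm k)
      ((∑ i : ι, MvPolynomial.X i : MvPolynomial ι ℕ) ^ N) =
      #{f : Fin N → ι | ∀ i, #{s | f s = i} = k i} := by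
    rw [h1, MvPolynomial.coeff_sum]
    simp only [MvPolynomial.coeff_monomial, EmbeddingLike.apply_eq_iff_eq, funext_iff]
    rw [sum_boole]
    rfl
  have h3 : (Finsupp.equivFunOnFinite.symm k).sum (fun _ m => m) = N := by
    rw [Finsupp.sum_fintype _ _ fun _ => rfl]
    exact hk
  rw [← h2, MvPolynomial.coeff_sum_X_pow_of_fintype, if_pos h3, eq_div_iff (by positivity),
    Finsupp.multinomial_eq_of_support_subset (subset_univ _)]
  have h4 := Nat.multinomial_spec univ k
  rw [hk] at h4
  rw [← h4]
  push_cast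
  rw [mul_comm]
  rfl

theorem card_layerings (n l : ℕ) :
    #(layerings n l) = #{f : Fin n → Fin l | ∀ i, 0 < #{s | f s = i}} := by
  refine card_bij' (fun f hf s => ⟨f s, (mem_layerings.1 hf).1 s⟩) (fun f _ s => f s) ?_ ?_ ?_ ?_
  · intro f hf
    rw [mem_filter]
    refine ⟨mem_univ _, fun i => card_pos.2 ?_⟩
    obtain ⟨s, hs⟩ := (mem_layerings.1 hf).2 i i.2
    exact ⟨s, mem_filter.2 ⟨mem_univ _, Fin.ext hs⟩⟩
  · intro f hf
    refine mem_layerings.2 ⟨fun s => (f s).2, fun i hi => ?_⟩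
    obtain ⟨s, hs⟩ := card_pos.1 ((mem_filter.1 hf).2 ⟨i, hi⟩)
    exact ⟨s, congrArg Fin.val (mem_filter.1 hs).2⟩
  · intro f hf
    rfl
  · intro f hf
    rfl

/-- The number of ordered partitions of `Fin n`, by the sizes of the blocks. -/
theorem card_layerings_eq_sum_sizes (n l : ℕ) : (#(layerings n l) : ℚ) =
    ∑ c : Fin l → Fin (n + 1) with (∀ i, 0 < (c i : ℕ)) ∧ ∑ i, (c i : ℕ) = n,
      n.factorial / ∏ i, ((c i : ℕ).factorial : ℚ) := by
  have hlt : ∀ (f : Fin n → Fin l) i, #{s | f s = i} < n + 1 := fun f i =>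
    Nat.lt_succ_of_le ((card_filter_le _ _).trans (by simp))
  have hsum : ∀ f : Fin n → Fin l, ∑ i, #{s | f s = i} = n := fun f => by
    rw [← card_eq_sum_card_fiberwise fun s _ => mem_coe.2 (mem_univ (f s))]
    simp
  rw [card_layerings, card_eq_sum_card_fiberwise
    (f := fun f i => (⟨#{s | f s = i}, hlt f i⟩ : Fin (n + 1)))
    (t := {c : Fin l → Fin (n + 1) | (∀ i, 0 < (c i : ℕ)) ∧ ∑ i, (c i : ℕ) = n}), Nat.cast_sum]
  · refine sum_congr rfl fun c hc => ?_
    obtain ⟨-, hc1, hc2⟩ := mem_filter.1 hc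
    rw [← card_filter_card_fiber (fun i => (c i : ℕ)) hc2, filter_filter]
    congr 2
    refine filter_congr fun f _ => ?_
    simp only [funext_iff, Fin.ext_iff]
    exact and_iff_right_of_imp fun h i => (h i).symm ▸ hc1 i
  · intro f hf
    have hf' := (mem_filter.1 (mem_coe.1 hf)).2
    exact mem_coe.2 (mem_filter.2 ⟨mem_univ _, hf', hsum f⟩)

/-- The number of ordered partitions of `Fin n`, by the partition of `n` that they define. -/
theorem card_layerings_eq_sum_partition (n l : ℕ) : (#(layerings n l) : ℚ) =
    ∑ p : n.Partition with p.parts.card = l, partitionWeight p * partitionMultinomial p := by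
  classical
  have hinj : Function.Injective (Nat.Partition.parts (n := n)) := fun p q => Nat.Partition.ext
  have hprod : ∀ (g : ℕ → ℚ), (∏ j : Fin (n + 1), g j) =
      g 0 * ∏ j ∈ Icc 1 n, g j := by
    intro g
    rw [Fin.prod_univ_eq_prod_range g, ← prod_erase_mul _ _ (mem_range.2 (Nat.succ_pos n)), mul_comm]
    congr 2
    ext j
    rw [mem_erase, mem_range, mem_Icc]
    omega
  rw [card_layerings_eq_sum_sizes, ← sum_fiberwise_of_maps_to
    (g := fun c : Fin l → Fin (n + 1) => univ.val.map fun i => (c i : ℕ))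
    (t := (univ.filter fun p : n.Partition => p.parts.card = l).image Nat.Partition.parts),
    sum_image fun p _ q _ h => hinj h]
  · refine sum_congr rfl fun p hp => ?_
    have hp' := (mem_filter.1 hp).2
    have h1 : ∀ c : Fin l → Fin (n + 1), (univ.val.map fun i => (c i : ℕ)) = p.parts →
        (n.factorial / ∏ i, ((c i : ℕ).factorial : ℚ)) = partitionMultinomial p := by
      intro c hc
      rw [partitionMultinomial, ← hc, Multiset.map_map, ← Nat.cast_prod]
      rfl
    rw [sum_congr rfl fun c hc => h1 c (mem_filter.1 hc).2, sum_const, nsmul_eq_mul]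
    congr 1
    have h2 : ∀ (c : Fin l → Fin (n + 1)) (j : Fin (n + 1)),
        (univ.val.map fun i => (c i : ℕ)).count (j : ℕ) = #{i | c i = j} := by
      intro c j
      rw [Multiset.count_map]
      refine congrArg Multiset.card (Multiset.filter_congr fun i _ => ?_)
      rw [Fin.ext_iff, eq_comm]
    have h3 : ∀ j, j ∉ Icc 1 n → p.parts.count j = 0 := by
      intro j hj
      rw [Multiset.count_eq_zero]
      intro hj'
      exact hj (mem_Icc.2 ⟨p.parts_pos hj', p.le_of_mem_parts hj'⟩)
    have h4 : ∑ j : Fin (n + 1), p.parts.count (j : ℕ) = l := by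
      rw [← hp', ← Multiset.toFinset_sum_count_eq, Fin.sum_univ_eq_sum_range (fun j => p.parts.count j)]
      refine (sum_subset (fun j hj => ?_) fun j _ hj => ?_).symm
      · exact mem_range.2 (Nat.lt_succ_of_le (p.le_of_mem_parts (Multiset.mem_toFinset.1 hj)))
      · exact Multiset.count_eq_zero.2 fun h => hj (Multiset.mem_toFinset.2 h)
    -- The weight w(λ) is again a multinomial coefficient: it counts the sequences of l block sizes
    -- whose fibres have the multiplicities of λ as sizes. The value 0 never occurs, which removes
    -- the factor of `j = 0`.
    have h5 := card_filter_card_fiber (fun j : Fin (n + 1) => p.parts.count (j : ℕ)) h4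
    rw [hprod fun j => ((p.parts.count j).factorial : ℚ), h3 0 (by simp), Nat.factorial_zero,
      Nat.cast_one, one_mul] at h5
    rw [partitionWeight, hp', ← h5, filter_filter]
    congr 2
    refine filter_congr fun c _ => ?_
    simp only [← h2]
    constructor
    · rintro ⟨-, h⟩ j
      rw [h]
    · intro h
      have h6 : (univ.val.map fun i => (c i : ℕ)) = p.parts := by
        ext j
        by_cases hj : j < n + 1
        · exact h ⟨j, hj⟩
        · rw [h3 j (by rw [mem_Icc]; omega), Multiset.count_eq_zero, Multiset.mem_map]
          rintro ⟨i, -, rfl⟩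
          exact hj (c i).2
      refine ⟨⟨fun i => p.parts_pos (h6 ▸ Multiset.mem_map_of_mem _ (mem_univ i)), ?_⟩, h6⟩
      have h7 := p.parts_sum
      rwa [← h6] at h7
  · intro c hc
    obtain ⟨-, hc1, hc2⟩ := mem_filter.1 hc
    refine mem_image.2 ⟨⟨univ.val.map fun i => (c i : ℕ), ?_, hc2⟩, ?_, rfl⟩
    · intro j hj
      obtain ⟨i, -, rfl⟩ := Multiset.mem_map.1 hj
      exact hc1 i
    · simp

end Layerings

end Permutoassoc

namespace Permutoassoc

open Finset Permutonest

/-! ### The root system of type `A` in coordinates -/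

section Coordinates

variable {m : ℕ}

/-- The coordinates of a vector of the hyperplane. -/
def coords (m : ℕ) : hyperplaneA m →ₗ[ℝ] (Fin (m + 1) → ℝ) where
  toFun x s := (x : EuclideanSpace ℝ (Fin (m + 1))) s
  map_add' _ _ := rfl
  map_smul' _ _ := rfl

theorem sum_coords (x : hyperplaneA m) : ∑ s, coords m x s = 0 := x.2

theorem coords_injective : Function.Injective (coords m) := by
  intro x y h
  refine Subtype.ext (PiLp.ext fun s => ?_)
  exact congrFun h s

theorem exists_coords_eq (y : Fin (m + 1) → ℝ) (hy : ∑ s, y s = 0) : ∃ x, coords m x = y :=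
  ⟨⟨WithLp.toLp 2 y, hy⟩, rfl⟩

theorem coords_rootA (i j s : Fin (m + 1)) :
    coords m (rootA m i j) s = (if s = i then 1 else 0) - if s = j then 1 else 0 := by
  change (EuclideanSpace.single i (1 : ℝ) - EuclideanSpace.single j (1 : ℝ)) s = _
  simp [PiLp.single_apply]

theorem inner_eq_sum (x y : hyperplaneA m) : ⟪x, y⟫ = ∑ s, coords m x s * coords m y s := by
  rw [Submodule.coe_inner, PiLp.inner_apply]
  refine sum_congr rfl fun s _ => ?_
  rw [RCLike.inner_apply, conj_trivial, mul_comm]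
  rfl

theorem inner_rootA (x : hyperplaneA m) (i j : Fin (m + 1)) :
    ⟪x, rootA m i j⟫ = coords m x i - coords m x j := by
  rw [inner_eq_sum]
  simp [coords_rootA, mul_sub, sum_sub_distrib]

theorem simpleA_apply (i : Fin m) : simpleA m i = rootA m i.castSucc i.succ := by
  rw [simpleA, Module.Basis.mk_apply]

/-- Partial sums of coordinates are the basis dual to the simple roots, by `partialSum_rootA`. -/
theorem repr_simpleA (x : hyperplaneA m) (i : Fin m) :
    (simpleA m).repr x i = ∑ l ∈ Iic i.castSucc, coords m x l := by
  conv_rhs => rw [← (simpleA m).sum_repr x]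
  simp only [map_sum, map_smul, Finset.sum_apply, Pi.smul_apply, smul_eq_mul]
  rw [sum_comm]
  simp only [← mul_sum]
  have h : ∀ j, ∑ l ∈ Iic i.castSucc, coords m (simpleA m j) l = if j = i then 1 else 0 := by
    intro j
    rw [simpleA_apply]
    exact partialSum_rootA m i j
  simp [h]

/-- The reflection in a root transposes two coordinates. -/
theorem coords_rootReflection {i j : Fin (m + 1)} (h : i ≠ j) (x : hyperplaneA m)
    (s : Fin (m + 1)) :
    coords m (rootReflection (rootA m i j) x) s = coords m x (Equiv.swap i j s) := by
  have h1 : ‖rootA m i j‖ ^ 2 = 2 := by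
    rw [← real_inner_self_eq_norm_sq, inner_rootA, coords_rootA, coords_rootA, if_pos rfl,
      if_neg h, if_neg h.symm, if_pos rfl]
    norm_num
  rw [rootReflection, Submodule.reflection_orthogonal_apply, Submodule.reflection_singleton_apply,
    real_inner_comm, inner_rootA, RCLike.ofReal_real_eq_id, id_eq, h1, two_nsmul]
  have h2 : ∀ (c : ℝ) (y : hyperplaneA m), coords m (-(c • y + c • y - x)) s =
      -(c * coords m y s + c * coords m y s - coords m x s) := fun c y => rfl
  refine (h2 _ _).trans ?_
  rw [coords_rootA]
  rcases eq_or_ne s i with rfl | hi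
  · rw [Equiv.swap_apply_left]
    simp [h]
  · rcases eq_or_ne s j with rfl | hj
    · rw [Equiv.swap_apply_right]
      simp [hi]
      ring
    · rw [Equiv.swap_apply_of_ne_of_ne hi hj]
      simp [hi, hj]

/-- The Weyl group acts by permutations of the coordinates. -/
theorem exists_perm_of_mem_weylGroup {σ : hyperplaneA m ≃ₗᵢ[ℝ] hyperplaneA m}
    (hσ : σ ∈ weylGroup (rootsA m)) :
    ∃ τ : Equiv.Perm (Fin (m + 1)), ∀ x s, coords m (σ x) s = coords m x (τ s) := by
  induction hσ using Subgroup.closure_induction with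
  | mem σ h =>
    obtain ⟨_, ⟨i, j, hij, rfl⟩, rfl⟩ := h
    exact ⟨Equiv.swap i j, fun x s => coords_rootReflection hij x s⟩
  | one => exact ⟨1, fun x s => rfl⟩
  | mul σ σ' _ _ h h' =>
    obtain ⟨τ, hτ⟩ := h
    obtain ⟨τ', hτ'⟩ := h'
    refine ⟨τ' * τ, fun x s => ?_⟩
    rw [show (σ * σ') x = σ (σ' x) from rfl, hτ, hτ']
    rfl
  | inv σ _ h =>
    obtain ⟨τ, hτ⟩ := h
    refine ⟨τ⁻¹, fun x s => ?_⟩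
    have := hτ (σ⁻¹ x) (τ⁻¹ s)
    rw [show τ (τ⁻¹ s) = s from τ.apply_symm_apply s] at this
    rw [← this]
    exact congrArg (fun y => coords m y (τ⁻¹ s)) (σ.apply_symm_apply x)

theorem exists_mem_weylGroup (τ : Equiv.Perm (Fin (m + 1))) :
    ∃ σ ∈ weylGroup (rootsA m), ∀ x s, coords m (σ x) s = coords m x (τ s) := by
  induction τ using Equiv.Perm.swap_induction_on with
  | one => exact ⟨1, one_mem _, fun x s => rfl⟩
  | swap_mul τ i j hij h =>
    obtain ⟨σ, hσ, h⟩ := h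
    refine ⟨σ * rootReflection (rootA m i j), mul_mem hσ
      (Subgroup.subset_closure ⟨_, ⟨i, j, hij, rfl⟩, rfl⟩), fun x s => ?_⟩
    rw [show (σ * rootReflection (rootA m i j)) x = σ (rootReflection (rootA m i j) x) from rfl, h,
      coords_rootReflection hij]
    rfl

theorem repr_rootA_of_lt {s t : Fin (m + 1)} (h : s < t) (i : Fin m) :
    (simpleA m).repr (rootA m s t) i = if s ≤ i.castSucc ∧ i.castSucc < t then 1 else 0 := by
  rw [repr_simpleA]
  simp only [coords_rootA, sum_sub_distrib, sum_ite_eq', mem_Iic]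
  split_ifs <;> first | omega | simp

theorem positiveRoots_eq : positiveRoots (rootsA m) (simpleA m) =
    (fun d : Fin (m + 1) × Fin (m + 1) => rootA m d.1 d.2) '' {d | d.1 < d.2} := by
  ext α
  constructor
  · rintro ⟨⟨s, t, hst, rfl⟩, h⟩
    rcases lt_or_gt_of_ne hst with h1 | h1
    · exact ⟨(s, t), h1, rfl⟩
    · exfalso
      have h2 := h ⟨t, by omega⟩
      have h3 : rootA m s t = - rootA m t s := by
        refine coords_injective (funext fun r => ?_)
        rw [map_neg, Pi.neg_apply, coords_rootA, coords_rootA, neg_sub]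
      rw [h3, map_neg, Finsupp.neg_apply, repr_rootA_of_lt h1, if_pos] at h2
      · norm_num at h2
      · exact ⟨le_rfl, h1⟩
  · rintro ⟨⟨s, t⟩, h, rfl⟩
    refine ⟨⟨s, t, ne_of_lt h, rfl⟩, fun i => ?_⟩
    rw [repr_rootA_of_lt h]
    split_ifs <;> norm_num

theorem rootA_inj {s t s' t' : Fin (m + 1)} (h : s ≠ t) (heq : rootA m s t = rootA m s' t') :
    s = s' ∧ t = t' := by
  have h1 := coords_rootA s' t' s
  have h2 := coords_rootA s' t' t
  rw [← heq, coords_rootA] at h1 h2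
  rw [if_pos rfl, if_neg h] at h1
  rw [if_pos rfl, if_neg h.symm] at h2
  constructor
  · by_contra hne
    rw [if_neg hne] at h1
    split_ifs at h1 <;> norm_num at h1
  · by_contra hne
    rw [if_neg hne] at h2
    split_ifs at h2 <;> norm_num at h2

theorem delta_eq : delta (rootsA m) (simpleA m) =
    (1 / 2 : ℝ) • ∑ d : Fin (m + 1) × Fin (m + 1) with d.1 < d.2, rootA m d.1 d.2 := by
  rw [delta, positiveRoots_eq, finsum_mem_image]
  · congr 1
    rw [← finsum_mem_coe_finset]
    simp
  · rintro ⟨s, t⟩ h ⟨s', t'⟩ h' heq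
    obtain ⟨h1, h2⟩ := rootA_inj (ne_of_lt h) heq
    exact Prod.ext h1 h2

theorem inner_delta (x : hyperplaneA m) : ⟪x, delta (rootsA m) (simpleA m)⟫ =
    1 / 2 * ∑ s, ∑ t, if s < t then coords m x s - coords m x t else 0 := by
  rw [delta_eq]
  refine (real_inner_smul_right x _ _).trans ?_
  rw [inner_sum, sum_filter, Fintype.sum_prod_type]
  simp only [inner_rootA]

end Coordinates

end Permutoassoc

namespace Permutoassoc

open Finset Permutonest

/-! ### The subspaces spanned by simple roots -/

section Subspaces

variable {m : ℕ}

/-- The vectors supported on `F`. -/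
def supported (F : Finset (Fin (m + 1))) : Submodule ℝ (hyperplaneA m) where
  carrier := {x | ∀ s, s ∉ F → coords m x s = 0}
  add_mem' {x y} hx hy s hs := by
    rw [map_add, Pi.add_apply, hx s hs, hy s hs, add_zero]
  zero_mem' s _ := by rw [map_zero, Pi.zero_apply]
  smul_mem' c x hx s hs := by
    rw [map_smul, Pi.smul_apply, hx s hs, smul_zero]

/-- The vectors whose coordinates sum to zero on each block of `q`. -/
def blockwise (q : Fin (m + 1) → Fin (m + 1)) : Submodule ℝ (hyperplaneA m) where
  carrier := {x | ∀ v, ∑ s with q s = v, coords m x s = 0}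
  add_mem' {x y} hx hy v := by
    simp only [map_add, Pi.add_apply, sum_add_distrib, hx v, hy v, add_zero]
  zero_mem' v := by simp only [map_zero, Pi.zero_apply, sum_const_zero]
  smul_mem' c x hx v := by
    simp only [map_smul, Pi.smul_apply, smul_eq_mul, ← mul_sum, hx v, mul_zero]

theorem mem_supported {F : Finset (Fin (m + 1))} {x : hyperplaneA m} :
    x ∈ supported F ↔ ∀ s, s ∉ F → coords m x s = 0 := Iff.rfl

theorem mem_blockwise {q : Fin (m + 1) → Fin (m + 1)} {x : hyperplaneA m} :
    x ∈ blockwise q ↔ ∀ v, ∑ s with q s = v, coords m x s = 0 := Iff.rfl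

/-- `F` is an interval. -/
def IsInterval (F : Finset (Fin (m + 1))) : Prop :=
  ∀ s t u, s ∈ F → u ∈ F → s ≤ t → t ≤ u → t ∈ F

theorem rootA_mem_supported {F : Finset (Fin (m + 1))} {s t : Fin (m + 1)} (h : s ≠ t) :
    rootA m s t ∈ supported F ↔ s ∈ F ∧ t ∈ F := by
  rw [mem_supported]
  constructor
  · intro hF
    constructor
    · by_contra hs
      have := hF s hs
      rw [coords_rootA, if_pos rfl, if_neg h] at this
      norm_num at this
    · by_contra hs
      have := hF t hs
      rw [coords_rootA, if_pos rfl, if_neg h.symm] at this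
      norm_num at this
  · rintro ⟨hs, ht⟩ r hr
    rw [coords_rootA, if_neg (ne_of_mem_of_not_mem hs hr).symm,
      if_neg (ne_of_mem_of_not_mem ht hr).symm, sub_zero]

theorem sum_coords_rootA (q : Fin (m + 1) → Fin (m + 1)) (s t v : Fin (m + 1)) :
    ∑ r with q r = v, coords m (rootA m s t) r =
      (if q s = v then 1 else 0) - if q t = v then 1 else 0 := by
  simp [coords_rootA, sum_sub_distrib]

theorem rootA_mem_blockwise {q : Fin (m + 1) → Fin (m + 1)} {s t : Fin (m + 1)} :
    rootA m s t ∈ blockwise q ↔ q s = q t := by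
  rw [mem_blockwise]
  constructor
  · intro h
    by_contra hst
    have := h (q s)
    rw [sum_coords_rootA, if_pos rfl, if_neg (Ne.symm hst)] at this
    norm_num at this
  · intro h v
    rw [sum_coords_rootA, h, sub_self]

theorem supported_le_blockwise {F : Finset (Fin (m + 1))} {q : Fin (m + 1) → Fin (m + 1)} :
    supported F ≤ blockwise q ↔ ∀ s ∈ F, ∀ t ∈ F, q s = q t := by
  constructor
  · intro h s hs t ht
    rcases eq_or_ne s t with rfl | hst
    · rfl
    · exact rootA_mem_blockwise.1 (h ((rootA_mem_supported hst).2 ⟨hs, ht⟩))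
  · intro h x hx v
    by_cases hv : ∃ s ∈ F, q s = v
    · obtain ⟨s, hs, rfl⟩ := hv
      rw [← sum_coords x]
      refine sum_subset (subset_univ _) fun t _ ht => hx t fun htF => ht ?_
      exact mem_filter.2 ⟨mem_univ t, h t htF s hs⟩
    · refine sum_eq_zero fun t ht => hx t fun htF => hv ⟨t, htF, (mem_filter.1 ht).2⟩

theorem supported_le_supported {F F' : Finset (Fin (m + 1))} (hF : 2 ≤ #F) :
    supported F ≤ supported F' ↔ F ⊆ F' := by
  constructor
  · intro h s hs
    obtain ⟨t, ht, hst⟩ := exists_mem_ne hF s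
    exact ((rootA_mem_supported hst.symm).1 (h ((rootA_mem_supported hst.symm).2 ⟨hs, ht⟩))).1
  · exact fun h x hx s hs => hx s fun hc => hs (h hc)

theorem mem_span_simpleA {I : Set (Fin m)} {x : hyperplaneA m} :
    x ∈ Submodule.span ℝ (simpleA m '' I) ↔ ∀ i ∉ I, ∑ l ∈ Iic i.castSucc, coords m x l = 0 := by
  rw [Module.Basis.mem_span_image]
  simp only [← repr_simpleA]
  constructor
  · intro h i hi
    by_contra hc
    exact hi (h (Finsupp.mem_support_iff.2 hc))
  · intro h i hi
    by_contra hc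
    exact Finsupp.mem_support_iff.1 hi (h i hc)

/-- The indices of the simple roots supported on `F`. -/
def simpleOn (F : Finset (Fin (m + 1))) : Finset (Fin m) := {i | i.castSucc ∈ F ∧ i.succ ∈ F}

/-- At an index outside `simpleOn F` the partial sum of a vector supported on the interval `F`
contains all of `F` or none of it, so it vanishes. -/
theorem supported_eq_span {F : Finset (Fin (m + 1))} (hF : IsInterval F) :
    supported F = Submodule.span ℝ (simpleA m '' simpleOn F) := by
  apply le_antisymm
  · intro x hx
    rw [mem_span_simpleA]
    intro i hi
    by_cases h : ∃ l ∈ F, l ≤ i.castSucc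
    · obtain ⟨l, hl, hli⟩ := h
      rw [← sum_coords x]
      refine sum_subset (subset_univ _) fun u _ hu => hx u fun huF => hi ?_
      rw [mem_Iic, not_le] at hu
      refine mem_coe.2 (mem_filter.2 ⟨mem_univ i, hF l _ u hl huF hli hu.le, ?_⟩)
      exact hF l _ u hl huF (hli.trans i.castSucc_le_succ) (Fin.castSucc_lt_iff_succ_le.1 hu)
    · exact sum_eq_zero fun u hu => hx u fun huF => h ⟨u, huF, mem_Iic.1 hu⟩
  · rw [Submodule.span_le]
    rintro _ ⟨i, hi, rfl⟩
    rw [simpleA_apply]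
    exact (rootA_mem_supported i.castSucc_lt_succ.ne).2 (mem_filter.1 (mem_coe.1 hi)).2

/-- The simple roots left out are those where `q` jumps; there the partial sum runs over whole
blocks. -/
theorem blockwise_eq_span {q : Fin (m + 1) → Fin (m + 1)} (hq : Monotone q) :
    blockwise q = Submodule.span ℝ (simpleA m '' {i | q i.castSucc = q i.succ}) := by
  apply le_antisymm
  · intro x hx
    rw [mem_span_simpleA]
    intro i hi
    have h1 : Iic i.castSucc = univ.filter fun l => q l ≤ q i.castSucc := by
      ext l
      rw [mem_Iic, mem_filter]
      constructor
      · exact fun h => ⟨mem_univ l, hq h⟩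
      · rintro ⟨-, h⟩
        by_contra! hl
        exact hi (le_antisymm (hq i.castSucc_le_succ)
          ((hq (Fin.castSucc_lt_iff_succ_le.1 hl)).trans h))
    rw [h1, ← sum_fiberwise (univ.filter fun l => q l ≤ q i.castSucc) q]
    refine sum_eq_zero fun v _ => ?_
    rw [filter_filter]
    by_cases hv : v ≤ q i.castSucc
    · rw [← hx v]
      refine sum_congr (filter_congr fun s _ => ⟨fun h => h.2, fun h => ⟨h ▸ hv, h⟩⟩) fun _ _ => rfl
    · exact sum_eq_zero fun s hs => absurd ((mem_filter.1 hs).2.2 ▸ (mem_filter.1 hs).2.1) hv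
  · rw [Submodule.span_le]
    rintro _ ⟨i, hi, rfl⟩
    rw [simpleA_apply]
    exact rootA_mem_blockwise.2 hi

/-- Let `q s` count the indices outside `I` that precede `s`. Thus sets of simple roots correspond
to partitions of the coordinates into consecutive blocks. -/
theorem exists_monotone (I : Set (Fin m)) : ∃ q : Fin (m + 1) → Fin (m + 1), Monotone q ∧
    {i | q i.castSucc = q i.succ} = I := by
  classical
  have hlt : ∀ s : Fin (m + 1), #{i : Fin m | i ∉ I ∧ i.castSucc < s} < m + 1 := fun s =>
    Nat.lt_succ_of_le ((card_filter_le _ _).trans (by simp))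
  refine ⟨fun s => ⟨_, hlt s⟩, fun s t hst => ?_, ?_⟩
  · rw [Fin.mk_le_mk]
    refine card_le_card fun i hi => ?_
    rw [mem_filter] at hi ⊢
    exact ⟨hi.1, hi.2.1, hi.2.2.trans_le hst⟩
  · ext i
    rw [Set.mem_ofPred_eq, Fin.mk.injEq]
    have h1 : ∀ j : Fin m, j.castSucc < i.succ ↔ j.castSucc < i.castSucc ∨ j = i := by
      intro j
      rw [Fin.castSucc_lt_succ_iff, Fin.castSucc_lt_castSucc_iff, le_iff_lt_or_eq]
    by_cases hi : i ∈ I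
    · refine iff_of_true (congrArg card (filter_congr fun j _ => and_congr_right fun hj => ?_)) hi
      rw [h1]
      exact ⟨Or.inl, fun h => h.resolve_right fun hji => hj (hji ▸ hi)⟩
    · refine iff_of_false (ne_of_lt (card_lt_card ?_)) hi
      refine ⟨fun j hj => ?_, fun h => ?_⟩
      · rw [mem_filter] at hj ⊢
        exact ⟨hj.1, hj.2.1, (h1 j).2 (Or.inl hj.2.2)⟩
      have := h (mem_filter.2 ⟨mem_univ i, hi, (h1 i).2 (Or.inr rfl)⟩)
      exact lt_irrefl _ (mem_filter.1 this).2.2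

theorem isInterval_fiber {q : Fin (m + 1) → Fin (m + 1)} (hq : Monotone q) (v : Fin (m + 1)) :
    IsInterval (univ.filter fun s => q s = v) := by
  intro s t u hs hu hst htu
  rw [mem_filter] at hs hu ⊢
  exact ⟨mem_univ t, le_antisymm (hu.2 ▸ hq htu) (hs.2 ▸ hq hst)⟩

theorem card_simpleOn {F : Finset (Fin (m + 1))} (hF : IsInterval F) (hne : F.Nonempty) :
    #(simpleOn F) = #F - 1 := by
  rw [← card_erase_of_mem (max'_mem F hne), ← card_map Fin.castSuccEmb]
  congr 1
  ext s
  rw [mem_map, mem_erase]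
  constructor
  · rintro ⟨i, hi, rfl⟩
    obtain ⟨h1, h2⟩ := (mem_filter.1 hi).2
    refine ⟨fun hc => ?_, h1⟩
    have := le_max' F _ h2
    rw [← hc] at this
    exact absurd this (not_le.2 i.castSucc_lt_succ)
  · rintro ⟨h1, h2⟩
    have h3 : s < F.max' hne := lt_of_le_of_ne (le_max' F _ h2) h1
    obtain ⟨i, rfl⟩ : ∃ i : Fin m, i.castSucc = s := ⟨s.castPred (Fin.ne_last_of_lt h3), by simp⟩
    refine ⟨i, mem_filter.2 ⟨mem_univ i, h2, ?_⟩, rfl⟩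
    exact hF _ _ _ h2 (max'_mem F hne) i.castSucc_le_succ (Fin.castSucc_lt_iff_succ_le.1 h3)

theorem finrank_supported {F : Finset (Fin (m + 1))} (hF : IsInterval F) (hne : F.Nonempty) :
    Module.finrank ℝ (supported F) = #F - 1 := by
  have h : LinearIndependent ℝ (fun i : simpleOn F => simpleA m i) :=
    (simpleA m).linearIndependent.comp _ Subtype.val_injective
  have h1 := finrank_span_eq_card h
  rw [Fintype.card_coe, card_simpleOn hF hne] at h1
  rw [supported_eq_span hF, ← h1]
  have h2 : simpleA m '' simpleOn F = Set.range fun i : simpleOn F => simpleA m i := by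
    ext x
    simp
  rw [h2]

theorem isSubsystem_rootsOn (F : Finset (Fin (m + 1))) :
    IsSubsystem (rootsA m) {α | ∃ s ∈ F, ∃ t ∈ F, s ≠ t ∧ α = rootA m s t} := by
  constructor
  · rintro _ ⟨s, -, t, -, hst, rfl⟩
    exact ⟨s, t, hst, rfl⟩
  · rintro _ ⟨s, hs, t, ht, hst, rfl⟩ _ ⟨u, hu, v, hv, huv, rfl⟩
    have hmem : ∀ r ∈ F, Equiv.swap s t r ∈ F := by
      intro r hr
      rw [Equiv.swap_apply_def]
      split_ifs <;> assumption
    refine ⟨_, hmem u hu, _, hmem v hv, (Equiv.swap s t).injective.ne huv, ?_⟩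
    refine coords_injective (funext fun r => ?_)
    rw [coords_rootReflection hst, coords_rootA, coords_rootA]
    simp only [Equiv.swap_apply_eq_iff]

/-- Two orthogonal roots e_s - e_t and e_u - e_v have disjoint index sets, and e_s - e_u is
orthogonal to neither of them, so it fits into neither part of an orthogonal splitting. -/
theorem isIrreducibleSystem_rootsOn {F : Finset (Fin (m + 1))} (hF : 2 ≤ #F) :
    IsIrreducibleSystem {α : hyperplaneA m | ∃ s ∈ F, ∃ t ∈ F, s ≠ t ∧ α = rootA m s t} := by
  obtain ⟨a, ha, b, hb, hab⟩ := one_lt_card.1 hF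
  refine ⟨⟨_, a, ha, b, hb, hab, rfl⟩, fun Ψ₁ Ψ₂ hun hort => ?_⟩
  by_contra! hne
  obtain ⟨⟨α, hα⟩, ⟨β, hβ⟩⟩ := hne
  obtain ⟨s, hs, t, ht, hst, rfl⟩ : α ∈ {α | ∃ s ∈ F, ∃ t ∈ F, s ≠ t ∧ α = rootA m s t} :=
    hun ▸ Or.inl hα
  obtain ⟨u, hu, v, hv, huv, rfl⟩ : β ∈ {α | ∃ s ∈ F, ∃ t ∈ F, s ≠ t ∧ α = rootA m s t} :=
    hun ▸ Or.inr hβ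
  have h1 := hort _ hα _ hβ
  rw [inner_rootA, coords_rootA, coords_rootA] at h1
  have hus : u ≠ s := by
    rintro rfl
    rw [if_pos rfl, if_neg hst, if_neg huv.symm] at h1
    split_ifs at h1 <;> norm_num at h1
  have hut : u ≠ t := by
    rintro rfl
    rw [if_neg hst.symm, if_pos rfl, if_neg huv.symm] at h1
    split_ifs at h1 <;> norm_num at h1
  obtain hγ | hγ : rootA m s u ∈ Ψ₁ ∪ Ψ₂ := hun ▸ ⟨s, hs, u, hu, hus.symm, rfl⟩
  · have h2 := hort _ hγ _ hβ
    rw [inner_rootA, coords_rootA, coords_rootA, if_neg hus, if_pos rfl, if_neg huv.symm] at h2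
    split_ifs at h2 <;> norm_num at h2
  · have h2 := hort _ hα _ hγ
    rw [inner_rootA, coords_rootA, coords_rootA, if_pos rfl, if_neg hst, if_neg hus,
      if_neg hut] at h2
    norm_num at h2

/-- The subspaces of the minimal building set that are spanned by simple roots. -/
theorem mem_fund_irreducibleSubspaces {A : Submodule ℝ (hyperplaneA m)} :
    A ∈ fund (simpleA m) (irreducibleSubspaces (rootsA m)) ↔
      ∃ F, IsInterval F ∧ 2 ≤ #F ∧ A = supported F := by
  constructor
  · rintro ⟨⟨Ψ, hΨ, ⟨⟨α, hα⟩, hirr⟩, hA⟩, I, hI⟩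
    obtain ⟨q, hq, rfl⟩ := exists_monotone I
    rw [← blockwise_eq_span hq] at hI
    obtain ⟨s, t, hst, rfl⟩ := hΨ.1 hα
    have hmem : ∀ u v, rootA m u v ∈ Ψ → q u = q v := fun u v h =>
      rootA_mem_blockwise.1 (hI ▸ hA ▸ Submodule.subset_span h)
    set F := univ.filter fun r => q r = q s with hF
    have hsF : s ∈ F ∧ t ∈ F := by
      rw [mem_filter, mem_filter]
      exact ⟨⟨mem_univ s, rfl⟩, mem_univ t, (hmem s t hα).symm⟩
    -- Every root of `Ψ` joins two elements of one block of `q`. The roots inside the block `F` are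
    -- orthogonal to the others, so irreducibility leaves only those in `F`.
    have hsub : Ψ ⊆ supported F := by
      have hort : ∀ x ∈ Ψ ∩ supported F, ∀ y ∈ Ψ \ supported F, ⟪x, y⟫ = 0 := by
        rintro x ⟨-, hx⟩ y ⟨hy, hyF⟩
        obtain ⟨u, v, huv, rfl⟩ := hΨ.1 hy
        have hquv := hmem u v hy
        have hu : u ∉ F := fun hu => hyF ((rootA_mem_supported huv).2
          ⟨hu, mem_filter.2 ⟨mem_univ v, hquv.symm.trans (mem_filter.1 hu).2⟩⟩)
        have hv : v ∉ F := fun hv => hu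
          (mem_filter.2 ⟨mem_univ u, hquv.trans (mem_filter.1 hv).2⟩)
        rw [inner_rootA, hx u hu, hx v hv, sub_zero]
      rcases hirr (Ψ ∩ supported F) (Ψ \ supported F) (Set.inter_union_sdiff _ _) hort with h | h
      · exact absurd h (Set.nonempty_iff_ne_empty.1 ⟨_, hα, (rootA_mem_supported hst).2 hsF⟩)
      · exact Set.sdiff_eq_empty.1 h
    refine ⟨F, isInterval_fiber hq _, one_lt_card.2 ⟨s, hsF.1, t, hsF.2, hst⟩, ?_⟩
    refine le_antisymm (hA ▸ Submodule.span_le.2 hsub) (hI ▸ supported_le_blockwise.2 ?_)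
    exact fun u hu v hv => (mem_filter.1 hu).2.trans (mem_filter.1 hv).2.symm
  · rintro ⟨F, hF, h2, rfl⟩
    refine ⟨⟨_, isSubsystem_rootsOn F, isIrreducibleSystem_rootsOn h2, le_antisymm ?_ ?_⟩, _,
      supported_eq_span hF⟩
    · rw [supported_eq_span hF]
      refine Submodule.span_mono ?_
      rintro _ ⟨i, hi, rfl⟩
      obtain ⟨h3, h4⟩ := (mem_filter.1 (mem_coe.1 hi)).2
      exact ⟨_, h3, _, h4, i.castSucc_lt_succ.ne, simpleA_apply i⟩
    · rw [Submodule.span_le]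
      rintro _ ⟨s, hs, t, ht, hst, rfl⟩
      exact (rootA_mem_supported hst).2 ⟨hs, ht⟩

/-- The subspaces spanned by simple roots. -/
theorem mem_fund_spannedSubspaces {B : Submodule ℝ (hyperplaneA m)} :
    B ∈ fund (simpleA m) (spannedSubspaces (rootsA m)) ↔
      ∃ q, Monotone q ∧ ¬ Function.Injective q ∧ B = blockwise q := by
  constructor
  · rintro ⟨⟨Ψ, hΨ, ⟨α, hα⟩, hB⟩, I, hI⟩
    obtain ⟨q, hq, rfl⟩ := exists_monotone I
    rw [← blockwise_eq_span hq] at hI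
    obtain ⟨s, t, hst, rfl⟩ := hΨ hα
    exact ⟨q, hq, fun h => hst (h (rootA_mem_blockwise.1 (hI ▸ hB ▸ Submodule.subset_span hα))), hI⟩
  · rintro ⟨q, hq, hinj, rfl⟩
    refine ⟨⟨_, ?_, ?_, blockwise_eq_span hq⟩, _, blockwise_eq_span hq⟩
    · rintro _ ⟨i, -, rfl⟩
      exact ⟨_, _, i.castSucc_lt_succ.ne, simpleA_apply i⟩
    · obtain ⟨s, t, hst, hne⟩ : ∃ s t, q s = q t ∧ s < t := by
        rw [Function.not_injective_iff] at hinj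
        obtain ⟨s, t, h, hne⟩ := hinj
        rcases lt_or_gt_of_ne hne with h1 | h1
        · exact ⟨s, t, h, h1⟩
        · exact ⟨t, s, h.symm, h1⟩
      obtain ⟨i, rfl⟩ : ∃ i : Fin m, i.castSucc = s := ⟨s.castPred (Fin.ne_last_of_lt hne), by simp⟩
      refine ⟨_, i, le_antisymm (hq i.castSucc_le_succ) ?_, rfl⟩
      rw [hst]
      exact hq (Fin.castSucc_lt_iff_succ_le.1 hne)

theorem blockwise_eq_top {q : Fin (m + 1) → Fin (m + 1)} : blockwise q = ⊤ ↔ ¬ Nonconst q := by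
  constructor
  · rintro h ⟨s, t, hst⟩
    exact hst (rootA_mem_blockwise.1 (h ▸ Submodule.mem_top))
  · intro h
    rw [eq_top_iff]
    intro x _ v
    by_cases hv : ∃ s, q s = v
    · obtain ⟨s, rfl⟩ := hv
      rw [← sum_coords x, filter_true_of_mem]
      intro t _
      by_contra hts
      exact h ⟨t, s, hts⟩
    · exact sum_eq_zero fun s hs => absurd ⟨s, (mem_filter.1 hs).2⟩ hv

end Subspaces

end Permutoassoc

namespace Permutoassoc

open Finset Permutonest

/-! ### The half-spaces in coordinates -/

section HalfSpaces

variable {m : ℕ}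

/-- The number of elements of `F` above `s` minus the number of those below. -/
def excess (F : Finset (Fin (m + 1))) (s : Fin (m + 1)) : ℝ :=
  (#{t ∈ F | s < t} : ℝ) - #{t ∈ F | t < s}

theorem sum_pairs_eq (F : Finset (Fin (m + 1))) (x : Fin (m + 1) → ℝ) :
    (∑ s ∈ F, ∑ t ∈ F, if s < t then x s - x t else 0) = ∑ s ∈ F, x s * excess F s := by
  have h : ∀ s t, (if s < t then x s - x t else 0) =
      (if s < t then x s else 0) - if s < t then x t else 0 := by
    intro s t
    split_ifs <;> simp
  simp only [h, sum_sub_distrib]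
  rw [sum_comm (f := fun s t => if s < t then x t else 0), ← sum_sub_distrib]
  refine sum_congr rfl fun s _ => ?_
  rw [← sum_filter, ← sum_filter, sum_const, sum_const, excess, nsmul_eq_mul, nsmul_eq_mul]
  ring

theorem sum_excess (F : Finset (Fin (m + 1))) : ∑ s ∈ F, excess F s = 0 := by
  have h := sum_pairs_eq F fun _ => 1
  simp only [sub_self, ite_self, sum_const_zero, one_mul] at h
  exact h.symm

/-- An element outside an interval is on the same side of all the elements of the interval. Hence
the difference between δ and the candidate for its projection is constant on `F`, i.e. orthogonal to
the vectors supported on `F`. -/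
theorem excess_univ_sub_excess {F : Finset (Fin (m + 1))} (hF : IsInterval F) {s s' : Fin (m + 1)}
    (hs : s ∈ F) (hs' : s' ∈ F) :
    excess univ s - excess F s = excess univ s' - excess F s' := by
  have h1 : ∀ r, excess univ r - excess F r = (#{t ∈ Fᶜ | r < t} : ℝ) - #{t ∈ Fᶜ | t < r} := by
    intro r
    have h2 : ∀ p : Fin (m + 1) → Prop, ∀ [DecidablePred p],
        (#{t | p t} : ℝ) = #{t ∈ F | p t} + #{t ∈ Fᶜ | p t} := by
      intro p _
      rw [← Nat.cast_add, ← card_union_of_disjoint, ← filter_union, union_compl]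
      exact disjoint_filter_filter disjoint_compl_right
    rw [excess, excess, h2, h2]
    ring
  have h3 : ∀ t ∈ Fᶜ, (s < t ↔ s' < t) := by
    intro t ht
    rw [mem_compl] at ht
    constructor
    · intro h
      by_contra! hc
      exact ht (hF s t s' hs hs' h.le hc)
    · intro h
      by_contra! hc
      exact ht (hF s' t s hs' hs h.le hc)
  have h4 : ∀ t ∈ Fᶜ, (t < s ↔ t < s') := by
    intro t ht
    rw [mem_compl] at ht
    constructor
    · intro h
      by_contra! hc
      exact ht (hF s' t s hs' hs hc h.le)
    · intro h
      by_contra! hc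
      exact ht (hF s t s' hs hs' hc h.le)
  rw [h1, h1, filter_congr h3, filter_congr h4]

theorem inner_delta_eq_excess (x : hyperplaneA m) : ⟪x, delta (rootsA m) (simpleA m)⟫ =
    1 / 2 * ∑ s, coords m x s * excess univ s := by
  rw [inner_delta, sum_pairs_eq]

/-- The projection of `δ` to the span of an interval of simple roots. -/
theorem coords_piVec {F : Finset (Fin (m + 1))} (hF : IsInterval F) (s : Fin (m + 1)) :
    coords m (piVec (rootsA m) (simpleA m) (supported F)) s =
      if s ∈ F then 1 / 2 * excess F s else 0 := by
  obtain ⟨y, hy⟩ := exists_coords_eq (fun s => if s ∈ F then 1 / 2 * excess F s else 0) (by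
    rw [← sum_filter, filter_mem_eq_inter, univ_inter, ← mul_sum, sum_excess, mul_zero])
  have h1 : piVec (rootsA m) (simpleA m) (supported F) = y := by
    refine Submodule.eq_starProjection_of_mem_of_inner_eq_zero ?_ ?_
    · intro s hs
      rw [hy]
      exact if_neg hs
    · intro w hw
      rw [real_inner_comm, inner_sub_right, inner_delta_eq_excess, inner_eq_sum, hy]
      have h2 : ∑ s, coords m w s * excess univ s = ∑ s ∈ F, coords m w s * excess univ s :=
        (sum_subset (subset_univ F) fun s _ hs => by rw [hw s hs, zero_mul]).symm
      have h3 : (∑ s, coords m w s * if s ∈ F then 1 / 2 * excess F s else 0) =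
          ∑ s ∈ F, coords m w s * (1 / 2 * excess F s) := by
        simp only [mul_ite, mul_zero]
        rw [← sum_filter, filter_mem_eq_inter, univ_inter]
      have h4 : ∑ s ∈ F, coords m w s = 0 := by
        rw [← sum_coords w]
        exact sum_subset (subset_univ F) fun s _ hs => hw s hs
      rw [h2, h3, mul_sum, ← sum_sub_distrib]
      rcases F.eq_empty_or_nonempty with rfl | ⟨r, hr⟩
      · rfl
      · have h5 : ∀ s ∈ F, 1 / 2 * (coords m w s * excess univ s) -
            coords m w s * (1 / 2 * excess F s) =
            coords m w s * (1 / 2 * (excess univ r - excess F r)) := by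
          intro s hs
          rw [← excess_univ_sub_excess hF hs hr]
          ring
        rw [sum_congr rfl h5, ← sum_mul, h4, zero_mul]
  rw [h1, hy]

theorem inner_piVec {F : Finset (Fin (m + 1))} (hF : IsInterval F) (x : hyperplaneA m) :
    ⟪x, piVec (rootsA m) (simpleA m) (supported F)⟫ =
      1 / 2 * ∑ s ∈ F, ∑ t ∈ F, if s < t then coords m x s - coords m x t else 0 := by
  rw [inner_eq_sum, sum_pairs_eq, mul_sum]
  simp only [coords_piVec hF, mul_ite, mul_zero]
  rw [← sum_filter, filter_mem_eq_inter, univ_inter]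
  exact sum_congr rfl fun s _ => by ring

/-- The fibre of `q` over `v`. -/
def fiber (q : Fin (m + 1) → Fin (m + 1)) (v : Fin (m + 1)) : Finset (Fin (m + 1)) := {s | q s = v}

theorem mem_fiber {q : Fin (m + 1) → Fin (m + 1)} {v s : Fin (m + 1)} :
    s ∈ fiber q v ↔ q s = v := by
  rw [fiber, mem_filter]
  exact and_iff_right (mem_univ s)

/-- The blocks of `q` with at least two elements. -/
def largeBlocks (q : Fin (m + 1) → Fin (m + 1)) : Finset (Fin (m + 1)) := {v | 2 ≤ #(fiber q v)}

theorem sum_largeBlocks (q : Fin (m + 1) → Fin (m + 1)) (g : Finset (Fin (m + 1)) → ℝ)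
    (h0 : g ∅ = 0) (h1 : ∀ s, g {s} = 0) :
    ∑ v ∈ largeBlocks q, g (fiber q v) = ∑ v, g (fiber q v) := by
  refine sum_subset (subset_univ _) fun v _ hv => ?_
  have h2 : ¬ 2 ≤ #(fiber q v) := fun h => hv (mem_filter.2 ⟨mem_univ v, h⟩)
  have h3 : #(fiber q v) = 0 ∨ #(fiber q v) = 1 := by omega
  rcases h3 with h3 | h3
  · rw [card_eq_zero.1 h3, h0]
  · obtain ⟨s, hs⟩ := card_eq_one.1 h3
    rw [hs, h1]

/-- δ sums over all ordered pairs of positions, and the projection attached to a block accounts for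
the pairs inside it; removing these leaves the pairs in different blocks. Singleton blocks
contribute nothing. -/
theorem form_eq_inner {q : Fin (m + 1) → Fin (m + 1)} (hq : Monotone q) (x : hyperplaneA m) :
    form q (coords m x) = ⟪x, delta (rootsA m) (simpleA m) -
      ∑ v ∈ largeBlocks q, piVec (rootsA m) (simpleA m) (supported (fiber q v))⟫ := by
  rw [inner_sub_right, inner_sum, inner_delta]
  simp only [inner_piVec (isInterval_fiber hq _), fiber]
  rw [← mul_sum]
  have h1 := sum_largeBlocks q (fun F => ∑ s ∈ F, ∑ t ∈ F,
    if s < t then coords m x s - coords m x t else 0) (by simp) (by simp)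
  unfold fiber at h1
  rw [h1]
  have h2 : (∑ v, ∑ s with q s = v, ∑ t with q t = v,
      if s < t then coords m x s - coords m x t else 0) =
      ∑ s, ∑ t, if q t = q s then (if s < t then coords m x s - coords m x t else 0) else 0 := by
    refine Eq.trans ?_ (sum_fiberwise univ q _)
    refine sum_congr rfl fun v _ => sum_congr rfl fun s hs => ?_
    rw [sum_filter, (mem_filter.1 hs).2]
  rw [h2, ← mul_sub, form]
  congr 1
  rw [← sum_sub_distrib]
  refine sum_congr rfl fun s _ => ?_
  rw [← sum_sub_distrib]
  refine sum_congr rfl fun t _ => ?_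
  rcases lt_or_ge s t with h | h
  · rw [if_pos h]
    rcases (hq h.le).lt_or_eq with h3 | h3
    · rw [if_pos h3, if_neg h3.ne', sub_zero]
    · rw [if_pos h3.symm, if_neg h3.not_lt, sub_self]
  · rw [if_neg h.not_gt, if_neg (hq h).not_gt, ite_self, sub_zero]

/-- The list `ε` indexed by the size of a block instead of the dimension of its span. -/
def blockWeight (ε : ℕ → ℝ) (s : ℕ) : ℝ := if s < 2 then 0 else ε (s - 1)

theorem bound_eq_sub_sum (hm : 1 ≤ m) (ε : ℕ → ℝ) (q : Fin (m + 1) → Fin (m + 1)) :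
    bound (blockWeight ε) q = ε m - ∑ v ∈ largeBlocks q, ε (#(fiber q v) - 1) := by
  rw [bound, blockSum_eq_sum_image, blockWeight, if_neg (by omega), Nat.add_sub_cancel]
  congr 1
  have h1 : ∑ v ∈ largeBlocks q, ε (#(fiber q v) - 1) =
      ∑ v ∈ largeBlocks q, blockWeight ε #(fiber q v) := by
    refine sum_congr rfl fun v hv => ?_
    rw [blockWeight, if_neg (not_lt.2 (mem_filter.1 hv).2)]
  rw [h1, sum_largeBlocks q (fun F => blockWeight ε #F) (by simp [blockWeight])
    (by simp [blockWeight])]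
  refine sum_subset (subset_univ _) fun v _ hv => ?_
  rw [filter_false_of_mem fun s _ hs => hv (mem_image.2 ⟨s, mem_univ s, hs⟩), card_empty,
    blockWeight, if_pos (by norm_num)]

/-- The components of a subspace spanned by simple roots. -/
theorem components_blockwise {q : Fin (m + 1) → Fin (m + 1)} (hq : Monotone q) :
    components (fund (simpleA m) (irreducibleSubspaces (rootsA m))) (blockwise q) =
      (fun v => supported (fiber q v)) '' largeBlocks q := by
  have hmem : ∀ v ∈ largeBlocks q,
      supported (fiber q v) ∈ fund (simpleA m) (irreducibleSubspaces (rootsA m)) ∧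
      supported (fiber q v) ≤ blockwise q := by
    intro v hv
    refine ⟨mem_fund_irreducibleSubspaces.2 ⟨_, isInterval_fiber hq v, (mem_filter.1 hv).2, rfl⟩,
      supported_le_blockwise.2 fun s hs t ht => ?_⟩
    rw [mem_fiber.1 hs, mem_fiber.1 ht]
  ext A
  constructor
  · intro hA
    rw [components, Set.mem_ofPred_eq] at hA
    obtain ⟨hA1, hA2⟩ := hA.prop
    obtain ⟨F, hF, h2, rfl⟩ := mem_fund_irreducibleSubspaces.1 hA1
    rw [supported_le_blockwise] at hA2
    obtain ⟨s, hs⟩ := card_pos.1 (by omega : 0 < #F)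
    have h3 : F ⊆ fiber q (q s) := fun t ht => mem_fiber.2 (hA2 t ht s hs)
    have h4 : q s ∈ largeBlocks q := mem_filter.2 ⟨mem_univ _, h2.trans (card_le_card h3)⟩
    exact ⟨q s, mem_coe.2 h4, (hA.eq_of_le (hmem _ h4) ((supported_le_supported h2).2 h3)).symm⟩
  · rintro ⟨v, hv, rfl⟩
    refine ⟨hmem v hv, fun C hC hle => ?_⟩
    obtain ⟨F, hF, h2, rfl⟩ := mem_fund_irreducibleSubspaces.1 hC.1
    have h3 := (mem_filter.1 (mem_coe.1 hv)).2
    have h4 := (supported_le_supported h3).1 hle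
    obtain ⟨s, hs⟩ := card_pos.1 (by omega : 0 < #(fiber q v))
    refine (supported_le_supported h2).2 fun t ht => mem_fiber.2 ?_
    rw [supported_le_blockwise.1 hC.2 t ht s (h4 hs), mem_fiber.1 hs]

theorem mem_halfSpaceBar (hm : 1 ≤ m) (ε : ℕ → ℝ) {q : Fin (m + 1) → Fin (m + 1)}
    (hq : Monotone q) (x : hyperplaneA m) :
    x ∈ halfSpaceBar (rootsA m) (simpleA m) (irreducibleSubspaces (rootsA m)) ε (blockwise q) ↔
      form q (coords m x) ≤ bound (blockWeight ε) q := by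
  have hinj : Set.InjOn (fun v => supported (fiber q v)) (largeBlocks q : Set (Fin (m + 1))) := by
    intro v hv w hw h
    have h3 := (mem_filter.1 (mem_coe.1 hv)).2
    have h4 := (supported_le_supported h3).1 (le_of_eq h)
    obtain ⟨s, hs⟩ := card_pos.1 (by omega : 0 < #(fiber q v))
    rw [← mem_fiber.1 hs, mem_fiber.1 (h4 hs)]
  unfold halfSpaceBar
  rw [Set.mem_ofPred_eq]
  rw [components_blockwise hq, finsum_mem_image hinj, finsum_mem_image hinj,
    finsum_mem_coe_finset, finsum_mem_coe_finset, ← form_eq_inner hq, bound_eq_sub_sum hm]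
  rw [sum_congr rfl fun v hv => by
    rw [finrank_supported (F := fiber q v) (isInterval_fiber hq v)
      (card_pos.1 (lt_of_lt_of_le two_pos (mem_filter.1 hv).2))]]

theorem components_eq_singleton {V : Type*} [NormedAddCommGroup V] [InnerProductSpace ℝ V]
    {G : Set (Submodule ℝ V)} {A : Submodule ℝ V} (hA : A ∈ G) : components G A = {A} := by
  ext C
  rw [Set.mem_singleton_iff]
  constructor
  · intro hC
    rw [components, Set.mem_ofPred_eq] at hC
    exact hC.eq_of_le ⟨hA, le_rfl⟩ hC.prop.2
  · rintro rfl
    exact ⟨⟨hA, le_rfl⟩, fun D hD _ => hD.2⟩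

/-- A member of the minimal building set is its own only component, so apart from `V` the two kinds
of half-spaces are given by one formula. -/
theorem mem_halfSpace_iff {ε : ℕ → ℝ} {A : Submodule ℝ (hyperplaneA m)}
    (hA : A ∈ fund (simpleA m) (irreducibleSubspaces (rootsA m))) (htop : A ≠ ⊤)
    (x : hyperplaneA m) : x ∈ halfSpace (rootsA m) (simpleA m) ε A ↔
      x ∈ halfSpaceBar (rootsA m) (simpleA m) (irreducibleSubspaces (rootsA m)) ε A := by
  unfold halfSpace halfSpaceBar
  rw [components_eq_singleton hA, finsum_mem_singleton, finsum_mem_singleton]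
  exact ⟨fun h => h.2 htop, fun h => ⟨fun hc => absurd hc htop, fun _ => h⟩⟩

theorem fund_irreducible_subset :
    fund (simpleA m) (irreducibleSubspaces (rootsA m)) ⊆
      fund (simpleA m) (spannedSubspaces (rootsA m)) := by
  rintro A ⟨⟨Ψ, h1, h2, h3⟩, h4⟩
  exact ⟨⟨Ψ, h1.1, h2.1, h3⟩, h4⟩

theorem top_mem_fund (hm : 1 ≤ m) :
    (⊤ : Submodule ℝ (hyperplaneA m)) ∈ fund (simpleA m) (irreducibleSubspaces (rootsA m)) := by
  refine mem_fund_irreducibleSubspaces.2 ⟨univ, fun s t u _ _ _ _ => mem_univ t, ?_, ?_⟩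
  · rw [card_univ, Fintype.card_fin]
    omega
  · exact (eq_top_iff.2 fun x _ s hs => absurd (mem_univ s) hs).symm

/-- The half-space of `V` belongs to the partition into singletons, not to the constant one: no
projection is subtracted from δ. -/
theorem mem_halfSpace_top (hm : 1 ≤ m) {ε : ℕ → ℝ} {q : Fin (m + 1) → Fin (m + 1)}
    (hq : Monotone q) (hinj : Function.Injective q) (x : hyperplaneA m) :
    x ∈ halfSpace (rootsA m) (simpleA m) ε ⊤ ↔
      form q (coords m x) ≤ bound (blockWeight ε) q := by
  have h1 : largeBlocks q = ∅ := by
    refine filter_false_of_mem fun v _ h => ?_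
    obtain ⟨s, hs, t, ht, hst⟩ := one_lt_card.1 h
    exact hst (hinj ((mem_fiber.1 hs).trans (mem_fiber.1 ht).symm))
  rw [form_eq_inner hq, bound_eq_sub_sum hm, h1, sum_empty, sum_empty, sub_zero, sub_zero]
  exact ⟨fun h => h.1 rfl, fun h => ⟨fun _ => h, fun hc => absurd rfl hc⟩⟩

/-- The half-spaces of the fundamental chamber. -/
theorem forall_mem_halfSpace_iff (hm : 1 ≤ m) (ε : ℕ → ℝ) (x : hyperplaneA m) :
    ((∀ A ∈ fund (simpleA m) (irreducibleSubspaces (rootsA m)),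
        x ∈ halfSpace (rootsA m) (simpleA m) ε A) ∧
      ∀ B ∈ fund (simpleA m) (spannedSubspaces (rootsA m)) \
          fund (simpleA m) (irreducibleSubspaces (rootsA m)),
        x ∈ halfSpaceBar (rootsA m) (simpleA m) (irreducibleSubspaces (rootsA m)) ε B) ↔
    ∀ q : Fin (m + 1) → Fin (m + 1), Monotone q → Nonconst q →
      form q (coords m x) ≤ bound (blockWeight ε) q := by
  constructor
  · rintro ⟨h1, h2⟩ q hq hnc
    by_cases hinj : Function.Injective q
    · exact (mem_halfSpace_top hm hq hinj x).1 (h1 _ (top_mem_fund hm))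
    · rw [← mem_halfSpaceBar hm ε hq]
      by_cases hmem : blockwise q ∈ fund (simpleA m) (irreducibleSubspaces (rootsA m))
      · exact (mem_halfSpace_iff hmem (fun hc => blockwise_eq_top.1 hc hnc) x).1 (h1 _ hmem)
      · exact h2 _ ⟨mem_fund_spannedSubspaces.2 ⟨q, hq, hinj, rfl⟩, hmem⟩
  · intro h
    have hbar : ∀ B ∈ fund (simpleA m) (spannedSubspaces (rootsA m)), B ≠ ⊤ →
        x ∈ halfSpaceBar (rootsA m) (simpleA m) (irreducibleSubspaces (rootsA m)) ε B := by
      intro B hB htop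
      obtain ⟨q, hq, -, rfl⟩ := mem_fund_spannedSubspaces.1 hB
      refine (mem_halfSpaceBar hm ε hq x).2 (h q hq ?_)
      by_contra hc
      exact htop (blockwise_eq_top.2 hc)
    refine ⟨fun A hA => ?_, fun B hB => hbar B hB.1 fun hc => hB.2 (hc ▸ top_mem_fund hm)⟩
    by_cases htop : A = ⊤
    · subst htop
      refine (mem_halfSpace_top hm monotone_id Function.injective_id x).2 (h id monotone_id ?_)
      exact ⟨0, Fin.last m, fun hc => by
        have := congrArg Fin.val hc
        simp only [id_eq, Fin.val_zero, Fin.val_last] at this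
        omega⟩
    · exact (mem_halfSpace_iff hA htop x).2 (hbar A (fund_irreducible_subset hA) htop)

/-- The permutonestohedron in terms of the ordered partitions. -/
theorem minimalPermutonestohedronA_eq (hm : 1 ≤ m) (ε : ℕ → ℝ) :
    minimalPermutonestohedronA m ε =
      polyhedron (formOn (coords m)) fun q => bound (blockWeight ε) q.1 := by
  have himg : ∀ (σ : hyperplaneA m ≃ₗᵢ[ℝ] hyperplaneA m) (H : Set (hyperplaneA m))
      (x : hyperplaneA m), x ∈ σ '' H ↔ σ⁻¹ x ∈ H := by
    intro σ H x
    constructor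
    · rintro ⟨y, hy, rfl⟩
      rwa [show σ⁻¹ (σ y) = y from σ.symm_apply_apply y]
    · exact fun h => ⟨σ⁻¹ x, h, σ.apply_symm_apply x⟩
  ext x
  unfold minimalPermutonestohedronA permutonestohedron
  simp only [Set.mem_iInter, Set.mem_inter_iff, himg]
  simp only [forall_mem_halfSpace_iff hm]
  constructor
  · rintro h ⟨q, hq⟩
    -- An arbitrary ordered partition becomes monotone after sorting the coordinates, and the
    -- sorting permutation is realized in the Weyl group.
    obtain ⟨σ, hσ, hστ⟩ := exists_mem_weylGroup (m := m) (Tuple.sort q)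
    have h1 := h σ⁻¹ (inv_mem hσ) (q ∘ Tuple.sort q) (Tuple.monotone_sort q) (by
      obtain ⟨s, t, hst⟩ := hq
      exact ⟨(Tuple.sort q).symm s, (Tuple.sort q).symm t, by simpa using hst⟩)
    rw [inv_inv, show coords m (σ x) = coords m x ∘ Tuple.sort q from funext (hστ x),
      form_comp_perm, bound_comp_perm] at h1
    exact h1
  · intro h σ hσ q hq hnc
    obtain ⟨τ, hτ⟩ := exists_perm_of_mem_weylGroup (inv_mem hσ)
    rw [show coords m (σ⁻¹ x) = coords m x ∘ τ from funext (hτ x)]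
    have h1 := h ⟨q ∘ τ.symm, by
      obtain ⟨s, t, hst⟩ := hnc
      exact ⟨τ s, τ t, by simpa using hst⟩⟩
    have h2 := form_comp_perm (q ∘ τ.symm) (coords m x) τ
    have h3 := bound_comp_perm (blockWeight ε) (q ∘ τ.symm) τ
    rw [show (q ∘ τ.symm) ∘ τ = q from funext fun s => by simp] at h2 h3
    rw [h2, h3]
    exact h1

end HalfSpaces

end Permutoassoc

namespace Permutoassoc

open Finset Permutonest

/-! ### Suitable lists -/

section Suitable

variable {m : ℕ}

theorem isInterval_Iic (N : Fin (m + 1)) : IsInterval (Iic N) :=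
  fun _ _ _ _ hu _ htu => mem_Iic.2 (htu.trans (mem_Iic.1 hu))

theorem excess_Iic {N t : Fin (m + 1)} (h : t ≤ N) : excess (Iic N) t = (N : ℝ) - 2 * t := by
  have h1 : (Iic N).filter (fun u => t < u) = Ioc t N := by
    ext u
    rw [mem_filter, mem_Iic, mem_Ioc, and_comm]
  have h2 : (Iic N).filter (fun u => u < t) = Iio t := by
    ext u
    rw [mem_filter, mem_Iic, mem_Iio]
    exact and_iff_right_of_imp fun hu => (hu.trans_le h).le
  rw [excess, h1, h2, Fin.card_Ioc, Fin.card_Iio, Nat.cast_sub (Fin.le_def.1 h)]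
  ring

theorem simpleA_mem_supported_Iic {N : Fin (m + 1)} {i : Fin m} :
    simpleA m i ∈ supported (Iic N) ↔ i.succ ≤ N := by
  rw [simpleA_apply, rootA_mem_supported i.castSucc_lt_succ.ne, mem_Iic, mem_Iic]
  exact and_iff_right_of_imp fun h => i.castSucc_le_succ.trans h

/-- The coefficients of the projection of `δ` to the span of the first simple roots. -/
theorem repr_piVec_Iic {N : Fin (m + 1)} {i : Fin m} (h : i.succ ≤ N) :
    (simpleA m).repr (piVec (rootsA m) (simpleA m) (supported (Iic N))) i =
      1 / 2 * (((i : ℝ) + 1) * (N - i)) := by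
  have h1 : ∀ l ∈ Iic i.castSucc, coords m (piVec (rootsA m) (simpleA m) (supported (Iic N))) l =
      1 / 2 * ((N : ℝ) - 2 * ((Fin.valEmbedding l : ℕ) : ℝ)) := by
    intro l hl
    have hlN : l ≤ N := ((mem_Iic.1 hl).trans i.castSucc_le_succ).trans h
    rw [coords_piVec (isInterval_Iic N), if_pos (mem_Iic.2 hlN), excess_Iic hlN]
    rfl
  have h2 : ∀ k : ℕ, ∑ l ∈ range (k + 1), ((N : ℝ) - 2 * (l : ℝ)) = (k + 1) * (N - k) := by
    intro k
    induction k with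
    | zero => simp
    | succ k ih =>
      rw [sum_range_succ, ih]
      push_cast
      ring
  rw [repr_simpleA, sum_congr rfl h1, ← mul_sum,
    ← sum_map (Iic i.castSucc) Fin.valEmbedding fun l : ℕ => (N : ℝ) - 2 * (l : ℝ),
    Fin.map_valEmbedding_Iic, ← Nat.range_succ_eq_Iic, h2]
  rfl

/-- Finitely many pairs of index sets give the ratios; without boundedness the supremum in
`maxRatio` would not dominate its members. -/
theorem bddAbove_ratio (i j : ℕ) :
    BddAbove {c | ∃ A ∈ fund (simpleA m) (irreducibleSubspaces (rootsA m)),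
      ∃ B ∈ fund (simpleA m) (irreducibleSubspaces (rootsA m)), B < A ∧
        Module.finrank ℝ A = i ∧ Module.finrank ℝ B = j ∧
        c = ratio (rootsA m) (simpleA m) A B} := by
  refine ((Set.finite_range fun d : Finset (Fin (m + 1)) × Finset (Fin (m + 1)) =>
    ratio (rootsA m) (simpleA m) (supported d.1) (supported d.2)).subset ?_).bddAbove
  rintro _ ⟨A, hA, B, hB, -, -, -, rfl⟩
  obtain ⟨F, -, -, rfl⟩ := mem_fund_irreducibleSubspaces.1 hA
  obtain ⟨F', -, -, rfl⟩ := mem_fund_irreducibleSubspaces.1 hB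
  exact ⟨(F, F'), rfl⟩

/-- Test the maximum on the spans of the first `s` and the first `s - 1` simple roots. The
projection on the larger one has a coefficient ½ab for every splitting a + b = s + 1, and on the
smaller one the end coefficient is ½(s - 1). -/
theorem mul_le_mul_maxRatio {s a b : ℕ} (hs : 2 ≤ s) (hsm : s ≤ m) (hab : a + b = s + 1)
    (ha : 1 ≤ a) (hb : 1 ≤ b) : (a : ℝ) * b ≤
      ((s : ℝ) - 1) * maxRatio (rootsA m) (simpleA m) (irreducibleSubspaces (rootsA m)) s (s - 1) := by
  set N : Fin (m + 1) := ⟨s, by omega⟩ with hN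
  set M : Fin (m + 1) := ⟨s - 1, by omega⟩ with hM
  have hcN : #(Iic N) = s + 1 := Fin.card_Iic N
  have hcM : #(Iic M) = s - 1 + 1 := Fin.card_Iic M
  have hs1 : ((s - 1 : ℕ) : ℝ) = (s : ℝ) - 1 := by
    rw [Nat.cast_sub (by omega), Nat.cast_one]
  have hs0 : (0 : ℝ) < (s : ℝ) - 1 := by
    rw [← hs1]
    exact_mod_cast (by omega : 0 < s - 1)
  have h1 : ratio (rootsA m) (simpleA m) (supported (Iic N)) (supported (Iic M)) ≤
      maxRatio (rootsA m) (simpleA m) (irreducibleSubspaces (rootsA m)) s (s - 1) := by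
    refine le_csSup (bddAbove_ratio _ _) ⟨_, mem_fund_irreducibleSubspaces.2
      ⟨Iic N, isInterval_Iic N, by omega, rfl⟩, _, mem_fund_irreducibleSubspaces.2
      ⟨Iic M, isInterval_Iic M, by omega, rfl⟩, ?_, ?_, ?_, rfl⟩
    · refine lt_of_le_not_ge ((supported_le_supported (by omega)).2 ?_) fun h => ?_
      · exact Iic_subset_Iic.2 (Fin.mk_le_mk.2 (by omega))
      · have := card_le_card ((supported_le_supported (by omega)).1 h)
        omega
    · rw [finrank_supported (isInterval_Iic N) (card_pos.1 (by omega)), hcN, Nat.add_sub_cancel]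
    · rw [finrank_supported (isInterval_Iic M) (card_pos.1 (by omega)), hcM, Nat.add_sub_cancel]
  have h2 : 1 / 2 * ((a : ℝ) * b) ≤
      ⨆ i : {i : Fin m // simpleA m i ∈ supported (Iic N)},
        (simpleA m).repr (piVec (rootsA m) (simpleA m) (supported (Iic N))) i := by
    have hi : (⟨a - 1, by omega⟩ : Fin m).succ ≤ N := Fin.mk_le_mk.2 (by omega)
    refine le_trans (le_of_eq ?_) (le_ciSup (Set.finite_range _).bddAbove
      ⟨⟨a - 1, by omega⟩, simpleA_mem_supported_Iic.2 hi⟩)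
    rw [repr_piVec_Iic hi]
    have h3 : (a : ℝ) + b = s + 1 := by exact_mod_cast hab
    have h4 : ((a - 1 : ℕ) : ℝ) = (a : ℝ) - 1 := by rw [Nat.cast_sub ha, Nat.cast_one]
    simp only [hN, h4]
    rw [show (b : ℝ) = s + 1 - a by linarith]
    ring
  have h0 : (⟨0, by omega⟩ : Fin m).succ ≤ M := Fin.mk_le_mk.2 (by omega)
  have h3 : (⨅ j : {j : Fin m // simpleA m j ∈ supported (Iic M)},
      (simpleA m).repr (piVec (rootsA m) (simpleA m) (supported (Iic M))) j) ≤
      1 / 2 * ((s : ℝ) - 1) := by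
    refine (ciInf_le (Set.finite_range _).bddBelow
      ⟨⟨0, by omega⟩, simpleA_mem_supported_Iic.2 h0⟩).trans (le_of_eq ?_)
    rw [repr_piVec_Iic h0]
    simp only [hM, hs1, Nat.cast_zero]
    ring
  -- An upper bound for the infimum gives a lower bound for the ratio only because the infimum is
  -- positive.
  have h4 : 0 < ⨅ j : {j : Fin m // simpleA m j ∈ supported (Iic M)},
      (simpleA m).repr (piVec (rootsA m) (simpleA m) (supported (Iic M))) j := by
    have : Nonempty {j : Fin m // simpleA m j ∈ supported (Iic M)} :=
      ⟨⟨⟨0, by omega⟩, simpleA_mem_supported_Iic.2 h0⟩⟩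
    obtain ⟨⟨j, hj⟩, hjeq⟩ := exists_eq_ciInf_of_finite
      (f := fun j : {j : Fin m // simpleA m j ∈ supported (Iic M)} =>
        (simpleA m).repr (piVec (rootsA m) (simpleA m) (supported (Iic M))) j)
    rw [← hjeq, repr_piVec_Iic (simpleA_mem_supported_Iic.1 hj)]
    have h5 : (j : ℕ) + 1 ≤ M := Fin.le_def.1 (simpleA_mem_supported_Iic.1 hj)
    have h6 : ((j : ℕ) : ℝ) + 1 ≤ (M : ℕ) := by exact_mod_cast h5
    have h7 : (0 : ℝ) < (M : ℕ) - (j : ℕ) := by linarith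
    positivity
  have h5 : (a : ℝ) * b / ((s : ℝ) - 1) ≤
      ratio (rootsA m) (simpleA m) (supported (Iic N)) (supported (Iic M)) := by
    rw [ratio, div_le_div_iff₀ hs0 h4]
    have h6 := mul_le_mul_of_nonneg_left h3 (by positivity : (0 : ℝ) ≤ a * b)
    have h7 := mul_le_mul_of_nonneg_right h2 hs0.le
    linarith
  rw [← div_le_iff₀' hs0]
  exact h5.trans h1

/-- The inequalities between the entries of a suitable list. -/
theorem growth_blockWeight (hm : 1 ≤ m) {ε : ℕ → ℝ}
    (hε : IsSuitable (rootsA m) (simpleA m) (irreducibleSubspaces (rootsA m)) ε) :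
    Growth (m + 1) (blockWeight ε) where
  zero := if_pos (by norm_num)
  one := if_pos (by norm_num)
  two_pos _ := by
    rw [blockWeight, if_neg (by norm_num)]
    exact hε.pos 1 le_rfl hm
  step s a b hs hn hab ha hb := by
    rw [blockWeight, blockWeight, if_neg (by omega), if_neg (by omega), Nat.add_sub_cancel]
    have h1 := mul_le_mul_maxRatio hs (by omega) hab ha hb (m := m)
    have h2 := hε.two_mul_lt s hs (by omega)
    have h3 := hε.pos (s - 1) (by omega) (by omega)
    have h4 : (0 : ℝ) < (s : ℝ) - 1 := by
      have : (2 : ℝ) ≤ s := by exact_mod_cast hs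
      linarith
    have h5 := mul_le_mul_of_nonneg_right h1 h3.le
    have h6 := mul_lt_mul_of_pos_left h2 h4
    linarith

end Suitable

end Permutoassoc
-- Assembling the count
theorem mainTheorem9 (n k : ℕ) (hk : k + 2 ≤ n) (ε : ℕ → ℝ)
    (hε : Permutonest.IsSuitable (Permutonest.rootsA (n - 1)) (Permutonest.simpleA (n - 1))
      (Permutonest.irreducibleSubspaces (Permutonest.rootsA (n - 1))) ε) :
    (Permutonest.facesOfCodim
      (Permutonest.minimalPermutonestohedronA (n - 1) ε) (k + 1)).Finite ∧
    ((Permutonest.facesOfCodim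
      (Permutonest.minimalPermutonestohedronA (n - 1) ε) (k + 1)).ncard : ℚ) =
      ∑ p : n.Partition with k + 2 ≤ p.parts.card,
        Permutonest.partitionWeight p * Permutonest.partitionMultinomial p *
          (1 / ((k : ℚ) + 1) * ((p.parts.card - 2).choose k : ℚ) *
            ((p.parts.card + k).choose k : ℚ)) := by
  obtain ⟨m, rfl⟩ : ∃ m, n = m + 1 := ⟨n - 1, by omega⟩
  rw [Nat.add_sub_cancel] at hε ⊢
  have hm : 1 ≤ m := by omega
  obtain ⟨h1, h2⟩ := Permutoassoc.ncard_facesOfCodim (Permutoassoc.growth_blockWeight hm hε)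
    (Permutoassoc.coords m) Permutoassoc.exists_coords_eq k
  rw [Permutoassoc.minimalPermutonestohedronA_eq hm]
  refine ⟨h1, ?_⟩
  -- Group the partitions by their number of parts `l`, to match the sum over the number of layers.
  -- For `l < k + 2` there are no bracketings, so the restriction on the number of parts costs
  -- nothing.
  rw [h2, Nat.cast_sum, Finset.sum_filter,
    ← Finset.sum_fiberwise_of_maps_to (g := fun p : (m + 1).Partition => p.parts.card)
      (t := Finset.range (m + 1 + 1))]
  · refine Finset.sum_congr rfl fun l _ => ?_
    rw [Nat.cast_mul, Permutoassoc.card_layerings_eq_sum_partition, Finset.sum_mul]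
    refine Finset.sum_congr rfl fun p hp => ?_
    rw [(Finset.mem_filter.1 hp).2]
    split_ifs with hl
    · rw [Permutoassoc.card_bracketings hl]
    · rw [Permutoassoc.card_bracketings_eq_zero (not_le.1 hl), Nat.cast_zero, mul_zero]
  · intro p _
    rw [Finset.mem_range, Nat.lt_succ_iff]
    calc p.parts.card = p.parts.card • 1 := by simp
      _ ≤ p.parts.sum := Multiset.card_nsmul_le_sum fun i hi => p.parts_pos hi
      _ = m + 1 := p.parts_sum
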